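/- Let $G=(V,E)$ be a finite simple graph with $n$ vertices and edge weights $w:E\to\mathbb{N}$. Write $W$ for the maximum edge weight and $\Delta$ for the maximum (unweighted) degree of $G$ (both $0$ if there are no edges). A cut is a partition of $V$ into two (possibly empty) sets $V_0,V_1$; its weight is the total weight of the edges between $V_0$ and $V_1$. It is stable if for every $i\in\{0,1\}$ and every $v\in V_i$, $$\sum_{vu\in E,\ u\in V_{1-i}} w(vu)\ \ge\ \frac12\sum_{vu\in E} w(vu).$$ In Min Stable Cut one has to find a stable cut whose weight is minimum among all stable cuts. **Theorem 3.5.** There is an algorithm which, given such a graph $G$ with weights $w$ and a tree decomposition of $G$ of width $\mathrm{tw}$, finds an optimal solution of Min Stable Cut in time $$(\Delta\cdot W)^{O(\mathrm{tw})}\,n^{O(1)}.$$ Precisely: there are a program for a random access machine (with unit-cost addition, truncated subtraction, zero tests and indirect memory access on natural numbers, and without multiplication) and a constant $C$ such that, for every weighted graph $G$ with $n$ vertices and every tree decomposition of $G$ with $N$ nodes and width $\mathrm{tw}$, the program, given the graph and the decomposition by their matrices, halts after at most $$C\cdot\max(1,\Delta\cdot W)^{C\cdot\mathrm{tw}}\cdot(n+N)^{C}$$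 steps and outputs a stable cut of minimum weight. In particular the polynomial factor is $n^{O(1)}$ when, as usual, the given decomposition has $n^{O(1)}$ nodes. (For the graph without vertices, $\mathrm{tw}$ is read as $0$.) -/

import Mathlib

namespace MinStableCut

/-! ### Stable cuts of edge-weighted graphs

An edge-weighted graph is a simple graph `G` with a weight function `w` on unordered pairs, of
which only the values on edges of `G` are ever used. A cut is a function `c : V → Bool`, with
sides `{v | c v = false}` and `{v | c v = true}`. -/

section Cuts

variable {V : Type*} [Fintype V]

open Classical in
/-- The weighted degree of `v`. -/
noncomputable def weightedDegree (G : SimpleGraph V) (w : Sym2 V → ℕ) (v : V) : ℕ :=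
  ∑ u with G.Adj v u, w s(v, u)

open Classical in
/-- The total weight of the edges at `v` whose other endpoint is on the other side of the cut. -/
noncomputable def crossingWeight (G : SimpleGraph V) (w : Sym2 V → ℕ) (c : V → Bool) (v : V) : ℕ :=
  ∑ u with G.Adj v u ∧ c u ≠ c v, w s(v, u)

/-- The cut is stable for every vertex: at least half of its weighted degree is cut. -/
def IsStable (G : SimpleGraph V) (w : Sym2 V → ℕ) (c : V → Bool) : Prop :=
  ∀ v, weightedDegree G w v ≤ 2 * crossingWeight G w c v

open Classical in
/-- The total weight of the edges with endpoints on both sides of the cut. -/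
noncomputable def cutWeight (G : SimpleGraph V) (w : Sym2 V → ℕ) (c : V → Bool) : ℕ :=
  ∑ e ∈ G.edgeFinset with ∃ u ∈ e, ∃ v ∈ e, c u ≠ c v, w e

/-- An optimal solution of Min Stable Cut: a stable cut of minimum weight among stable cuts. -/
def IsMinStableCut (G : SimpleGraph V) (w : Sym2 V → ℕ) (c : V → Bool) : Prop :=
  IsStable G w c ∧ ∀ c' : V → Bool, IsStable G w c' → cutWeight G w c ≤ cutWeight G w c'

open Classical in
/-- The maximum (unweighted) degree of the graph. -/
noncomputable def maxDeg (G : SimpleGraph V) : ℕ := G.maxDegree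

open Classical in
/-- The maximum edge weight, `0` if there are no edges. -/
noncomputable def maxWeight (G : SimpleGraph V) (w : Sym2 V → ℕ) : ℕ := G.edgeFinset.sup w

end Cuts

/-- A tree decomposition of `G` whose tree has node set `ι`. -/
structure TreeDecomposition {V : Type*} (G : SimpleGraph V) (ι : Type*) where
  /-- the tree -/
  tree : SimpleGraph ι
  isTree : tree.IsTree
  /-- the bags -/
  bag : ι → Finset V
  vertex_mem_bag : ∀ v, ∃ t, v ∈ bag t
  edge_mem_bag : ∀ u v, G.Adj u v → ∃ t, u ∈ bag t ∧ v ∈ bag t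
  /-- the nodes whose bags contain a given vertex induce a connected subtree -/
  preconnected : ∀ v, (tree.induce {t | v ∈ bag t}).Preconnected

/-- The maximum size of a bag, minus one. (The truncation at `0` only matters for the graph
without vertices.) -/
def TreeDecomposition.width {V : Type*} {G : SimpleGraph V} {ι : Type*} [Fintype ι]
    (D : TreeDecomposition G ι) : ℕ :=
  (Finset.univ.sup fun t => (D.bag t).card) - 1

/-! ### Random access machines

Structured programs of a random access machine with natural number registers and
one-dimensional, randomly accessible arrays of natural numbers, indexed from `0`. A program names
finitely many registers and arrays. The arithmetic is addition and truncated subtraction (there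
is no multiplication), and every elementary operation takes one step, so that the machine is
polynomially equivalent to a Turing machine. -/

/-- Arithmetic expressions. -/
inductive RamExpr : Type
  /-- a numeral of the program text -/
  | const (k : ℕ)
  /-- the content of register `r` -/
  | reg (r : ℕ)
  /-- the entry of array `a` at the index given by the value of `i` -/
  | get (a : ℕ) (i : RamExpr)
  /-- addition -/
  | add (x y : RamExpr)
  /-- truncated subtraction -/
  | sub (x y : RamExpr)

/-- Programs. A test succeeds if its value is not `0`. -/
inductive RamProgram : Type
  /-- do nothing -/
  | skip
  /-- write the value of `x` to register `r` -/
  | set (r : ℕ) (x : RamExpr)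
  /-- write the value of `x` to array `a` at the index given by the value of `i` -/
  | put (a : ℕ) (i x : RamExpr)
  /-- `p`, then `q` -/
  | seq (p q : RamProgram)
  /-- `p` if the value of `x` is not `0`, else `q` -/
  | ite (x : RamExpr) (p q : RamProgram)
  /-- repeat `p` as long as the value of `x` is not `0` -/
  | loop (x : RamExpr) (p : RamProgram)

/-- The content of all registers and arrays: `arr a i` is the entry of array `a` at index `i`. -/
structure RamState where
  reg : ℕ → ℕ
  arr : ℕ → ℕ → ℕ

/-- The value of an expression. -/
def RamExpr.eval (s : RamState) : RamExpr → ℕ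
  | const k => k
  | reg r => s.reg r
  | get a i => s.arr a (i.eval s)
  | add x y => x.eval s + y.eval s
  | sub x y => x.eval s - y.eval s

/-- The number of steps for evaluating an expression: one for each operation in it. -/
def RamExpr.cost : RamExpr → ℕ
  | const _ => 1
  | reg _ => 1
  | get _ i => i.cost + 1
  | add x y => x.cost + y.cost + 1
  | sub x y => x.cost + y.cost + 1

/-- The state after writing `k` to register `r`. -/
def RamState.setReg (s : RamState) (r k : ℕ) : RamState :=
  ⟨Function.update s.reg r k, s.arr⟩

/-- The state after writing `k` to array `a` at index `i`. -/
def RamState.setArr (s : RamState) (a i k : ℕ) : RamState :=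
  ⟨s.reg, Function.update s.arr a (Function.update (s.arr a) i k)⟩

/-- `Runs p s s' t`: started in state `s`, the program `p` halts after `t` steps in state `s'`. -/
inductive Runs : RamProgram → RamState → RamState → ℕ → Prop
  | skip (s : RamState) : Runs .skip s s 1
  | set (s : RamState) (r : ℕ) (x : RamExpr) :
      Runs (.set r x) s (s.setReg r (x.eval s)) (x.cost + 1)
  | put (s : RamState) (a : ℕ) (i x : RamExpr) :
      Runs (.put a i x) s (s.setArr a (i.eval s) (x.eval s)) (i.cost + x.cost + 1)
  | seq {p q : RamProgram} {s s' s'' : RamState} {t t' : ℕ} :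
      Runs p s s' t → Runs q s' s'' t' → Runs (.seq p q) s s'' (t + t')
  | ite_true {x : RamExpr} {p q : RamProgram} {s s' : RamState} {t : ℕ} :
      x.eval s ≠ 0 → Runs p s s' t → Runs (.ite x p q) s s' (x.cost + 1 + t)
  | ite_false {x : RamExpr} {p q : RamProgram} {s s' : RamState} {t : ℕ} :
      x.eval s = 0 → Runs q s s' t → Runs (.ite x p q) s s' (x.cost + 1 + t)
  | loop_stop {x : RamExpr} {p : RamProgram} {s : RamState} :
      x.eval s = 0 → Runs (.loop x p) s s (x.cost + 1)
  | loop_step {x : RamExpr} {p : RamProgram} {s s' s'' : RamState} {t t' : ℕ} :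
      x.eval s ≠ 0 → Runs p s s' t → Runs (.loop x p) s' s'' t' →
      Runs (.loop x p) s s'' (x.cost + 1 + t + t')

/-! ### Input and output -/

/-- A matrix as an array in row-major order, followed by zeros. -/
def rowMajor {m k : ℕ} (f : Fin m → Fin k → ℕ) (a : ℕ) : ℕ :=
  if h : a < m * k then
    f (finProdFinEquiv.symm ⟨a, h⟩).1 (finProdFinEquiv.symm ⟨a, h⟩).2
  else 0

theorem rowMajor_apply {m k : ℕ} (f : Fin m → Fin k → ℕ) (i : Fin m) (j : Fin k) :
    rowMajor f (i * k + j) = f i j := by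
  have e : (i * k + j : ℕ) = (finProdFinEquiv (i, j) : Fin (m * k)) := by
    simp [finProdFinEquiv, add_comm, mul_comm]
  rw [e, rowMajor, dif_pos (finProdFinEquiv (i, j)).isLt]
  simp only [Fin.eta, Equiv.symm_apply_apply]

open Classical in
/-- The initial state for a weighted graph on `n` vertices with a tree decomposition on `N`
nodes. Registers `0` and `1` hold `n` and `N`; arrays `0` to `3` hold the adjacency matrix of the
graph, its weight matrix, the adjacency matrix of the tree, and the incidence matrix of nodes
(rows) and vertices (columns). Everything else is `0`. -/
noncomputable def inputState {n N : ℕ} (G : SimpleGraph (Fin n)) (w : Sym2 (Fin n) → ℕ)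
    (D : TreeDecomposition G (Fin N)) : RamState where
  reg
    | 0 => n
    | 1 => N
    | _ => 0
  arr
    | 0 => rowMajor fun u v : Fin n => if G.Adj u v then 1 else 0
    | 1 => rowMajor fun u v : Fin n => if G.Adj u v then w s(u, v) else 0
    | 2 => rowMajor fun t t' : Fin N => if D.tree.Adj t t' then 1 else 0
    | 3 => rowMajor fun (t : Fin N) (v : Fin n) => if v ∈ D.bag t then 1 else 0
    | _ => fun _ => 0

/-- The state holds the cut `c`: the first `n` entries of array `0` are the sides (`0` or `1`) of
the vertices. -/
def Outputs {n : ℕ} (s : RamState) (c : Fin n → Bool) : Prop :=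
  ∀ v : Fin n, s.arr 0 v = (c v).toNat

end MinStableCut

/-! The algorithm is dynamic programming over the tree decomposition. A partial cut of a vertex set
`U` is remembered only through its signature on a bag `B`: the side of each vertex of `B` and the
weight already cut at that vertex. If the vertices of `U` outside `B` have no neighbours outside
`U`, their stability is decided within `U`, and two partial cuts of `U` with the same signature,
both stable off `B`, can replace each other in every extension. Hence a table with one lightest
partial cut per signature is enough (`Represents`).

A single operation produces all tables, the join of two tables whose parts meet only in the bags
(`Represents.join`, based on `crossing_exchange`; `joinProg_spec` for the machine). The table of a
bag arises by joining in its vertices one at a time. A leaf of the remaining tree is merged into its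
neighbour by joining their tables with signatures on the neighbour's bag; `IsContraction` records
the separation properties that survive such merges. Finally, a join with the table of the empty set
and signatures on `∅` demands stability everywhere. All signatures on `∅` agree, so the last table
has at most one entry. It has one, since a cut of maximum weight is stable (`exists_stable`), and
this entry is the optimum (`Represents.final`).

Weighted degrees are at most `X = Δ * W`, so a table with signatures on a bag has at most `(3 * (X +
1)) ^ (tw + 1)` entries (`Represents.length_le`). A join is cubic in this number and quadratic in
`n`. For `2 ≤ X` and `1 ≤ tw` the number is at most `X ^ (8 * tw)`, but for small `X` or `tw = 0` no
such bound is available. The program therefore first tests whether some weighted degree is at least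
two, which implies both inequalities. Otherwise the edges of positive weight form a matching, every
stable cut cuts all of them, and such a cut is written down directly in polynomial time
(`isMinStableCut_of_weightedDegree_le_one`).

The programs are verified in a small Hoare logic with time bounds (`Does`), in which the
preservation of untouched registers and arrays is read off the program text (`Frame`). -/

namespace MinStableCut

/-! ### Partial cuts

A partial cut is a function to `{0, 1, 2}`: the value `0` marks the vertices that are not
assigned, `1` and `2` are the two sides. Weights are given by a matrix. -/

section PartialCuts

variable {V : Type*} [Fintype V]

/-- The weight between `v` and the vertices on the other side of the partial cut. -/
def crossing (a : V → V → ℕ) (c : V → ℕ) (v : V) : ℕ :=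
  ∑ u, if c u + c v = 3 then a v u else 0

/-- Twice the weight of the partial cut. -/
def totalCrossing (a : V → V → ℕ) (c : V → ℕ) : ℕ := ∑ v, crossing a c v

/-- The assigned vertices outside `B` are stable. -/
def StableOff (a : V → V → ℕ) (B : Finset V) (c : V → ℕ) : Prop :=
  ∀ v ∉ B, c v ≠ 0 → ∑ u, a v u ≤ 2 * crossing a c v

/-- The partial cuts have the same signature on `B`. -/
def SameOn (a : V → V → ℕ) (B : Finset V) (c c' : V → ℕ) : Prop :=
  ∀ v ∈ B, c v = c' v ∧ crossing a c v = crossing a c' v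

/-- The partial cuts with set of assigned vertices `U`. -/
def IsCutOf (U : Finset V) (c : V → ℕ) : Prop :=
  ∀ v, c v ≤ 2 ∧ (c v ≠ 0 ↔ v ∈ U)

/-- The table `E 0, …, E (m - 1)` holds one lightest partial cut for each signature on `B` of the
partial cuts with `Q` that are stable off `B`. -/
structure Represents (a : V → V → ℕ) (B : Finset V) (Q : (V → ℕ) → Prop) (E : ℕ → V → ℕ)
    (m : ℕ) : Prop where
  sound : ∀ i < m, Q (E i) ∧ StableOff a B (E i)
  distinct : ∀ i < m, ∀ j < m, SameOn a B (E i) (E j) → i = j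
  complete : ∀ c, Q c → StableOff a B c →
    ∃ i < m, SameOn a B (E i) c ∧ totalCrossing a (E i) ≤ totalCrossing a c

variable {a : V → V → ℕ} {B : Finset V} {Q : (V → ℕ) → Prop} {E : ℕ → V → ℕ} {m : ℕ}

theorem SameOn.refl (c : V → ℕ) : SameOn a B c c := fun _ _ => ⟨rfl, rfl⟩

theorem SameOn.symm {c c' : V → ℕ} (h : SameOn a B c c') : SameOn a B c' c :=
  fun v hv => ⟨(h v hv).1.symm, (h v hv).2.symm⟩

theorem SameOn.trans {c c' c'' : V → ℕ} (h : SameOn a B c c') (h' : SameOn a B c' c'') :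
    SameOn a B c c'' :=
  fun v hv => ⟨(h v hv).1.trans (h' v hv).1, (h v hv).2.trans (h' v hv).2⟩

theorem Represents.congr (h : Represents a B Q E m) {Q' : (V → ℕ) → Prop} {E' : ℕ → V → ℕ}
    (hQ : ∀ c, Q c ↔ Q' c) (hE : ∀ i < m, E' i = E i) : Represents a B Q' E' m := by
  obtain ⟨h1, h2, h3⟩ := h
  refine ⟨fun i hi => ?_, fun i hi j hj => ?_, fun c hc hs => ?_⟩
  · rw [hE i hi, ← hQ]; exact h1 i hi
  · rw [hE i hi, hE j hj]; exact h2 i hi j hj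
  · obtain ⟨i, hi, h⟩ := h3 c ((hQ c).2 hc) hs
    exact ⟨i, hi, by rwa [hE i hi]⟩

theorem represents_empty (a : V → V → ℕ) (B : Finset V) (E : ℕ → V → ℕ) :
    Represents a B (fun _ => False) E 0 :=
  ⟨fun i hi => absurd hi (by simp), fun i hi => absurd hi (by simp), fun _ h => h.elim⟩

theorem Represents.insert_unstable (h : Represents a B Q E m) {c : V → ℕ}
    (hc : ¬ StableOff a B c) : Represents a B (fun d => Q d ∨ d = c) E m := by
  obtain ⟨h1, h2, h3⟩ := h
  refine ⟨fun i hi => ⟨Or.inl (h1 i hi).1, (h1 i hi).2⟩, h2, fun d hd hs => ?_⟩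
  rcases hd with hd | rfl
  · exact h3 d hd hs
  · exact absurd hs hc

theorem Represents.insert_new (h : Represents a B Q E m) {c : V → ℕ}
    (hc : StableOff a B c) (hne : ∀ i < m, ¬ SameOn a B (E i) c) {E' : ℕ → V → ℕ}
    (hE : ∀ i < m, E' i = E i) (hm : E' m = c) :
    Represents a B (fun d => Q d ∨ d = c) E' (m + 1) := by
  obtain ⟨h1, h2, h3⟩ := h
  refine ⟨fun i hi => ?_, fun i hi j hj hij => ?_, fun d hd hs => ?_⟩
  · rcases Nat.lt_succ_iff_lt_or_eq.1 hi with hi | rfl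
    · rw [hE i hi]; exact ⟨Or.inl (h1 i hi).1, (h1 i hi).2⟩
    · rw [hm]; exact ⟨Or.inr rfl, hc⟩
  · rcases Nat.lt_succ_iff_lt_or_eq.1 hi with hi | rfl <;>
      rcases Nat.lt_succ_iff_lt_or_eq.1 hj with hj | rfl
    · rw [hE i hi, hE j hj] at hij; exact h2 i hi j hj hij
    · rw [hE i hi, hm] at hij; exact absurd hij (hne i hi)
    · rw [hE j hj, hm] at hij; exact absurd hij.symm (hne j hj)
    · rfl
  · rcases hd with hd | rfl
    · obtain ⟨i, hi, h⟩ := h3 d hd hs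
      exact ⟨i, by omega, by rwa [hE i hi]⟩
    · exact ⟨m, by omega, by rw [hm]; exact ⟨.refl _, le_rfl⟩⟩

-- Overwriting an entry by a lighter one of the same signature changes no signature in the table, so
-- distinctness and completeness carry over.
open Classical in
theorem Represents.insert_found (h : Represents a B Q E m) {c : V → ℕ}
    (hc : StableOff a B c) (hex : ∃ i < m, SameOn a B (E i) c) {E' : ℕ → V → ℕ}
    (hE : ∀ i < m, E' i =
      if SameOn a B (E i) c ∧ totalCrossing a c < totalCrossing a (E i) then c else E i) :
    Represents a B (fun d => Q d ∨ d = c) E' m := by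
  obtain ⟨h1, h2, h3⟩ := h
  have hsame : ∀ i < m, SameOn a B (E' i) (E i) := by
    intro i hi
    rw [hE i hi]
    split_ifs with hh
    · exact hh.1.symm
    · exact .refl _
  have hle : ∀ i < m, totalCrossing a (E' i) ≤ totalCrossing a (E i) := by
    intro i hi
    rw [hE i hi]
    split_ifs with hh
    · exact hh.2.le
    · exact le_rfl
  refine ⟨fun i hi => ?_, fun i hi j hj hij => ?_, fun d hd hs => ?_⟩
  · rw [hE i hi]
    split_ifs with hh
    · exact ⟨Or.inr rfl, hc⟩
    · exact ⟨Or.inl (h1 i hi).1, (h1 i hi).2⟩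
  · exact h2 i hi j hj (((hsame i hi).symm.trans hij).trans (hsame j hj))
  · rcases hd with hd | rfl
    · obtain ⟨i, hi, h, h'⟩ := h3 d hd hs
      exact ⟨i, hi, (hsame i hi).trans h, (hle i hi).trans h'⟩
    · obtain ⟨i, hi, h⟩ := hex
      refine ⟨i, hi, (hsame i hi).trans h, ?_⟩
      rw [hE i hi]
      split_ifs with hh
      · exact le_rfl
      · by_contra hlt
        exact hh ⟨h, by omega⟩

theorem crossing_le (a : V → V → ℕ) (c : V → ℕ) (v : V) : crossing a c v ≤ ∑ u, a v u := by
  refine Finset.sum_le_sum fun u _ => ?_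
  split_ifs <;> omega

/-- The number of signatures bounds the length of a table. -/
theorem Represents.length_le (h : Represents a B Q E m) {D : ℕ} (hQ : ∀ c, Q c → ∀ v, c v ≤ 2)
    (hD : ∀ v, ∑ u, a v u ≤ D) : m ≤ (3 * (D + 1)) ^ B.card := by
  classical
  -- The signature of an entry; `distinct` says exactly that this map is injective.
  let f : Fin m → (B → Fin 3 × Fin (D + 1)) := fun i v =>
    (⟨E i v, Nat.lt_succ_of_le (hQ _ (h.sound i i.2).1 v)⟩,
      ⟨crossing a (E i) v, Nat.lt_succ_of_le ((crossing_le a _ _).trans (hD v))⟩)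
  have hf : Function.Injective f := by
    intro i j hij
    refine Fin.ext (h.distinct i i.2 j j.2 fun v hv => ?_)
    have := congrFun hij ⟨v, hv⟩
    simp only [f, Prod.mk.injEq, Fin.mk.injEq] at this
    exact this
  have := Fintype.card_le_of_injective f hf
  simpa using this

theorem crossing_eq_zero {U : Finset V} {c : V → ℕ} (hc : IsCutOf U c) {v : V} (hv : v ∉ U) :
    crossing a c v = 0 := by
  refine Finset.sum_eq_zero fun u _ => ?_
  have h1 := (hc u).1
  have h2 : c v = 0 := by
    by_contra h
    exact hv ((hc v).2.1 h)
  rw [if_neg (by omega)]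

theorem represents_zero (a : V → V → ℕ) (B : Finset V) {E : ℕ → V → ℕ} (hE : E 0 = 0) :
    Represents a B (IsCutOf ∅) E 1 := by
  have h0 : ∀ c : V → ℕ, IsCutOf ∅ c ↔ c = 0 := by
    intro c
    constructor
    · intro h
      funext v
      have := (h v).2
      simpa using this
    · rintro rfl
      simp [IsCutOf]
  refine ⟨fun i hi => ?_, fun i hi j hj _ => by omega, fun c hc _ => ⟨0, by omega, ?_⟩⟩
  · obtain rfl : i = 0 := by omega
    refine ⟨(h0 _).2 hE, ?_⟩
    simp [StableOff, hE]
  · rw [hE, (h0 c).1 hc]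
    exact ⟨.refl _, le_rfl⟩

theorem represents_single [DecidableEq V] (a : V → V → ℕ) (w : V) {E : ℕ → V → ℕ}
    (h1 : E 0 = Pi.single w 1)
    (h2 : E 1 = Pi.single w 2) : Represents a {w} (IsCutOf {w}) E 2 := by
  have hcut : ∀ k, k = 1 ∨ k = 2 → IsCutOf {w} (Pi.single w k : V → ℕ) := by
    intro k hk v
    by_cases hv : v = w
    · subst hv
      simp only [Pi.single_eq_same, Finset.mem_singleton, iff_true]
      omega
    · simp [hv]
  have hst : ∀ c : V → ℕ, IsCutOf {w} c → StableOff a {w} c := by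
    intro c hc v hv hv'
    exact absurd ((hc v).2.1 hv') hv
  refine ⟨fun i hi => ?_, fun i hi j hj hij => ?_, fun c hc _ => ?_⟩
  · have : IsCutOf {w} (E i) := by
      interval_cases i
      · rw [h1]; exact hcut 1 (by simp)
      · rw [h2]; exact hcut 2 (by simp)
    exact ⟨this, hst _ this⟩
  · have := (hij w (by simp)).1
    interval_cases i <;> interval_cases j <;> simp_all
  · have hw := (hc w).2.2 (by simp)
    have hw' := (hc w).1
    have hcw : c = Pi.single w (c w) := by
      funext v
      by_cases hv : v = w
      · subst hv; simp
      · have := (hc v).2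
        simp only [Finset.mem_singleton, hv, iff_false, not_not] at this
        simp [hv, this]
    rcases (by omega : c w = 1 ∨ c w = 2) with h | h
    · exact ⟨0, by omega, by rw [h1, hcw, h]; exact ⟨.refl _, by simp⟩⟩
    · exact ⟨1, by omega, by rw [h2, hcw, h]; exact ⟨.refl _, by simp⟩⟩

/-- The pointwise maxima of compatible entries of two tables. -/
def IsJoin (E₁ : ℕ → V → ℕ) (m₁ : ℕ) (E₂ : ℕ → V → ℕ) (m₂ : ℕ) (c : V → ℕ) : Prop :=
  ∃ i < m₁, ∃ j < m₂, (∀ v, E₁ i v + E₂ j v ≠ 3) ∧ c = fun v => max (E₁ i v) (E₂ j v)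

/-- A pair of nonzero weight with exactly one part containing both ends counts in the whole cut as
it does in the cut of that part. A pair inside both parts lies in both bags, and a pair running
between the parts has its ends in the respective bags by the separation hypotheses; such pairs look
the same before and after the exchange. So the crossing weight of the whole minus those of the two
parts depends only on the sides on the bags. The equation is this statement without subtractions. -/
theorem crossing_exchange {U₁ U₂ : Finset V} {B₁ B₂ : Finset V} {c c' c₁ c₁' c₂ c₂' : V → ℕ}
    (ha : ∀ u v, a u v = a v u) (hU : ∀ v, v ∈ U₁ → v ∈ U₂ → v ∈ B₁ ∧ v ∈ B₂)
    (hE₁ : ∀ v ∈ U₁, v ∉ B₁ → ∀ u ∉ U₁, a v u = 0)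
    (hE₂ : ∀ v ∈ U₂, v ∉ B₂ → ∀ u ∉ U₂, a v u = 0)
    (h₁ : IsCutOf U₁ c₁) (h₁' : IsCutOf U₁ c₁') (h₂ : IsCutOf U₂ c₂) (h₂' : IsCutOf U₂ c₂')
    (hs₁ : SameOn a B₁ c₁' c₁) (hs₂ : SameOn a B₂ c₂' c₂)
    (hc : ∀ v, (v ∈ U₁ → c v = c₁ v) ∧ (v ∈ U₂ → c v = c₂ v) ∧
      (v ∉ U₁ → v ∉ U₂ → c v = 0))
    (hc' : ∀ v, (v ∈ U₁ → c' v = c₁' v) ∧ (v ∈ U₂ → c' v = c₂' v) ∧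
      (v ∉ U₁ → v ∉ U₂ → c' v = 0)) (v : V) :
    crossing a c' v + crossing a c₁ v + crossing a c₂ v =
      crossing a c v + crossing a c₁' v + crossing a c₂' v := by
  simp only [crossing, ← Finset.sum_add_distrib]
  refine Finset.sum_congr rfl fun u _ => ?_
  by_cases h0 : a v u = 0
  · simp [h0]
  have h0' : a u v ≠ 0 := by rwa [ha]
  have zero : ∀ {U : Finset V} {d : V → ℕ}, IsCutOf U d → ∀ z, z ∉ U → d z = 0 := by
    intro U d hd z hz
    by_contra h
    exact hz ((hd z).2.1 h)
  have two : ∀ {U : Finset V} {d : V → ℕ}, IsCutOf U d → ∀ z, d z ≤ 2 := fun hd z => (hd z).1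
  have e₁ := fun z (hz : z ∈ B₁) => (hs₁ z hz).1
  have e₂ := fun z (hz : z ∈ B₂) => (hs₂ z hz).1
  have hu := hc u
  have hv := hc v
  have hu' := hc' u
  have hv' := hc' v
  have tu := And.intro (And.intro (two h₁ u) (two h₂ u)) (And.intro (two h₁' u) (two h₂' u))
  have tv := And.intro (And.intro (two h₁ v) (two h₂ v)) (And.intro (two h₁' v) (two h₂' v))
  by_cases u1 : u ∈ U₁ <;> by_cases u2 : u ∈ U₂ <;> by_cases v1 : v ∈ U₁ <;>
    by_cases v2 : v ∈ U₂ <;>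
    simp only [u1, u2, v1, v2, forall_true_left, not_true_eq_false, not_false_eq_true,
      false_imp_iff, and_true, true_and] at hu hv hu' hv'
  -- Each `try` succeeds only in the cases where the vertex is outside the part in question.
  all_goals
    try have zu1 := zero h₁ u u1
    try have zu1' := zero h₁' u u1
    try have zu2 := zero h₂ u u2
    try have zu2' := zero h₂' u u2
    try have zv1 := zero h₁ v v1
    try have zv1' := zero h₁' v v1
    try have zv2 := zero h₂ v v2
    try have zv2' := zero h₂' v v2
  all_goals try grind

end PartialCuts

/-! ### Joining tables, existence of stable cuts, and the final table -/

section PartialCutJoin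

variable {V : Type*} {a : V → V → ℕ}

theorem IsCutOf.eq_zero {U : Finset V} {c : V → ℕ} (hc : IsCutOf U c) {v : V} (hv : v ∉ U) :
    c v = 0 := by
  by_contra h
  exact hv ((hc v).2.1 h)

variable [Fintype V]

/-- Joining the tables of two separated parts. -/
theorem Represents.join [DecidableEq V] {U₁ U₂ B₁ B₂ B : Finset V} {E₁ E₂ E : ℕ → V → ℕ}
    {m₁ m₂ m : ℕ}
    (ha : ∀ u v, a u v = a v u) (hU : ∀ v, v ∈ U₁ → v ∈ U₂ → v ∈ B₁ ∧ v ∈ B₂)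
    (hB₁ : ∀ v ∈ B, v ∈ U₁ → v ∈ B₁) (hB₂ : ∀ v ∈ B, v ∈ U₂ → v ∈ B₂)
    (hE₁ : ∀ v ∈ U₁, v ∉ B₁ → ∀ u ∉ U₁, a v u = 0)
    (hE₂ : ∀ v ∈ U₂, v ∉ B₂ → ∀ u ∉ U₂, a v u = 0)
    (h₁ : Represents a B₁ (IsCutOf U₁) E₁ m₁) (h₂ : Represents a B₂ (IsCutOf U₂) E₂ m₂)
    (h : Represents a B (IsJoin E₁ m₁ E₂ m₂) E m) :
    Represents a B (IsCutOf (U₁ ∪ U₂)) E m := by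
  refine ⟨fun i hi => ?_, h.distinct, fun c hc hs => ?_⟩
  · obtain ⟨hj, hs⟩ := h.sound i hi
    refine ⟨?_, hs⟩
    obtain ⟨i', hi', j', hj', hcomp, heq⟩ := hj
    have c1 := (h₁.sound i' hi').1
    have c2 := (h₂.sound j' hj').1
    intro v
    have := c1 v
    have := c2 v
    rw [heq]
    simp only [Finset.mem_union]
    grind
  -- Completeness: cut `c` into its restrictions to the two parts, replace each by the table entry
  -- with its signature, and glue the entries together.
  · let c₁ : V → ℕ := fun v => if v ∈ U₁ then c v else 0
    let c₂ : V → ℕ := fun v => if v ∈ U₂ then c v else 0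
    have hc₁ : IsCutOf U₁ c₁ := by
      intro v
      have := hc v
      simp only [c₁, Finset.mem_union] at *
      grind
    have hc₂ : IsCutOf U₂ c₂ := by
      intro v
      have := hc v
      simp only [c₂, Finset.mem_union] at *
      grind
    -- A vertex of a part off its bag sends no weight out of the part, so restriction preserves the
    -- weight cut at it, and with it its stability.
    have restrict : ∀ {U : Finset V} {v : V}, v ∈ U → (∀ u ∉ U, a v u = 0) →
        crossing a (fun v => if v ∈ U then c v else 0) v = crossing a c v := by
      intro U v hv hz
      refine Finset.sum_congr rfl fun u _ => ?_
      by_cases hu : u ∈ U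
      · simp [hv, hu]
      · simp [hz u hu]
    have hs₁ : StableOff a B₁ c₁ := by
      intro v hv hv0
      have hvU := (hc₁ v).2.1 hv0
      rw [restrict hvU (hE₁ v hvU hv)]
      refine hs v (fun hB => hv (hB₁ v hB hvU)) ?_
      simpa [c₁, hvU] using hv0
    have hs₂ : StableOff a B₂ c₂ := by
      intro v hv hv0
      have hvU := (hc₂ v).2.1 hv0
      rw [restrict hvU (hE₂ v hvU hv)]
      refine hs v (fun hB => hv (hB₂ v hB hvU)) ?_
      simpa [c₂, hvU] using hv0
    obtain ⟨i, hi, hsi, hwi⟩ := h₁.complete c₁ hc₁ hs₁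
    obtain ⟨j, hj, hsj, hwj⟩ := h₂.complete c₂ hc₂ hs₂
    obtain ⟨hi1, hi2⟩ := h₁.sound i hi
    obtain ⟨hj1, hj2⟩ := h₂.sound j hj
    let c' : V → ℕ := fun v => max (E₁ i v) (E₂ j v)
    have agree : ∀ v, v ∈ U₁ → v ∈ U₂ → E₁ i v = c v ∧ E₂ j v = c v := by
      intro v hv1 hv2
      have := (hsi v (hU v hv1 hv2).1).1
      have := (hsj v (hU v hv1 hv2).2).1
      simp_all [c₁, c₂]
    have hcu : ∀ v, (v ∈ U₁ → c v = c₁ v) ∧ (v ∈ U₂ → c v = c₂ v) ∧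
        (v ∉ U₁ → v ∉ U₂ → c v = 0) := by
      intro v
      refine ⟨fun hv => by simp [c₁, hv], fun hv => by simp [c₂, hv], fun hv hv' => ?_⟩
      exact hc.eq_zero (by simp [hv, hv'])
    have hcu' : ∀ v, (v ∈ U₁ → c' v = E₁ i v) ∧ (v ∈ U₂ → c' v = E₂ j v) ∧
        (v ∉ U₁ → v ∉ U₂ → c' v = 0) := by
      intro v
      have z1 := fun hv : v ∉ U₁ => hi1.eq_zero hv
      have z2 := fun hv : v ∉ U₂ => hj1.eq_zero hv
      have := agree v
      simp only [c']
      grind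
    have exch := crossing_exchange ha hU hE₁ hE₂ hc₁ hi1 hc₂ hj1 hsi hsj hcu hcu'
    -- At vertices that are in the bag or not in the part at all, the exchange of the part is
    -- invisible.
    have cross1 : ∀ v, (v ∈ U₁ → v ∈ B₁) → crossing a (E₁ i) v = crossing a c₁ v := by
      intro v hv
      by_cases hvU : v ∈ U₁
      · exact (hsi v (hv hvU)).2
      · rw [crossing_eq_zero hi1 hvU, crossing_eq_zero hc₁ hvU]
    have cross2 : ∀ v, (v ∈ U₂ → v ∈ B₂) → crossing a (E₂ j) v = crossing a c₂ v := by
      intro v hv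
      by_cases hvU : v ∈ U₂
      · exact (hsj v (hv hvU)).2
      · rw [crossing_eq_zero hj1 hvU, crossing_eq_zero hc₂ hvU]
    have sameB : SameOn a B c' c := by
      intro v hv
      refine ⟨?_, ?_⟩
      · by_cases hv1 : v ∈ U₁
        · rw [(hcu' v).1 hv1, (hcu v).1 hv1]
          exact (hsi v (hB₁ v hv hv1)).1
        by_cases hv2 : v ∈ U₂
        · rw [(hcu' v).2.1 hv2, (hcu v).2.1 hv2]
          exact (hsj v (hB₂ v hv hv2)).1
        · rw [(hcu' v).2.2 hv1 hv2, (hcu v).2.2 hv1 hv2]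
      · have := exch v
        rw [cross1 v (hB₁ v hv), cross2 v (hB₂ v hv)] at this
        omega
    have hle1 : ∀ v ∈ U₁, crossing a (E₁ i) v ≤ crossing a c' v := by
      intro v hv
      refine Finset.sum_le_sum fun u _ => ?_
      by_cases hu : u ∈ U₁
      · rw [(hcu' v).1 hv, (hcu' u).1 hu]
      · have := hi1.eq_zero hu
        have := (hi1 v).1
        rw [if_neg (by omega)]
        exact Nat.zero_le _
    have hle2 : ∀ v ∈ U₂, crossing a (E₂ j) v ≤ crossing a c' v := by
      intro v hv
      refine Finset.sum_le_sum fun u _ => ?_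
      by_cases hu : u ∈ U₂
      · rw [(hcu' v).2.1 hv, (hcu' u).2.1 hu]
      · have := hj1.eq_zero hu
        have := (hj1 v).1
        rw [if_neg (by omega)]
        exact Nat.zero_le _
    -- A vertex of a part off the bag of that part is stable in the table entry, and gluing only
    -- adds cut edges at it. At every other vertex the cut weight is the same as for `c`.
    have hst : StableOff a B c' := by
      intro v hvB hv0
      by_cases h1 : v ∈ U₁ ∧ v ∉ B₁
      · have := hi2 v h1.2 ((hi1 v).2.2 h1.1)
        have := hle1 v h1.1
        omega
      by_cases h2 : v ∈ U₂ ∧ v ∉ B₂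
      · have := hj2 v h2.2 ((hj1 v).2.2 h2.1)
        have := hle2 v h2.1
        omega
      push Not at h1 h2
      have hcv : c v ≠ 0 := by
        rw [(hc v).2]
        by_contra hvU
        simp only [Finset.mem_union, not_or] at hvU
        exact hv0 ((hcu' v).2.2 hvU.1 hvU.2)
      have := exch v
      rw [cross1 v h1, cross2 v h2] at this
      have := hs v hvB hcv
      omega
    -- Summing the exchange identity over all vertices turns the two weight comparisons in the parts
    -- into one for the whole.
    have hwt : totalCrossing a c' ≤ totalCrossing a c := by
      have : totalCrossing a c' + totalCrossing a c₁ + totalCrossing a c₂ =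
          totalCrossing a c + totalCrossing a (E₁ i) + totalCrossing a (E₂ j) := by
        simp only [totalCrossing, ← Finset.sum_add_distrib]
        exact Finset.sum_congr rfl fun v _ => exch v
      omega
    have hcomp : ∀ v, E₁ i v + E₂ j v ≠ 3 := by
      intro v
      have := agree v
      have := hi1.eq_zero (v := v)
      have := hj1.eq_zero (v := v)
      have := (hi1 v).1
      have := (hj1 v).1
      grind
    obtain ⟨k, hk, hks, hkw⟩ := h.complete c' ⟨i, hi, j, hj, hcomp, rfl⟩ hst
    exact ⟨k, hk, hks.trans sameB, hkw.trans hwt⟩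

/-- Moving `v` to the other side. -/
theorem totalCrossing_flip [DecidableEq V] (ha : ∀ u v, a u v = a v u) (ha0 : ∀ v, a v v = 0)
    {c : V → ℕ} (hc : IsCutOf Finset.univ c) (v : V) :
    totalCrossing a (Function.update c v (3 - c v)) + 4 * crossing a c v =
      totalCrossing a c + 2 * ∑ u, a v u := by
  set c' := Function.update c v (3 - c v) with hc'
  let e : V → V → ℕ := fun w u => if c u + c w = 3 then a w u else 0
  have h1 : ∑ w, ∑ u, (if w = v then e w u else 0) = crossing a c v := by
    simp only [crossing, e]
    rw [Finset.sum_eq_single v (fun w _ hw => by simp [hw]) (by simp)]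
    simp
  have h2 : ∑ w, ∑ u, (if u = v then e w u else 0) = crossing a c v := by
    rw [Finset.sum_comm, ← h1]
    refine Finset.sum_congr rfl fun w _ => Finset.sum_congr rfl fun u _ => ?_
    simp only [e, add_comm (c u) (c w), ha w u]
  have h3 : ∑ w, ∑ u, (if w = v then a w u else 0) = ∑ u, a v u := by
    rw [Finset.sum_eq_single v (fun w _ hw => by simp [hw]) (by simp)]
    simp
  have h4 : ∑ w, ∑ u, (if u = v then a w u else 0) = ∑ u, a v u := by
    rw [Finset.sum_comm, ← h3]
    refine Finset.sum_congr rfl fun w _ => Finset.sum_congr rfl fun u _ => ?_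
    rw [ha w u]
  -- Exactly the pairs with one end at `v` change their status, so their contribution becomes `a -
  -- e`. The pair of `v` with itself would be counted twice but has weight `0`.
  have h5 : ∀ w u, (if c' u + c' w = 3 then a w u else 0) +
      (2 * (if w = v then e w u else 0) + 2 * (if u = v then e w u else 0)) =
      e w u + ((if w = v then a w u else 0) + (if u = v then a w u else 0)) := by
    intro w u
    have tw := hc w
    have tu := hc u
    simp only [Finset.mem_univ, iff_true] at tw tu
    by_cases hw : w = v <;> by_cases hu : u = v
    · subst hw; subst hu; simp [e, ha0]
    · subst hw; simp only [hc', e, hu]; grind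
    · subst hu; simp only [hc', e, hw]; grind
    · simp [hc', e, hw, hu]
  have h6 : ∑ w, ∑ u, ((if c' u + c' w = 3 then a w u else 0) +
      (2 * (if w = v then e w u else 0) + 2 * (if u = v then e w u else 0))) =
      ∑ w, ∑ u, (e w u + ((if w = v then a w u else 0) + (if u = v then a w u else 0))) :=
    Finset.sum_congr rfl fun w _ => Finset.sum_congr rfl fun u _ => h5 w u
  simp only [Finset.sum_add_distrib, ← Finset.mul_sum, h1, h2, h3, h4] at h6
  simp only [totalCrossing, crossing, e] at *
  omega

/-- A cut of maximum weight is stable. -/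
theorem exists_stable [DecidableEq V] (ha : ∀ u v, a u v = a v u) (ha0 : ∀ v, a v v = 0) :
    ∃ c, IsCutOf Finset.univ c ∧ StableOff a ∅ c := by
  have hbound : ∀ c : V → ℕ, totalCrossing a c ≤ ∑ v, ∑ u, a v u :=
    fun c => Finset.sum_le_sum fun v _ => crossing_le a c v
  have hne : ∃ k, ∃ c, IsCutOf Finset.univ c ∧ totalCrossing a c = k :=
    ⟨_, fun _ => 1, fun v => by simp, rfl⟩
  classical
  let P : ℕ → Prop := fun k => ∃ c, IsCutOf Finset.univ c ∧ totalCrossing a c = k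
  obtain ⟨k0, hk0⟩ := hne
  have hP0 : k0 ≤ ∑ v, ∑ u, a v u := by
    obtain ⟨c, -, rfl⟩ := hk0
    exact hbound c
  -- The cut `c` attains the largest total. Flipping an unstable `v` would raise the total by twice
  -- the positive difference of its weighted degree and twice its crossing weight.
  obtain ⟨c, hc, hck⟩ := Nat.findGreatest_spec (P := P) hP0 hk0
  refine ⟨c, hc, fun v _ _ => ?_⟩
  have hc' : IsCutOf Finset.univ (Function.update c v (3 - c v)) := by
    intro u
    have := hc u
    have := hc v
    simp only [Finset.mem_univ, iff_true, Function.update_apply] at *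
    split_ifs <;> omega
  have := Nat.le_findGreatest (P := P) (hbound _) ⟨_, hc', rfl⟩
  have := totalCrossing_flip ha ha0 hc v
  omega

/-- On the empty bag all signatures agree, so the table has at most one entry. The existence of a
stable cut guarantees that entry `0` is really there. -/
theorem Represents.final [DecidableEq V] (ha : ∀ u v, a u v = a v u) (ha0 : ∀ v, a v v = 0)
    {E : ℕ → V → ℕ} {m : ℕ} (h : Represents a ∅ (IsCutOf Finset.univ) E m) :
    IsCutOf Finset.univ (E 0) ∧ StableOff a ∅ (E 0) ∧
      ∀ c, IsCutOf Finset.univ c → StableOff a ∅ c →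
        totalCrossing a (E 0) ≤ totalCrossing a c := by
  obtain ⟨c, hc, hs⟩ := exists_stable ha ha0
  have key : ∀ c, IsCutOf Finset.univ c → StableOff a ∅ c →
      0 < m ∧ totalCrossing a (E 0) ≤ totalCrossing a c := by
    intro c hc hs
    obtain ⟨i, hi, -, hw⟩ := h.complete c hc hs
    obtain rfl : i = 0 := h.distinct i hi 0 (by omega) (by simp [SameOn])
    exact ⟨hi, hw⟩
  obtain ⟨h1, h2⟩ := h.sound 0 (key c hc hs).1
  exact ⟨h1, h2, fun c hc hs => (key c hc hs).2⟩

end PartialCutJoin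

/-! ### Cuts of the weighted graph as partial cuts -/

section Graph

variable {V : Type*} (G : SimpleGraph V) (w : Sym2 V → ℕ)

open Classical in
/-- The weight matrix. -/
noncomputable def weightMatrix (v u : V) : ℕ := if G.Adj v u then w s(v, u) else 0

theorem weightMatrix_comm (u v : V) : weightMatrix G w u v = weightMatrix G w v u := by
  by_cases h : G.Adj u v
  · simp [weightMatrix, h, h.symm, Sym2.eq_swap (a := u)]
  · simp [weightMatrix, h, G.adj_comm v u]

theorem weightMatrix_self (v : V) : weightMatrix G w v v = 0 := by simp [weightMatrix]

variable [Fintype V]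

theorem sum_weightMatrix (v : V) : ∑ u, weightMatrix G w v u = weightedDegree G w v := by
  classical
  simp only [weightedDegree, weightMatrix, Finset.sum_filter]

theorem crossing_weightMatrix (c : V → Bool) (v : V) :
    crossing (weightMatrix G w) (fun u => 1 + (c u).toNat) v = crossingWeight G w c v := by
  classical
  simp only [crossing, crossingWeight, weightMatrix, Finset.sum_filter]
  refine Finset.sum_congr rfl fun u _ => ?_
  by_cases h : G.Adj v u
  · simp only [h, true_and, if_true]
    cases hu : c u <;> cases hv : c v <;> simp
  · simp [h]

/-- Double counting over darts: grouped by first endpoint they give the left side, grouped by edge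
each edge occurs twice. -/
theorem sum_crossingWeight (c : V → Bool) :
    ∑ v, crossingWeight G w c v = 2 * cutWeight G w c := by
  classical
  let f : Sym2 V → ℕ := fun e => if ∃ u ∈ e, ∃ v ∈ e, c u ≠ c v then w e else 0
  have h1 : ∑ d : G.Dart, f d.edge = ∑ v, crossingWeight G w c v := by
    rw [← Finset.sum_fiberwise (g := fun d : G.Dart => d.fst)]
    refine Finset.sum_congr rfl fun v _ => ?_
    have hcw : crossingWeight G w c v =
        ∑ u with G.Adj v u, if c u ≠ c v then w s(v, u) else 0 := by
      simp only [crossingWeight, Finset.sum_filter, ite_and]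
    rw [hcw]
    refine Finset.sum_bij (fun d _ => d.snd) ?_ ?_ ?_ ?_
    · intro d hd
      simp only [Finset.mem_filter, Finset.mem_univ, true_and] at hd ⊢
      rw [← hd]; exact d.adj
    · intro d hd d' hd' h
      simp only [Finset.mem_filter, Finset.mem_univ, true_and] at hd hd'
      exact SimpleGraph.Dart.ext _ _ (Prod.ext (hd.trans hd'.symm) h)
    · intro u hu
      simp only [Finset.mem_filter, Finset.mem_univ, true_and] at hu
      exact ⟨⟨(v, u), hu⟩, by simp, rfl⟩
    · intro d hd
      simp only [Finset.mem_filter, Finset.mem_univ, true_and] at hd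
      subst hd
      have he : d.edge = s(d.fst, d.snd) := rfl
      simp only [f, he, Sym2.mem_iff]
      have : (∃ u, (u = d.fst ∨ u = d.snd) ∧ ∃ v, (v = d.fst ∨ v = d.snd) ∧ c u ≠ c v) ↔
          c d.snd ≠ c d.fst := by
        constructor
        · rintro ⟨u, rfl | rfl, v, rfl | rfl, h⟩ <;> simp_all [eq_comm]
        · intro h
          exact ⟨_, Or.inr rfl, _, Or.inl rfl, h⟩
      simp only [this]
  have h2 : ∑ d : G.Dart, f d.edge = 2 * cutWeight G w c := by
    rw [← Finset.sum_fiberwise_of_maps_to (t := G.edgeFinset) (g := fun d : G.Dart => d.edge)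
      (fun d _ => by simp)]
    rw [cutWeight, Finset.sum_filter, Finset.mul_sum]
    refine Finset.sum_congr rfl fun e he => ?_
    rw [Finset.sum_congr rfl (g := fun _ => f e) (fun d hd => by simp_all), Finset.sum_const,
      G.dart_edge_fiber_card e (by simpa using he), smul_eq_mul]
  rw [← h1, h2]

theorem isMinStableCut_of_totalCrossing (c : V → Bool)
    (h₁ : StableOff (weightMatrix G w) ∅ fun u => 1 + (c u).toNat)
    (h₂ : ∀ c' : V → Bool, StableOff (weightMatrix G w) ∅ (fun u => 1 + (c' u).toNat) →
      totalCrossing (weightMatrix G w) (fun u => 1 + (c u).toNat) ≤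
        totalCrossing (weightMatrix G w) fun u => 1 + (c' u).toNat) :
    IsMinStableCut G w c := by
  have hst : ∀ c : V → Bool, StableOff (weightMatrix G w) ∅ (fun u => 1 + (c u).toNat) ↔
      IsStable G w c := by
    intro c
    simp [StableOff, IsStable, sum_weightMatrix, crossing_weightMatrix]
  refine ⟨(hst c).1 h₁, fun c' hc' => ?_⟩
  have := h₂ c' ((hst c').2 hc')
  simp only [totalCrossing, crossing_weightMatrix, sum_crossingWeight] at this
  omega

theorem isCutOf_univ (c : V → Bool) : IsCutOf Finset.univ fun u => 1 + (c u).toNat := by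
  intro v
  have := (c v).toNat_le
  simp only [Finset.mem_univ, iff_true]
  omega

theorem eq_one_add_toNat {c : V → ℕ} (hc : IsCutOf Finset.univ c) :
    (fun u => 1 + (decide (c u = 2)).toNat) = c := by
  funext v
  have := hc v
  simp only [Finset.mem_univ, iff_true] at this
  rcases (by omega : c v = 1 ∨ c v = 2) with h | h <;> simp [h]

/-- If all weighted degrees are at most one, then the edges of positive weight form a matching,
and it is optimal to cut all of them. -/
theorem isMinStableCut_of_weightedDegree_le_one [LinearOrder V]
    (h : ∀ v, ∑ u, weightMatrix G w v u ≤ 1) (c : V → Bool)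
    (hc : ∀ v, c v = true ↔ ∃ u < v, weightMatrix G w v u ≠ 0) : IsMinStableCut G w c := by
  set a := weightMatrix G w with ha
  have hcomm : ∀ u v, a u v = a v u := weightMatrix_comm G w
  have hself : ∀ v, a v v = 0 := weightMatrix_self G w
  -- Two partners with positive weight would already give weighted degree two.
  have uniq : ∀ v u u', a v u ≠ 0 → a v u' ≠ 0 → u = u' := by
    intro v u u' h1 h2
    by_contra hne
    have := Finset.sum_le_sum_of_subset (f := a v) (Finset.subset_univ {u, u'})
    rw [Finset.sum_pair hne] at this
    have := h v
    omega
  have full : ∀ v, crossing a (fun u => 1 + (c u).toNat) v = ∑ u, a v u := by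
    intro v
    refine Finset.sum_congr rfl fun u _ => ?_
    by_cases h0 : a v u = 0
    · simp [h0]
    have h0' : a u v ≠ 0 := by rwa [hcomm]
    -- The larger end of the pair is on side `true`. The smaller end is not, because its only
    -- partner is the larger end.
    have hne : c u ≠ c v := by
      rcases lt_trichotomy u v with hlt | rfl | hlt
      · have hv : c v = true := (hc v).2 ⟨u, hlt, h0⟩
        have hu : ¬ c u = true := by
          rw [hc u]
          rintro ⟨z, hz, hz'⟩
          obtain rfl := uniq u z v hz' h0'
          exact absurd hz (not_lt.2 hlt.le)
        rw [hv]; exact hu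
      · exact absurd (hself u) h0
      · have hu : c u = true := (hc u).2 ⟨v, hlt, h0'⟩
        have hv : ¬ c v = true := by
          rw [hc v]
          rintro ⟨z, hz, hz'⟩
          obtain rfl := uniq v z u hz' h0
          exact absurd hz (not_lt.2 hlt.le)
        rw [hu]; exact fun e => hv e.symm
    rw [if_pos]
    change 1 + (c u).toNat + (1 + (c v).toNat) = 3
    revert hne
    cases c u <;> cases c v <;> simp
  refine isMinStableCut_of_totalCrossing G w c (fun v _ _ => ?_) fun c' hc' => ?_
  · rw [← ha, full]; omega
  · refine Finset.sum_le_sum fun v _ => ?_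
    rw [← ha] at hc' ⊢
    rw [full]
    -- Stability at a vertex of weighted degree one forces the unit of weight there to be cut, so
    -- every stable cut has full weight.
    have := hc' v (by simp) (by simp)
    have := h v
    omega

theorem sum_weightMatrix_le (v : V) :
    ∑ u, weightMatrix G w v u ≤ maxDeg G * maxWeight G w := by
  classical
  simp only [weightMatrix, ← Finset.sum_filter]
  calc _ ≤ ∑ u with G.Adj v u, maxWeight G w := by
        refine Finset.sum_le_sum fun u hu => ?_
        simp only [Finset.mem_filter, Finset.mem_univ, true_and] at hu
        unfold maxWeight
        exact Finset.le_sup (f := w) (by simpa using hu)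
    _ = G.degree v * maxWeight G w := by
        rw [Finset.sum_const, smul_eq_mul, ← SimpleGraph.card_neighborFinset_eq_degree]
        congr 2
        ext u; simp
    _ ≤ _ := by
        refine Nat.mul_le_mul_right _ ?_
        unfold maxDeg
        convert G.degree_le_maxDegree v

end Graph

/-! ### Contracting a tree decomposition along leaves -/

section Contraction

variable {V ι : Type*} {G : SimpleGraph V} (D : TreeDecomposition G ι)

/-- The situation after some leaves were merged into their neighbours, one after the other: `A`
is the set of remaining nodes, `U t` is the union of the bags merged into `t`. -/
structure IsContraction (A : Finset ι) (U : ι → Finset V) : Prop where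
  bag_subset : ∀ t ∈ A, D.bag t ⊆ U t
  covers : ∀ t, ∃ b ∈ A, D.bag t ⊆ U b
  separated : ∀ s ∈ A, ∀ t ∈ A, s ≠ t → ∀ v, v ∈ U s → v ∈ U t → v ∈ D.bag s ∧ v ∈ D.bag t
  preconnected_bag : ∀ v, (D.tree.induce {t | t ∈ A ∧ v ∈ D.bag t}).Preconnected
  preconnected : (D.tree.induce {t | t ∈ A}).Preconnected

/-- The node `p` is the only neighbour of `l` in `A`. -/
structure IsLeafOf (A : Finset ι) (l p : ι) : Prop where
  mem_leaf : l ∈ A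
  mem_parent : p ∈ A
  adj : D.tree.Adj l p
  unique : ∀ q ∈ A, D.tree.Adj l q → q = p

theorem isContraction_bag [Fintype ι] : IsContraction D Finset.univ D.bag := by
  refine ⟨fun _ _ => subset_rfl, fun t => ⟨t, Finset.mem_univ t, subset_rfl⟩,
    fun _ _ _ _ _ v hs ht => ⟨hs, ht⟩, ?_, ?_⟩
  · intro v
    have : {t | t ∈ Finset.univ ∧ v ∈ D.bag t} = {t | v ∈ D.bag t} := Set.ext fun t => by simp
    rw [this]
    exact D.preconnected v
  · have : {t : ι | t ∈ Finset.univ} = Set.univ := Set.ext fun t => by simp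
    rw [this]
    exact (SimpleGraph.induceUnivIso D.tree).preconnected_iff.2 D.isTree.connected.preconnected

/-- Removing a leaf keeps an induced subgraph preconnected. -/
theorem preconnected_induce_diff {T : SimpleGraph ι} {S S' : Set ι} {l p : ι}
    (h : (T.induce S).Preconnected) (hl : ∀ q ∈ S, T.Adj l q → q = p)
    (hS : ∀ t, t ∈ S' ↔ t ∈ S ∧ t ≠ l) : (T.induce S').Preconnected := by
  have h' := h.induce_of_degree_eq_one (s := {t : S | (t : ι) ≠ l}) (by
    rintro ⟨v, hv⟩ hvl x hx y hy
    simp only [ne_eq, Set.mem_ofPred_eq, not_not] at hvl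
    subst hvl
    simp only [SimpleGraph.mem_neighborSet, SimpleGraph.comap_adj] at hx hy
    exact Subtype.ext ((hl _ x.2 hx).trans (hl _ y.2 hy).symm))
  let f : (T.induce S).induce {t : S | (t : ι) ≠ l} →g T.induce S' :=
    ⟨fun t => ⟨t.1.1, (hS _).2 ⟨t.1.2, t.2⟩⟩, fun h => h⟩
  intro x y
  have := h' ⟨⟨x, ((hS _).1 x.2).1⟩, ((hS _).1 x.2).2⟩ ⟨⟨y, ((hS _).1 y.2).1⟩, ((hS _).1 y.2).2⟩
  exact this.map f

variable {D} {A : Finset ι} {U : ι → Finset V}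

/-- The remaining nodes induce a preconnected subgraph of a tree, hence a tree, and a tree with two
nodes has a vertex of degree one. -/
theorem IsContraction.exists_leaf (h : IsContraction D A U) (hA : 2 ≤ A.card) :
    ∃ l p, IsLeafOf D A l p := by
  classical
  have : Nontrivial {t | t ∈ A} := by
    obtain ⟨s, hs, t, ht, hst⟩ := Finset.one_lt_card.1 hA
    exact ⟨⟨s, hs⟩, ⟨t, ht⟩, fun e => hst (congrArg Subtype.val e)⟩
  have : Fintype {t | t ∈ A} := inferInstanceAs (Fintype A)
  have htree : (D.tree.induce {t | t ∈ A}).IsTree := by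
    refine ⟨⟨h.preconnected⟩, D.isTree.isAcyclic.induce _⟩
  obtain ⟨l, hl⟩ := htree.exists_vert_degree_one_of_nontrivial
  obtain ⟨p, hp, hu⟩ := SimpleGraph.degree_eq_one_iff_existsUnique_adj.1 hl
  exact ⟨l, p, l.2, p.2, hp, fun q hq hlq => congrArg Subtype.val (hu ⟨q, hq⟩ hlq)⟩

/-- The vertices of `U t` outside the bag have no neighbours outside `U t`. -/
theorem IsContraction.not_adj (h : IsContraction D A U) {t : ι} (ht : t ∈ A) {u v : V}
    (hv : v ∈ U t) (hvb : v ∉ D.bag t) (hu : u ∉ U t) : ¬ G.Adj v u := by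
  intro hadj
  -- A bag containing the edge is contained in some `U b`. For `b = t` this puts `u` into `U t`,
  -- otherwise separation puts `v` into the bag of `t`.
  obtain ⟨s, hvs, hus⟩ := D.edge_mem_bag v u hadj
  obtain ⟨b, hb, hsb⟩ := h.covers s
  by_cases hbt : b = t
  · subst hbt; exact hu (hsb hus)
  · exact hvb (h.separated b hb t ht hbt v (hsb hvs) hv).2

/-- Among the remaining nodes with `v` in their bags there is a walk from `l` to `b`, and its first
step can only lead to `p`. -/
theorem IsContraction.mem_bag_parent (h : IsContraction D A U) {l p b : ι}
    (hlp : IsLeafOf D A l p) (hb : b ∈ A) (hbl : b ≠ l) {v : V} (hv : v ∈ D.bag l)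
    (hvb : v ∈ D.bag b) : v ∈ D.bag p := by
  obtain ⟨w⟩ := h.preconnected_bag v ⟨l, hlp.mem_leaf, hv⟩ ⟨b, hb, hvb⟩
  have hnil : ¬ w.Nil := SimpleGraph.Walk.not_nil_of_ne (by
    intro e
    exact hbl (congrArg Subtype.val e).symm)
  have := w.adj_snd hnil
  rw [← hlp.unique _ w.snd.2.1 this]
  exact w.snd.2.2

/-- Only separation from the enlarged part needs an argument: a vertex that `U l` shares with
another part lies in the bag of `l` and in the other bag, hence also in the bag of `p`. Deleting a
leaf keeps both connectivity conditions. -/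
theorem IsContraction.merge [DecidableEq ι] [DecidableEq V] (h : IsContraction D A U) {l p : ι}
    (hlp : IsLeafOf D A l p) :
    IsContraction D (A.erase l) (Function.update U p (U p ∪ U l)) := by
  have hpl : p ≠ l := hlp.adj.ne'
  have hsep : ∀ t ∈ A, t ≠ l → t ≠ p → ∀ v, v ∈ U p ∪ U l → v ∈ U t →
      v ∈ D.bag p ∧ v ∈ D.bag t := by
    intro t ht htl htp v hv hvt
    rcases Finset.mem_union.1 hv with hv | hv
    · exact h.separated p hlp.mem_parent t ht htp.symm v hv hvt
    · obtain ⟨h1, h2⟩ := h.separated l hlp.mem_leaf t ht htl.symm v hv hvt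
      exact ⟨h.mem_bag_parent hlp ht htl h1 h2, h2⟩
  refine ⟨?_, ?_, ?_, ?_, ?_⟩
  · intro t ht
    have ht := Finset.mem_erase.1 ht
    by_cases htp : t = p
    · subst htp
      simpa using (h.bag_subset t ht.2).trans Finset.subset_union_left
    · simpa [htp] using h.bag_subset t ht.2
  · intro t
    obtain ⟨b, hb, htb⟩ := h.covers t
    by_cases hbl : b = l
    · subst hbl
      refine ⟨p, Finset.mem_erase.2 ⟨hpl, hlp.mem_parent⟩, ?_⟩
      simpa using htb.trans Finset.subset_union_right
    · refine ⟨b, Finset.mem_erase.2 ⟨hbl, hb⟩, ?_⟩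
      by_cases hbp : b = p
      · subst hbp
        simpa using htb.trans Finset.subset_union_left
      · simpa [hbp] using htb
  · intro s hs t ht hst v hvs hvt
    have hs := Finset.mem_erase.1 hs
    have ht := Finset.mem_erase.1 ht
    by_cases hsp : s = p
    · subst hsp
      simp only [Function.update_self, Function.update_of_ne hst.symm] at hvs hvt
      exact hsep t ht.2 ht.1 hst.symm v hvs hvt
    · by_cases htp : t = p
      · subst htp
        simp only [Function.update_self, Function.update_of_ne hst] at hvs hvt
        exact (hsep s hs.2 hs.1 hst v hvt hvs).symm
      · simp only [Function.update_of_ne hsp, Function.update_of_ne htp] at hvs hvt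
        exact h.separated s hs.2 t ht.2 hst v hvs hvt
  · intro v
    refine preconnected_induce_diff (h.preconnected_bag v) (l := l) (p := p)
      (fun q hq => hlp.unique q hq.1) fun t => ?_
    simp only [Finset.mem_erase, Set.mem_ofPred_eq]
    tauto
  · refine preconnected_induce_diff h.preconnected (l := l) (p := p)
      (fun q hq => hlp.unique q hq) fun t => ?_
    simp only [Finset.mem_erase, Set.mem_ofPred_eq]
    tauto

theorem IsContraction.eq_univ [Fintype V] (h : IsContraction D A U) {r : ι} (hA : A = {r}) :
    U r = Finset.univ := by
  subst hA
  refine Finset.eq_univ_of_forall fun v => ?_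
  obtain ⟨t, ht⟩ := D.vertex_mem_bag v
  obtain ⟨b, hb, htb⟩ := h.covers t
  obtain rfl := Finset.mem_singleton.1 hb
  exact htb ht

end Contraction

/-! ### Reasoning about programs -/

section Programs

attribute [simp] RamExpr.eval RamExpr.cost

@[simp] theorem RamState.reg_setReg (s : RamState) (r k r' : ℕ) :
    (s.setReg r k).reg r' = if r' = r then k else s.reg r' := by
  simp [RamState.setReg, Function.update_apply]

@[simp] theorem RamState.arr_setReg (s : RamState) (r k : ℕ) : (s.setReg r k).arr = s.arr := rfl

@[simp] theorem RamState.reg_setArr (s : RamState) (a i k : ℕ) :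
    (s.setArr a i k).reg = s.reg := rfl

@[simp] theorem RamState.arr_setArr (s : RamState) (a i k a' : ℕ) :
    (s.setArr a i k).arr a' = if a' = a then Function.update (s.arr a) i k else s.arr a' := by
  simp only [RamState.setArr, Function.update_apply]

/-- Does the program contain an assignment to register `k`? -/
def RamProgram.modReg : RamProgram → ℕ → Bool
  | skip, _ => false
  | set r _, k => r == k
  | put _ _ _, _ => false
  | seq p q, k => p.modReg k || q.modReg k
  | ite _ p q, k => p.modReg k || q.modReg k
  | loop _ p, k => p.modReg k

/-- Does the program contain an assignment to an entry of array `k`? -/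
def RamProgram.modArr : RamProgram → ℕ → Bool
  | skip, _ => false
  | set _ _, _ => false
  | put a _ _, k => a == k
  | seq p q, k => p.modArr k || q.modArr k
  | ite _ p q, k => p.modArr k || q.modArr k
  | loop _ p, k => p.modArr k

/-- The two states differ only where `p` may write. -/
structure Frame (p : RamProgram) (s s' : RamState) : Prop where
  reg : ∀ r, p.modReg r = false → s'.reg r = s.reg r
  arr : ∀ a, p.modArr a = false → s'.arr a = s.arr a

theorem Frame.refl (p : RamProgram) (s : RamState) : Frame p s s := ⟨fun _ _ => rfl, fun _ _ => rfl⟩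

theorem Frame.trans {p : RamProgram} {s s' s'' : RamState} (h : Frame p s s')
    (h' : Frame p s' s'') : Frame p s s'' :=
  ⟨fun r hr => (h'.reg r hr).trans (h.reg r hr), fun a ha => (h'.arr a ha).trans (h.arr a ha)⟩

/-- This lets a specification mention only what its program computes. For concrete programs, that a
register or array is untouched is decided by evaluating `modReg` or `modArr`, so `rfl` proves it. -/
theorem Frame.of_runs {p : RamProgram} {s s' : RamState} {t : ℕ} (h : Runs p s s' t) :
    Frame p s s' := by
  induction h with
  | skip s => exact .refl _ _
  | set s r x =>
    refine ⟨fun k hk => ?_, fun _ _ => rfl⟩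
    simp only [RamProgram.modReg, beq_eq_false_iff_ne] at hk
    simp [hk.symm]
  | put s a i x =>
    refine ⟨fun _ _ => rfl, fun k hk => ?_⟩
    simp only [RamProgram.modArr, beq_eq_false_iff_ne] at hk
    simp [hk.symm]
  | seq _ _ h h' =>
    refine ⟨fun k hk => ?_, fun k hk => ?_⟩
    · simp only [RamProgram.modReg, Bool.or_eq_false_iff] at hk
      exact (h'.reg k hk.2).trans (h.reg k hk.1)
    · simp only [RamProgram.modArr, Bool.or_eq_false_iff] at hk
      exact (h'.arr k hk.2).trans (h.arr k hk.1)
  | ite_true _ _ h =>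
    refine ⟨fun k hk => ?_, fun k hk => ?_⟩
    · simp only [RamProgram.modReg, Bool.or_eq_false_iff] at hk
      exact h.reg k hk.1
    · simp only [RamProgram.modArr, Bool.or_eq_false_iff] at hk
      exact h.arr k hk.1
  | ite_false _ _ h =>
    refine ⟨fun k hk => ?_, fun k hk => ?_⟩
    · simp only [RamProgram.modReg, Bool.or_eq_false_iff] at hk
      exact h.reg k hk.2
    · simp only [RamProgram.modArr, Bool.or_eq_false_iff] at hk
      exact h.arr k hk.2
  | loop_stop _ => exact .refl _ _
  | loop_step _ _ _ h h' =>
    exact ⟨fun k hk => (h'.reg k hk).trans (h.reg k hk),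
      fun k hk => (h'.arr k hk).trans (h.arr k hk)⟩

/-- Started in `s`, the program halts within `T` steps in a state with `Q`. -/
def Does (p : RamProgram) (s : RamState) (T : ℕ) (Q : RamState → Prop) : Prop :=
  ∃ s' t, Runs p s s' t ∧ t ≤ T ∧ Q s'

variable {p q : RamProgram} {s : RamState} {T T' : ℕ} {Q Q' R : RamState → Prop}

theorem Does.mono (h : Does p s T Q) (hT : T ≤ T') : Does p s T' Q := by
  obtain ⟨s', t, h, ht, hQ⟩ := h
  exact ⟨s', t, h, ht.trans hT, hQ⟩

theorem Does.conseq (h : Does p s T Q) (hQ : ∀ s', Frame p s s' → Q s' → Q' s') :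
    Does p s T Q' := by
  obtain ⟨s', t, h, ht, hq⟩ := h
  exact ⟨s', t, h, ht, hQ s' (.of_runs h) hq⟩

/-- Nonzero if the values of `x` and `y` have sum `3`. -/
def sumThree (x y : RamExpr) : RamExpr :=
  .sub (.const 1) (.add (.sub (.add x y) (.const 3)) (.sub (.const 3) (.add x y)))

theorem sumThree_eval {x y : RamExpr} :
    (sumThree x y).eval s ≠ 0 ↔ x.eval s + y.eval s = 3 := by
  simp only [sumThree, RamExpr.eval]
  omega

theorem sumThree_eval_eq_zero {x y : RamExpr} :
    (sumThree x y).eval s = 0 ↔ x.eval s + y.eval s ≠ 3 := by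
  simp only [sumThree, RamExpr.eval]
  omega

/-- Needed because time budgets are passed on by truncated subtraction: a program that halts within
`T - T'` steps certifies `T' < T`. -/
theorem Runs.pos {s' : RamState} {t : ℕ} (h : Runs p s s' t) : 0 < t := by
  induction h <;> omega

theorem Does.skip (h : Q s) (hT : 1 ≤ T := by simp only [RamExpr.cost, sumThree]; omega) :
    Does .skip s T Q := ⟨s, 1, .skip s, hT, h⟩

theorem Does.set {r : ℕ} {x : RamExpr} (h : Q (s.setReg r (x.eval s)))
    (hT : x.cost + 1 ≤ T := by simp only [RamExpr.cost, sumThree]; omega) :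
    Does (.set r x) s T Q := ⟨_, _, .set s r x, hT, h⟩

theorem Does.put {a : ℕ} {i x : RamExpr} (h : Q (s.setArr a (i.eval s) (x.eval s)))
    (hT : i.cost + x.cost + 1 ≤ T := by simp only [RamExpr.cost, sumThree]; omega) :
    Does (.put a i x) s T Q := ⟨_, _, .put s a i x, hT, h⟩

theorem Does.seq (h : Does p s T' R) (h' : ∀ s', Frame p s s' → R s' → Does q s' (T - T') Q) :
    Does (.seq p q) s T Q := by
  obtain ⟨s', t, h, ht, hR⟩ := h
  obtain ⟨s'', t', h2, ht', hQ⟩ := h' s' (.of_runs h) hR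
  have := h2.pos
  exact ⟨s'', _, .seq h h2, by omega, hQ⟩

theorem Does.set_seq {r : ℕ} {x : RamExpr}
    (h : Does q (s.setReg r (x.eval s)) (T - (x.cost + 1)) Q) :
    Does (.seq (.set r x) q) s T Q := by
  obtain ⟨s'', t', h2, ht', hQ⟩ := h
  have := h2.pos
  exact ⟨s'', _, .seq (.set s r x) h2, by omega, hQ⟩

theorem Does.put_seq {a : ℕ} {i x : RamExpr}
    (h : Does q (s.setArr a (i.eval s) (x.eval s)) (T - (i.cost + x.cost + 1)) Q) :
    Does (.seq (.put a i x) q) s T Q := by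
  obtain ⟨s'', t', h2, ht', hQ⟩ := h
  have := h2.pos
  exact ⟨s'', _, .seq (.put s a i x) h2, by omega, hQ⟩

theorem Does.ite {x : RamExpr} (h : x.eval s ≠ 0 → Does p s (T - (x.cost + 1)) Q)
    (h' : x.eval s = 0 → Does q s (T - (x.cost + 1)) Q) : Does (.ite x p q) s T Q := by
  by_cases hx : x.eval s = 0
  · obtain ⟨s', t, h, ht, hQ⟩ := h' hx
    have := h.pos
    exact ⟨s', _, .ite_false hx h, by omega, hQ⟩
  · obtain ⟨s', t, h, ht, hQ⟩ := h hx
    have := h.pos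
    exact ⟨s', _, .ite_true hx h, by omega, hQ⟩

/-- `for (i = x; i < b; i += y) p`, for a register `b`. -/
def forStep (i : ℕ) (x : RamExpr) (b : ℕ) (y : RamExpr) (p : RamProgram) : RamProgram :=
  .seq (.set i x) (.loop (.sub (.reg b) (.reg i)) (.seq p (.set i (.add (.reg i) y))))

/-- `for (i = 0; i < b; i++) p`, for a register `b`. -/
def forTo (i b : ℕ) (p : RamProgram) : RamProgram := forStep i (.const 0) b (.const 1) p

/-- The invariant is stated for the state in which the counter already has its next value.
Initialisation and the last failing test cost `x.cost + 1` and `4`; each round costs `4` for the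
test, `T` for the body and `e + 3` for the increment. -/
theorem Does.forStep {i b : ℕ} {x y : RamExpr} {d m e : ℕ} (I : ℕ → RamState → Prop)
    (hd : 0 < d) (hb : s.reg b = x.eval s + m * d) (hib : b ≠ i)
    (hpb : p.modReg b = false) (hpi : p.modReg i = false)
    (hy : ∀ s', Frame (forStep i x b y p) s s' → y.eval s' = d) (hye : y.cost = e)
    (h0 : I 0 (s.setReg i (x.eval s)))
    (h : ∀ k < m, ∀ s', Frame (MinStableCut.forStep i x b y p) s s' →
      s'.reg i = x.eval s + k * d → I k s' →
      Does p s' T fun s'' => I (k + 1) (s''.setReg i (x.eval s + (k + 1) * d))) :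
    Does (MinStableCut.forStep i x b y p) s (x.cost + 5 + m * (T + (7 + e)))
      fun s' => I m s' ∧ s'.reg i = x.eval s + m * d := by
  set F := MinStableCut.forStep i x b y p with hF
  have hFb : F.modReg b = false := by
    simp [hF, MinStableCut.forStep, RamProgram.modReg, hpb, hib.symm]
  have hFp : ∀ s₁ s₂, Frame p s₁ s₂ → Frame F s₁ s₂ := by
    intro s₁ s₂ h
    refine ⟨fun r hr => h.reg r ?_, fun r hr => h.arr r ?_⟩
    · simp only [hF, MinStableCut.forStep, RamProgram.modReg, Bool.or_eq_false_iff] at hr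
      exact hr.2.1
    · simp only [hF, MinStableCut.forStep, RamProgram.modArr, Bool.or_eq_false_iff] at hr
      exact hr.2.1
  have hFi : ∀ s₁ k, Frame F s₁ (s₁.setReg i k) := by
    intro s₁ k
    refine ⟨fun r hr => ?_, fun _ _ => rfl⟩
    simp only [hF, MinStableCut.forStep, RamProgram.modReg, Bool.or_eq_false_iff,
      beq_eq_false_iff_ne] at hr
    simp [hr.1.symm]
  have key : ∀ l k, k + l = m → ∀ s', Frame F s s' → s'.reg i = x.eval s + k * d → I k s' →
      Does (.loop (.sub (.reg b) (.reg i)) (.seq p (.set i (.add (.reg i) y)))) s'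
        (4 + l * (T + (7 + e))) fun s' => I m s' ∧ s'.reg i = x.eval s + m * d := by
    intro l
    induction l with
    | zero =>
      intro k hk s' hs hi hI
      obtain rfl : k = m := by omega
      refine ⟨s', _, Runs.loop_stop ?_, ?_, hI, hi⟩
      · simp [hs.reg b hFb, hb, hi]
      · simp
    | succ l ih =>
      intro k hk s' hs hi hI
      obtain ⟨s1, t1, r1, ht1, hI1⟩ := h k (by omega) s' hs hi hI
      have f1 := hFp _ _ (.of_runs r1)
      have hy1 := hy s1 (hs.trans f1)
      have hi1 : s1.reg i = x.eval s + k * d := by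
        rw [(Frame.of_runs r1).reg i hpi, hi]
      have hadd : (RamExpr.add (.reg i) y).eval s1 = x.eval s + (k + 1) * d := by
        simp only [RamExpr.eval, hi1, hy1]
        ring
      have r2 := Runs.set s1 i (.add (.reg i) y)
      rw [hadd] at r2
      obtain ⟨s2, t2, r3, ht2, hQ⟩ := ih (k + 1) (by omega) _
        ((hs.trans f1).trans (hFi s1 (x.eval s + (k + 1) * d))) (by simp) hI1
      refine ⟨s2, _, .loop_step ?_ (.seq r1 r2) r3, ?_, hQ⟩
      · simp only [RamExpr.eval, hs.reg b hFb, hb, hi]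
        have : k * d < m * d := Nat.mul_lt_mul_of_pos_right (by omega) hd
        omega
      · simp only [RamExpr.cost, hye, add_mul, one_mul] at ht1 ht2 ⊢
        omega
  obtain ⟨s', t, hr, ht, hQ⟩ := key m 0 (by omega) (s.setReg i (x.eval s)) (hFi _ _)
    (by simp) h0
  exact ⟨s', _, .seq (.set s i x) hr, by omega, hQ⟩

theorem Does.forTo {i b : ℕ} {m : ℕ} (I : ℕ → RamState → Prop) (T' : ℕ) (hb : s.reg b = m)
    (hT : 6 + m * (T' + 8) ≤ T) (h0 : I 0 (s.setReg i 0))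
    (h : ∀ k < m, ∀ s', Frame (MinStableCut.forTo i b p) s s' → s'.reg i = k → I k s' →
      Does p s' T' fun s'' => I (k + 1) (s''.setReg i (k + 1)))
    (hQ : ∀ s', Frame (MinStableCut.forTo i b p) s s' → I m s' → Q s')
    (hib : b ≠ i := by decide) (hpb : p.modReg b = false := by rfl)
    (hpi : p.modReg i = false := by rfl) :
    Does (MinStableCut.forTo i b p) s T Q := by
  have := Does.forStep (s := s) (p := p) (T := T') (x := .const 0) (y := .const 1) (d := 1)
    (m := m) (e := 1) (i := i) (b := b) I one_pos (by simpa using hb) hib hpb hpi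
    (fun _ _ => rfl) rfl h0
    (fun k hk s' hs hi hI => by
      simpa using h k hk s' hs (by simpa using hi) hI)
  exact (this.mono (by simpa using hT)).conseq fun s' hs h => hQ s' hs h.1

/-- Loops over the multiples of register `0`, from register `x` to register `b`. -/
theorem Does.forBlocks {i b x : ℕ} {m d : ℕ} (I : ℕ → RamState → Prop) (T' : ℕ) (hd : 0 < d)
    (hs0 : s.reg 0 = d) (hb : s.reg b = s.reg x + m * d)
    (hT : 6 + m * (T' + 8) ≤ T) (h0 : I 0 (s.setReg i (s.reg x)))
    (h : ∀ k < m, ∀ s', Frame (MinStableCut.forStep i (.reg x) b (.reg 0) p) s s' →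
      s'.reg i = s.reg x + k * d → I k s' →
      Does p s' T' fun s'' => I (k + 1) (s''.setReg i (s.reg x + (k + 1) * d)))
    (hQ : ∀ s', Frame (MinStableCut.forStep i (.reg x) b (.reg 0) p) s s' → I m s' → Q s')
    (hib : b ≠ i := by decide) (hi0 : i ≠ 0 := by decide) (hpb : p.modReg b = false := by rfl)
    (hpi : p.modReg i = false := by rfl) (hp0 : p.modReg 0 = false := by rfl) :
    Does (MinStableCut.forStep i (.reg x) b (.reg 0) p) s T Q := by
  have := Does.forStep (s := s) (p := p) (T := T') (x := .reg x) (y := .reg 0) (d := d)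
    (m := m) (e := 1) (i := i) (b := b) I hd (by simpa using hb) hib hpb hpi
    (fun s' hs' => by
      rw [RamExpr.eval, hs'.reg 0 (by simp [MinStableCut.forStep, RamProgram.modReg, hp0, hi0]),
        hs0]) rfl h0 h
  exact (this.mono (by simpa using hT)).conseq fun s' hs h => hQ s' hs h.1

end Programs

/-! ### Procedures

Register `0` holds `n`, register `2` the first free address of the heap (array `4`), register `3`
the position of the current bag in array `3`. A partial cut occupies `n` successive cells of the
heap. -/

section Procedures

/-- The partial cut at address `k`. -/
def cutAt (n : ℕ) (H : ℕ → ℕ) (k : ℕ) : Fin n → ℕ := fun v => H (k + v)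

/-- The matrix in an array. -/
def matrixOf (n : ℕ) (A : ℕ → ℕ) : Fin n → Fin n → ℕ := fun v u => A (v * n + u)

/-- The bag in the array `A` whose row starts at `b`. -/
def bagAt (n : ℕ) (A : ℕ → ℕ) (b : ℕ) : Finset (Fin n) := {v | A (b + v) ≠ 0}

theorem cutAt_congr {n : ℕ} {H H' : ℕ → ℕ} {k : ℕ} (h : ∀ v < n, H' (k + v) = H (k + v)) :
    cutAt n H' k = cutAt n H k := funext fun v => h v v.2

/-- Register `10` becomes register `11` times register `y`. -/
def mulProg (y : ℕ) : RamProgram :=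
  .seq (.set 10 (.const 0)) (forTo 12 11 (.set 10 (.add (.reg 10) (.reg y))))

/-- Row positions in matrices have to be found by repeated addition, at a cost linear in the row
index; hence the bound `b` on register `11`. -/
theorem mulProg_spec {s : RamState} {y b : ℕ} (hb : s.reg 11 ≤ b) (h₁ : y ≠ 10) (h₂ : y ≠ 12) :
    Does (mulProg y) s (8 + b * 12) fun s' => s'.reg 10 = s.reg 11 * s.reg y := by
  refine Does.set_seq (Does.forTo (m := s.reg 11) (fun k s' => s'.reg 10 = k * s.reg y) 4
    (by simp) (by simp; omega) (by simp) ?_ fun s' _ h => h)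
  intro k hk s' hs hi hI
  refine Does.set ?_
  have hy : s'.reg y = s.reg y := by
    rw [hs.reg y (by simp [forTo, forStep, RamProgram.modReg, h₁.symm, h₂.symm])]
    simp [h₁]
  simp [hI, hy]
  ring

/-- Register `14` becomes the weighted degree of the vertex in register `13`. -/
def degreeProg : RamProgram :=
  .seq (.set 11 (.reg 13)) <| .seq (mulProg 0) <| .seq (.set 14 (.const 0)) <|
    forTo 15 0 (.set 14 (.add (.reg 14) (.get 1 (.add (.reg 10) (.reg 15)))))

theorem degreeProg_spec {n : ℕ} {s : RamState} (hn : s.reg 0 = n) (v : Fin n)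
    (hv : s.reg 13 = v) :
    Does degreeProg s (40 * (n + 1)) fun s' =>
      s'.reg 14 = ∑ u, matrixOf n (s.arr 1) v u := by
  refine Does.set_seq (Does.seq (mulProg_spec (b := n) (by simp [hv]) (by simp) (by simp))
    fun s₁ f₁ h₁ => ?_)
  refine Does.set_seq ?_
  have e0 : s₁.reg 0 = n := by rw [f₁.reg 0 rfl]; simpa
  have e1 : s₁.arr 1 = s.arr 1 := f₁.arr 1 rfl
  have e10 : s₁.reg 10 = v * n := by rw [h₁]; simp [hv, hn]
  refine Does.forTo (m := n)
    (fun k s' => s'.reg 14 = ∑ u ∈ Finset.range k, s.arr 1 (v * n + u)) 7 (by simpa using e0)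
    (by simp; omega) (by simp) ?_ fun s' _ h => ?_
  · intro k hk s' hs hi hI
    refine Does.set ?_
    have e10' : s'.reg 10 = v * n := by rw [hs.reg 10 rfl]; simpa using e10
    have e1' : s'.arr 1 = s.arr 1 := by rw [hs.arr 1 rfl]; simpa using e1
    simp [hI, e10', e1', hi, Finset.sum_range_succ]
  · rw [h, Finset.sum_range]
    rfl

/-- Register `17` becomes the crossing weight at the vertex in register `13` of the partial cut
whose address is in register `16`. -/
def crossingProg : RamProgram :=
  .seq (.set 11 (.reg 13)) <| .seq (mulProg 0) <| .seq (.set 17 (.const 0)) <|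
    forTo 18 0 (.ite (sumThree (.get 4 (.add (.reg 16) (.reg 18)))
        (.get 4 (.add (.reg 16) (.reg 13))))
      (.set 17 (.add (.reg 17) (.get 1 (.add (.reg 10) (.reg 18))))) .skip)

theorem crossingProg_spec {n : ℕ} {s : RamState} (hn : s.reg 0 = n) (v : Fin n)
    (hv : s.reg 13 = v) :
    Does crossingProg s (80 * (n + 1)) fun s' =>
      s'.reg 17 = crossing (matrixOf n (s.arr 1)) (cutAt n (s.arr 4) (s.reg 16)) v := by
  refine Does.set_seq (Does.seq (mulProg_spec (b := n) (by simp [hv]) (by simp) (by simp))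
    fun s₁ f₁ h₁ => ?_)
  refine Does.set_seq ?_
  have e0 : s₁.reg 0 = n := by rw [f₁.reg 0 rfl]; simpa
  have e13 : s₁.reg 13 = v := by rw [f₁.reg 13 rfl]; simpa
  have e16 : s₁.reg 16 = s.reg 16 := by rw [f₁.reg 16 rfl]; simp
  have e1 : s₁.arr 1 = s.arr 1 := f₁.arr 1 rfl
  have e4 : s₁.arr 4 = s.arr 4 := f₁.arr 4 rfl
  have e10 : s₁.reg 10 = v * n := by rw [h₁]; simp [hv, hn]
  refine Does.forTo (m := n)
    (fun k s' => s'.reg 17 = ∑ u ∈ Finset.range k,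
      if s.arr 4 (s.reg 16 + u) + s.arr 4 (s.reg 16 + v) = 3 then s.arr 1 (v * n + u) else 0) 40
    (by simpa using e0) (by simp; omega) (by simp) ?_ fun s' _ h => ?_
  · intro k hk s' hs hi hI
    have e10' : s'.reg 10 = v * n := by rw [hs.reg 10 rfl]; simpa using e10
    have e13' : s'.reg 13 = v := by rw [hs.reg 13 rfl]; simpa using e13
    have e16' : s'.reg 16 = s.reg 16 := by rw [hs.reg 16 rfl]; simpa using e16
    have e1' : s'.arr 1 = s.arr 1 := by rw [hs.arr 1 rfl]; simpa using e1
    have e4' : s'.arr 4 = s.arr 4 := by rw [hs.arr 4 rfl]; simpa using e4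
    refine Does.ite (fun hx => Does.set ?_) (fun hx => Does.skip ?_)
    · rw [sumThree_eval] at hx
      simp only [RamExpr.eval, e4', e16', e13', hi] at hx
      simp [hI, e10', e1', hi, Finset.sum_range_succ, hx]
    · rw [sumThree_eval_eq_zero] at hx
      simp only [RamExpr.eval, e4', e16', e13', hi] at hx
      simp [hI, Finset.sum_range_succ, hx]
  · rw [h, Finset.sum_range]
    rfl

/-- Register `19` becomes the total crossing weight of the partial cut whose address is in
register `16`. -/
def totalProg : RamProgram :=
  .seq (.set 19 (.const 0)) <|
    forTo 13 0 (.seq crossingProg (.set 19 (.add (.reg 19) (.reg 17))))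

theorem totalProg_spec {n : ℕ} {s : RamState} (hn : s.reg 0 = n) :
    Does totalProg s (100 * (n + 1) ^ 2) fun s' =>
      s'.reg 19 = totalCrossing (matrixOf n (s.arr 1)) (cutAt n (s.arr 4) (s.reg 16)) := by
  let f : ℕ → ℕ := fun v => if h : v < n then
    crossing (matrixOf n (s.arr 1)) (cutAt n (s.arr 4) (s.reg 16)) ⟨v, h⟩ else 0
  refine Does.set_seq ?_
  refine Does.forTo (m := n) (fun k s' => s'.reg 19 = ∑ u ∈ Finset.range k, f u)
    (80 * (n + 1) + 4) (by simpa using hn) (Nat.le_sub_of_add_le (by simp; nlinarith)) (by simp) ?_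
    fun s' _ h => ?_
  · intro k hk s' hs hi hI
    have e0 : s'.reg 0 = n := by rw [hs.reg 0 rfl]; simpa using hn
    have e16 : s'.reg 16 = s.reg 16 := by rw [hs.reg 16 rfl]; simp
    have e1 : s'.arr 1 = s.arr 1 := by rw [hs.arr 1 rfl]; simp
    have e4 : s'.arr 4 = s.arr 4 := by rw [hs.arr 4 rfl]; simp
    refine Does.seq (crossingProg_spec e0 ⟨k, hk⟩ hi) fun s₁ f₁ h₁ => Does.set ?_
    have e19 : s₁.reg 19 = s'.reg 19 := f₁.reg 19 rfl
    rw [e1, e4, e16] at h₁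
    simp [Finset.sum_range_succ, h₁, e19, hI, f, hk]
  · rw [h, Finset.sum_range]
    simp [f, totalCrossing]

/-- Register `20` becomes nonzero if and only if the partial cut at the top of the heap is stable
off the current bag. -/
def stableProg : RamProgram :=
  .seq (.set 16 (.reg 2)) <| .seq (.set 20 (.const 1)) <|
    forTo 13 0 (.ite (.get 3 (.add (.reg 3) (.reg 13))) .skip <|
      .ite (.get 4 (.add (.reg 2) (.reg 13)))
        (.seq crossingProg <| .seq degreeProg <|
          .ite (.sub (.reg 14) (.add (.reg 17) (.reg 17))) (.set 20 (.const 0)) .skip)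
        .skip)

theorem stableProg_spec {n : ℕ} {s : RamState} (hn : s.reg 0 = n) :
    Does stableProg s (300 * (n + 1) ^ 2) fun s' => (s'.reg 20 ≠ 0 ↔
      StableOff (matrixOf n (s.arr 1)) (bagAt n (s.arr 3) (s.reg 3))
        (cutAt n (s.arr 4) (s.reg 2))) := by
  set a := matrixOf n (s.arr 1) with ha
  set c := cutAt n (s.arr 4) (s.reg 2) with hc
  set B := bagAt n (s.arr 3) (s.reg 3) with hB
  let P : ℕ → Prop := fun v => ∀ h : v < n, (⟨v, h⟩ : Fin n) ∉ B → c ⟨v, h⟩ ≠ 0 →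
    ∑ u, a ⟨v, h⟩ u ≤ 2 * crossing a c ⟨v, h⟩
  refine Does.set_seq (Does.set_seq ?_)
  refine Does.forTo (m := n) (fun k s' => s'.reg 20 ≠ 0 ↔ ∀ v < k, P v) (200 * (n + 1))
    (by simpa using hn) (Nat.le_sub_of_add_le (Nat.le_sub_of_add_le (by simp; nlinarith)))
    (by simp) ?_ fun s' _ h => ?_
  · intro k hk s' hs hi hI
    have e0 : s'.reg 0 = n := by rw [hs.reg 0 rfl]; simpa using hn
    have e2 : s'.reg 2 = s.reg 2 := by rw [hs.reg 2 rfl]; simp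
    have e3 : s'.reg 3 = s.reg 3 := by rw [hs.reg 3 rfl]; simp
    have e16 : s'.reg 16 = s.reg 2 := by rw [hs.reg 16 rfl]; simp
    have e1 : s'.arr 1 = s.arr 1 := by rw [hs.arr 1 rfl]; simp
    have a3 : s'.arr 3 = s.arr 3 := by rw [hs.arr 3 rfl]; simp
    have e4 : s'.arr 4 = s.arr 4 := by rw [hs.arr 4 rfl]; simp
    have split : (∀ v < k + 1, P v) ↔ (∀ v < k, P v) ∧ P k := by
      simp only [Nat.lt_succ_iff_lt_or_eq, or_imp, forall_and, forall_eq]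
    have done : P k → ∀ s'' : RamState, s''.reg 20 = s'.reg 20 →
        ((s''.setReg 13 (k + 1)).reg 20 ≠ 0 ↔ ∀ v < k + 1, P v) := by
      intro hPk s'' h20
      rw [split]
      simp [h20, hI, hPk]
    have hmem : ((⟨k, hk⟩ : Fin n) ∈ B) ↔ s.arr 3 (s.reg 3 + k) ≠ 0 := by
      simp [hB, bagAt]
    have hck : c ⟨k, hk⟩ = s.arr 4 (s.reg 2 + k) := rfl
    refine Does.ite (fun hx => Does.skip ?_) fun hx => Does.ite (fun hy => ?_) fun hy =>
      Does.skip ?_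
    · refine done (fun _ h => absurd (hmem.2 ?_) h) _ rfl
      simpa [a3, e3, hi] using hx
    · refine Does.seq (crossingProg_spec e0 ⟨k, hk⟩ hi) fun s₁ f₁ h₁ => ?_
      refine Does.seq (degreeProg_spec (v := ⟨k, hk⟩) (by rw [f₁.reg 0 rfl, e0])
        (by rw [f₁.reg 13 rfl, hi])) fun s₂ f₂ h₂ => ?_
      have h17 : s₂.reg 17 = crossing a c ⟨k, hk⟩ := by
        rw [f₂.reg 17 rfl, h₁, e1, e4, e16]
      have h14 : s₂.reg 14 = ∑ u, a ⟨k, hk⟩ u := by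
        rw [h₂, f₁.arr 1 rfl, e1]
      have h20 : s₂.reg 20 = s'.reg 20 := by rw [f₂.reg 20 rfl, f₁.reg 20 rfl]
      refine Does.ite (fun hz => Does.set ?_) fun hz => Does.skip ?_
      · simp only [RamExpr.eval, h17, h14] at hz
        have : ¬ P k := by
          intro h
          have := h hk (fun hm => hmem.1 hm (by simpa [a3, e3, hi] using hx))
            (by simpa [hck, e4, e2, hi] using hy)
          omega
        rw [split]
        simp [this]
      · simp only [RamExpr.eval, h17, h14] at hz
        exact done (fun _ _ _ => by omega) _ h20
    · refine done (fun _ _ h => absurd ?_ h) _ rfl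
      simpa [hck, e4, e2, hi] using hy
  · rw [h]
    exact ⟨fun h v => h v v.2 v.2, fun h v hv hv' => h ⟨v, hv⟩⟩

/-- Register `22` becomes nonzero if and only if the partial cut whose address is in register `21`
and the one at the top of the heap have the same signature on the current bag. -/
def sameProg : RamProgram :=
  .seq (.set 22 (.const 1)) <|
    forTo 13 0 (.ite (.get 3 (.add (.reg 3) (.reg 13)))
      (.seq (.set 16 (.reg 2)) <| .seq crossingProg <| .seq (.set 23 (.reg 17)) <|
        .seq (.set 16 (.reg 21)) <| .seq crossingProg <|
        .seq (.ite (.add (.sub (.reg 23) (.reg 17)) (.sub (.reg 17) (.reg 23)))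
          (.set 22 (.const 0)) .skip) <|
        .seq (.set 23 (.get 4 (.add (.reg 2) (.reg 13)))) <|
        .seq (.set 17 (.get 4 (.add (.reg 21) (.reg 13)))) <|
        .ite (.add (.sub (.reg 23) (.reg 17)) (.sub (.reg 17) (.reg 23)))
          (.set 22 (.const 0)) .skip)
      .skip)

theorem sameProg_spec {n : ℕ} {s : RamState} (hn : s.reg 0 = n) :
    Does sameProg s (400 * (n + 1) ^ 2) fun s' => (s'.reg 22 ≠ 0 ↔
      SameOn (matrixOf n (s.arr 1)) (bagAt n (s.arr 3) (s.reg 3))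
        (cutAt n (s.arr 4) (s.reg 21)) (cutAt n (s.arr 4) (s.reg 2))) := by
  set a := matrixOf n (s.arr 1) with ha
  set c := cutAt n (s.arr 4) (s.reg 2) with hc
  set d := cutAt n (s.arr 4) (s.reg 21) with hd
  set B := bagAt n (s.arr 3) (s.reg 3) with hB
  let P : ℕ → Prop := fun v => ∀ h : v < n, (⟨v, h⟩ : Fin n) ∈ B → d ⟨v, h⟩ = c ⟨v, h⟩ ∧
    crossing a d ⟨v, h⟩ = crossing a c ⟨v, h⟩
  refine Does.set_seq ?_
  refine Does.forTo (m := n) (fun k s' => s'.reg 22 ≠ 0 ↔ ∀ v < k, P v) (300 * (n + 1))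
    (by simpa using hn) (Nat.le_sub_of_add_le (by simp; nlinarith))
    (by simp) ?_ fun s' _ h => ?_
  · intro k hk s' hs hi hI
    have e0 : s'.reg 0 = n := by rw [hs.reg 0 rfl]; simpa using hn
    have e2 : s'.reg 2 = s.reg 2 := by rw [hs.reg 2 rfl]; simp
    have e3 : s'.reg 3 = s.reg 3 := by rw [hs.reg 3 rfl]; simp
    have e21 : s'.reg 21 = s.reg 21 := by rw [hs.reg 21 rfl]; simp
    have e1 : s'.arr 1 = s.arr 1 := by rw [hs.arr 1 rfl]; simp
    have a3 : s'.arr 3 = s.arr 3 := by rw [hs.arr 3 rfl]; simp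
    have e4 : s'.arr 4 = s.arr 4 := by rw [hs.arr 4 rfl]; simp
    have split : (∀ v < k + 1, P v) ↔ (∀ v < k, P v) ∧ P k := by
      simp only [Nat.lt_succ_iff_lt_or_eq, or_imp, forall_and, forall_eq]
    have hmem : ((⟨k, hk⟩ : Fin n) ∈ B) ↔ s.arr 3 (s.reg 3 + k) ≠ 0 := by
      simp [hB, bagAt]
    refine Does.ite (fun hx => ?_) fun hx => Does.skip ?_
    · have hkB : (⟨k, hk⟩ : Fin n) ∈ B := hmem.2 (by simpa [a3, e3, hi] using hx)
      refine Does.set_seq (Does.seq (crossingProg_spec (v := ⟨k, hk⟩) (by simpa using e0)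
        (by simpa using hi)) fun s₁ f₁ h₁ => ?_)
      have r₁ : ∀ r, crossingProg.modReg r = false → r ≠ 16 → s₁.reg r = s'.reg r := by
        intro r hr hr'
        rw [f₁.reg r hr]
        simp [hr']
      have g1 : s₁.arr 1 = s.arr 1 := by rw [f₁.arr 1 rfl]; simpa using e1
      have g4 : s₁.arr 4 = s.arr 4 := by rw [f₁.arr 4 rfl]; simpa using e4
      refine Does.set_seq (Does.set_seq (Does.seq (crossingProg_spec (v := ⟨k, hk⟩)
        (by simpa [r₁ 0 rfl] using e0) (by simpa [r₁ 13 rfl] using hi)) fun s₂ f₂ h₂ => ?_))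
      simp only [RamState.arr_setReg, RamState.reg_setReg, RamExpr.eval] at h₁ h₂
      simp only [e1, e4, e2, if_true] at h₁
      simp only [g1, g4, r₁ 21 rfl (by simp), e21] at h₂
      have k17 : s₂.reg 17 = crossing a d ⟨k, hk⟩ := by simpa using h₂
      have k23 : s₂.reg 23 = crossing a c ⟨k, hk⟩ := by
        rw [f₂.reg 23 rfl]
        simpa using h₁
      have k22 : s₂.reg 22 = s'.reg 22 := by
        rw [f₂.reg 22 rfl]
        simp [r₁ 22 rfl]
      have k4 : s₂.arr 4 = s.arr 4 := by rw [f₂.arr 4 rfl]; simpa using g4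
      have k2 : s₂.reg 2 = s.reg 2 := by
        rw [f₂.reg 2 rfl]
        simp [r₁ 2 rfl, e2]
      have k21 : s₂.reg 21 = s.reg 21 := by
        rw [f₂.reg 21 rfl]
        simp [r₁ 21 rfl, e21]
      have k13 : s₂.reg 13 = k := by
        rw [f₂.reg 13 rfl]
        simp [r₁ 13 rfl, hi]
      -- The first test compares the crossing weights, the second one the sides. Equality is tested
      -- by adding both truncated differences.
      refine Does.seq (T' := 20) (R := fun s₃ => s₃.reg 22 ≠ 0 ↔ s'.reg 22 ≠ 0 ∧
        crossing a d ⟨k, hk⟩ = crossing a c ⟨k, hk⟩)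
        (Does.ite (fun hz => Does.set ?_) fun hz => Does.skip ?_) fun s₃ f₃ h₃ => ?_
      · simp only [RamExpr.eval, k23, k17] at hz
        simp only [RamState.reg_setReg, if_true, RamExpr.eval, ne_eq, not_true_eq_false,
          false_iff, not_and]
        omega
      · simp only [RamExpr.eval, k23, k17] at hz
        rw [k22]
        have : crossing a d ⟨k, hk⟩ = crossing a c ⟨k, hk⟩ := by omega
        simp [this]
      · have l4 : s₃.arr 4 = s.arr 4 := by rw [f₃.arr 4 rfl, k4]
        have l2 : s₃.reg 2 = s.reg 2 := by rw [f₃.reg 2 rfl, k2]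
        have l21 : s₃.reg 21 = s.reg 21 := by rw [f₃.reg 21 rfl, k21]
        have l13 : s₃.reg 13 = k := by rw [f₃.reg 13 rfl, k13]
        have hck : c ⟨k, hk⟩ = s.arr 4 (s.reg 2 + k) := rfl
        have hdk : d ⟨k, hk⟩ = s.arr 4 (s.reg 21 + k) := rfl
        have hPk : P k ↔ d ⟨k, hk⟩ = c ⟨k, hk⟩ ∧
            crossing a d ⟨k, hk⟩ = crossing a c ⟨k, hk⟩ :=
          ⟨fun h => h hk hkB, fun h _ _ => h⟩
        refine Does.set_seq (Does.set_seq (Does.ite (fun hz => Does.set ?_) fun hz =>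
          Does.skip ?_))
        · simp [l4, l2, l21, l13, ← hck, ← hdk] at hz
          rw [split, hPk]
          simp only [RamState.reg_setReg, RamExpr.eval]
          norm_num
          intro _ h
          omega
        · simp [l4, l2, l21, l13, ← hck, ← hdk] at hz
          rw [split, hPk, ← hI]
          simp only [RamState.reg_setReg]
          norm_num
          rw [← ne_eq, h₃]
          have : d ⟨k, hk⟩ = c ⟨k, hk⟩ := by omega
          simp [this]
    · have : P k := fun _ h => absurd (by simpa [a3, e3, hi] using hx) (hmem.1 h)
      rw [split]
      simp [hI, this]
  · rw [h]
    exact ⟨fun h v => h v v.2 v.2, fun h v hv hv' => h ⟨v, hv⟩⟩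

end Procedures

/-! ### Searching, inserting into and joining tables -/

section TableProcedures

/-- Copies the block at the top of the heap to the address in register `21`. -/
def copyProg : RamProgram :=
  forTo 24 0 (.put 4 (.add (.reg 21) (.reg 24)) (.get 4 (.add (.reg 2) (.reg 24))))

theorem copyProg_spec {n : ℕ} {s : RamState} (hn : s.reg 0 = n)
    (hle : s.reg 21 + n ≤ s.reg 2) :
    Does copyProg s (20 * (n + 1)) fun s' =>
      (∀ v < n, s'.arr 4 (s.reg 21 + v) = s.arr 4 (s.reg 2 + v)) ∧
      ∀ k, k < s.reg 21 ∨ s.reg 21 + n ≤ k → s'.arr 4 k = s.arr 4 k := by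
  refine Does.forTo (m := n) (fun k s' =>
      (∀ v < k, s'.arr 4 (s.reg 21 + v) = s.arr 4 (s.reg 2 + v)) ∧
      ∀ i, i < s.reg 21 ∨ s.reg 21 + k ≤ i → s'.arr 4 i = s.arr 4 i) 8 hn (by omega)
    (by simp) ?_ fun s' _ h => h
  intro k hk s' hs hi ⟨hI, hI'⟩
  have e2 : s'.reg 2 = s.reg 2 := by rw [hs.reg 2 rfl]
  have e21 : s'.reg 21 = s.reg 21 := by rw [hs.reg 21 rfl]
  refine Does.put ?_
  simp only [RamState.arr_setReg, RamState.arr_setArr, if_true, RamExpr.eval, e2, e21, hi,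
    Function.update_apply]
  refine ⟨fun v hv => ?_, fun i hik => ?_⟩
  · by_cases hvk : v = k
    · subst hvk
      rw [if_pos rfl]
      -- The target block ends before the source block starts, so the source cell still has its
      -- original content.
      exact hI' _ (by omega)
    · rw [if_neg (by omega)]
      exact hI v (by omega)
  · rw [if_neg (by omega)]
    exact hI' i (by omega)

/-- One step of the search in a table: compares the entry whose address is in register `21` with
the candidate at the top of the heap. -/
def scanStepProg : RamProgram :=
  .seq sameProg <| .ite (.reg 22)
    (.seq (.set 25 (.const 1)) <| .seq (.set 16 (.reg 21)) <| .seq totalProg <|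
      .ite (.sub (.reg 19) (.reg 26)) copyProg .skip)
    .skip

open Classical in
theorem scanStepProg_spec {n : ℕ} {s : RamState} (hn : s.reg 0 = n) {a : Fin n → Fin n → ℕ}
    (ha : matrixOf n (s.arr 1) = a) {B : Finset (Fin n)} (hB : bagAt n (s.arr 3) (s.reg 3) = B)
    {c d : Fin n → ℕ} (hc : cutAt n (s.arr 4) (s.reg 2) = c)
    (hd : cutAt n (s.arr 4) (s.reg 21) = d) (h26 : s.reg 26 = totalCrossing a c)
    (hle : s.reg 21 + n ≤ s.reg 2) :
    Does scanStepProg s (700 * (n + 1) ^ 2) fun s' =>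
      (cutAt n (s'.arr 4) (s.reg 21) =
        if SameOn a B d c ∧ totalCrossing a c < totalCrossing a d then c else d) ∧
      (∀ k, k < s.reg 21 ∨ s.reg 21 + n ≤ k → s'.arr 4 k = s.arr 4 k) ∧
      (s'.reg 25 ≠ 0 ↔ s.reg 25 ≠ 0 ∨ SameOn a B d c) := by
  have hsq : n + 1 ≤ (n + 1) ^ 2 := by nlinarith
  refine Does.seq (sameProg_spec hn) fun s₁ f₁ h₁ => ?_
  rw [ha, hB, hc, hd] at h₁
  have g4 : s₁.arr 4 = s.arr 4 := f₁.arr 4 rfl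
  refine Does.ite (fun hx => ?_) fun hx => Does.skip ?_
  · have hsame := h₁.1 hx
    refine Does.set_seq (Does.set_seq (Does.seq (totalProg_spec (n := n) ?_)
      fun s₂ f₂ h₂ => ?_))
    · simpa [f₁.reg 0 rfl] using hn
    have k4 : s₂.arr 4 = s.arr 4 := by rw [f₂.arr 4 rfl]; simpa using g4
    have k21 : s₂.reg 21 = s.reg 21 := by rw [f₂.reg 21 rfl]; simp [f₁.reg 21 rfl]
    have k2 : s₂.reg 2 = s.reg 2 := by rw [f₂.reg 2 rfl]; simp [f₁.reg 2 rfl]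
    have k0 : s₂.reg 0 = n := by rw [f₂.reg 0 rfl]; simp [f₁.reg 0 rfl, hn]
    have k25 : s₂.reg 25 = 1 := by rw [f₂.reg 25 rfl]; simp
    have k26 : s₂.reg 26 = totalCrossing a c := by
      rw [f₂.reg 26 rfl]; simp [f₁.reg 26 rfl, h26]
    have k19 : s₂.reg 19 = totalCrossing a d := by
      rw [h₂]
      simp [g4, f₁.arr 1 rfl, f₁.reg 21 rfl, ha, hd]
    refine Does.ite (fun hz => ?_) fun hz => Does.skip ?_
    · simp only [RamExpr.eval, k19, k26] at hz
      refine ((copyProg_spec k0 (by rw [k21, k2]; exact hle)).mono ?_).conseq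
        fun s₃ f₃ ⟨h₃, h₃'⟩ => ?_
      · simp only [RamExpr.cost]
        omega
      rw [k4, k21, k2] at h₃
      rw [k4, k21] at h₃'
      refine ⟨?_, h₃', ?_⟩
      · rw [if_pos ⟨hsame, by omega⟩, ← hc]
        exact funext fun v => h₃ v v.2
      · rw [f₃.reg 25 rfl, k25]
        simp [hsame]
    · simp only [RamExpr.eval, k19, k26] at hz
      refine ⟨?_, fun k _ => by rw [k4], ?_⟩
      · rw [if_neg (by omega), k4, hd]
      · simp [k25, hsame]
  · have hsame : ¬ SameOn a B d c := fun h => h₁.2 h hx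
    refine ⟨?_, fun k _ => by rw [g4], ?_⟩
    · rw [if_neg (fun h => hsame h.1), g4, hd]
    · simp [f₁.reg 25 rfl, hsame]

/-- Searches the table from register `8` to the top of the heap for the signature of the candidate
at the top of the heap, which replaces a heavier entry of the same signature. Register `25` becomes
nonzero if the signature was found. -/
def scanProg : RamProgram :=
  .seq (.set 25 (.const 0)) <| .seq (.set 16 (.reg 2)) <| .seq totalProg <|
    .seq (.set 26 (.reg 19)) <| forStep 21 (.reg 8) 2 (.reg 0) scanStepProg

theorem block_le {n i m : ℕ} (h : i < m) : i * n + n ≤ m * n := by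
  have := Nat.mul_le_mul_right n (Nat.succ_le_of_lt h)
  rw [Nat.succ_mul] at this
  exact this

open Classical in
theorem scanProg_spec {n m S : ℕ} {s : RamState} (hn : s.reg 0 = n) (hn0 : 0 < n) (hmS : m ≤ S)
    {a : Fin n → Fin n → ℕ}
    (ha : matrixOf n (s.arr 1) = a) {B : Finset (Fin n)} (hB : bagAt n (s.arr 3) (s.reg 3) = B)
    {c : Fin n → ℕ} (hc : cutAt n (s.arr 4) (s.reg 2) = c) {E : ℕ → Fin n → ℕ}
    (hE : ∀ i < m, cutAt n (s.arr 4) (s.reg 8 + i * n) = E i)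
    (htop : s.reg 2 = s.reg 8 + m * n) :
    Does scanProg s (1000 * (S + 1) * (n + 1) ^ 2) fun s' =>
      (∀ i < m, cutAt n (s'.arr 4) (s.reg 8 + i * n) =
        if SameOn a B (E i) c ∧ totalCrossing a c < totalCrossing a (E i) then c else E i) ∧
      (∀ k, k < s.reg 8 ∨ s.reg 2 ≤ k → s'.arr 4 k = s.arr 4 k) ∧
      (s'.reg 25 ≠ 0 ↔ ∃ i < m, SameOn a B (E i) c) := by
  refine Does.set_seq (Does.set_seq (Does.seq (totalProg_spec (n := n) (by simpa using hn))
    fun s₁ f₁ h₁ => Does.set_seq ?_))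
  have r₁ : ∀ r, totalProg.modReg r = false → r ≠ 16 → r ≠ 25 → s₁.reg r = s.reg r := by
    intro r hr hr' hr''
    rw [f₁.reg r hr]
    simp [hr', hr'']
  have a1 : s₁.arr 1 = s.arr 1 := by rw [f₁.arr 1 rfl]; simp
  have a3 : s₁.arr 3 = s.arr 3 := by rw [f₁.arr 3 rfl]; simp
  have a4 : s₁.arr 4 = s.arr 4 := by rw [f₁.arr 4 rfl]; simp
  have k19 : s₁.reg 19 = totalCrossing a c := by
    rw [h₁]
    simp [ha, hc]
  have k25 : s₁.reg 25 = 0 := by rw [f₁.reg 25 rfl]; simp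
  refine Does.forBlocks (m := m) (d := n) (fun k s' =>
      (∀ i < k, cutAt n (s'.arr 4) (s.reg 8 + i * n) =
        if SameOn a B (E i) c ∧ totalCrossing a c < totalCrossing a (E i) then c else E i) ∧
      (∀ i, i < s.reg 8 ∨ s.reg 8 + k * n ≤ i → s'.arr 4 i = s.arr 4 i) ∧
      (s'.reg 25 ≠ 0 ↔ ∃ i < k, SameOn a B (E i) c)) (700 * (n + 1) ^ 2) hn0
    (by simp [r₁ 0 rfl, hn]) (by simp [r₁ 2 rfl, r₁ 8 rfl, htop]) ?_ ?_ ?_ ?_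
  · have h1 : m * (700 * (n + 1) ^ 2 + 8) ≤ S * (700 * (n + 1) ^ 2 + 8) :=
      Nat.mul_le_mul_right _ hmS
    refine Nat.le_sub_of_add_le (Nat.le_sub_of_add_le (Nat.le_sub_of_add_le
      (Nat.le_sub_of_add_le ?_)))
    simp only [RamExpr.cost]
    have : 1 ≤ (n + 1) ^ 2 := Nat.one_le_pow _ _ (by omega)
    nlinarith
  · simp [a4, k25]
  · rintro k hk s' hs hi ⟨hI1, hI2, hI3⟩
    simp only [RamState.reg_setReg, RamExpr.eval] at hi
    norm_num at hi
    rw [r₁ 8 rfl (by simp) (by simp)] at hi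
    have r' : ∀ r, scanStepProg.modReg r = false → totalProg.modReg r = false → r ≠ 16 →
        r ≠ 25 → r ≠ 26 → r ≠ 21 → s'.reg r = s.reg r := by
      intro r h1 h2 h3 h4 h5 h6
      rw [hs.reg r (by simp [forStep, RamProgram.modReg, h1, h6.symm])]
      simp [h5, r₁ r h2 h3 h4]
    have e2 : s'.reg 2 = s.reg 2 := r' 2 rfl rfl (by simp) (by simp) (by simp) (by simp)
    have e3 : s'.reg 3 = s.reg 3 := r' 3 rfl rfl (by simp) (by simp) (by simp) (by simp)
    have e0 : s'.reg 0 = n := by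
      rw [r' 0 rfl rfl (by simp) (by simp) (by simp) (by simp), hn]
    have e26 : s'.reg 26 = totalCrossing a c := by rw [hs.reg 26 rfl]; simp [k19]
    have e1 : s'.arr 1 = s.arr 1 := by rw [hs.arr 1 rfl]; simp [a1]
    have e3' : s'.arr 3 = s.arr 3 := by rw [hs.arr 3 rfl]; simp [a3]
    have hkm := block_le (n := n) hk
    refine (scanStepProg_spec (a := a) (B := B) (c := c) (d := E k) e0 (by rw [e1, ha])
      (by rw [e3', e3, hB])
      ?_ ?_ e26 ?_).conseq fun s'' f'' ⟨h1, h2, h3⟩ => ?_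
    · rw [e2, ← hc]
      -- Only entries already passed can have been overwritten, so the candidate and the current
      -- entry are still the original ones.
      exact cutAt_congr fun v hv => hI2 _ (by omega)
    · rw [hi, ← hE k hk]
      exact cutAt_congr fun v hv => hI2 _ (by omega)
    · omega
    · rw [hi] at h1 h2
      simp only [RamState.arr_setReg, RamState.reg_setReg]
      refine ⟨fun i hik => ?_, fun i hik => ?_, ?_⟩
      · rcases Nat.lt_succ_iff_lt_or_eq.1 hik with hik | rfl
        · rw [← hI1 i hik]
          have := block_le (n := n) hik
          exact cutAt_congr fun v hv => h2 _ (by omega)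
        · exact h1
      · have : (k + 1) * n = k * n + n := by ring
        rw [h2 i (by omega)]
        exact hI2 i (by omega)
      · norm_num
        rw [← ne_eq, h3, hI3]
        constructor
        · rintro (⟨i, hi, h⟩ | h)
          · exact ⟨i, by omega, h⟩
          · exact ⟨k, by omega, h⟩
        · rintro ⟨i, hi, h⟩
          rcases Nat.lt_succ_iff_lt_or_eq.1 (Nat.lt_succ_of_le hi) with hi | rfl
          · exact Or.inl ⟨i, hi, h⟩
          · exact Or.inr h
  · rintro s' - ⟨h1, h2, h3⟩
    exact ⟨h1, by rwa [htop], h3⟩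

/-- Inserts the candidate at the top of the heap into the table that starts at the address in
register `8` and ends at the top of the heap. -/
def insertProg : RamProgram :=
  .seq stableProg <| .ite (.reg 20)
    (.seq scanProg <| .ite (.reg 25) .skip (.set 2 (.add (.reg 2) (.reg 0)))) .skip

/-- The candidate already occupies the block right behind the table. Appending it means moving the
top of the heap past it; otherwise it is left behind as garbage above the table. -/
theorem insertProg_spec {n m S : ℕ} {s : RamState} (hn : s.reg 0 = n) (hn0 : 0 < n) (hmS : m ≤ S)
    {a : Fin n → Fin n → ℕ} {Q : (Fin n → ℕ) → Prop}
    (ha : matrixOf n (s.arr 1) = a) {B : Finset (Fin n)} (hB : bagAt n (s.arr 3) (s.reg 3) = B)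
    {c : Fin n → ℕ} (hc : cutAt n (s.arr 4) (s.reg 2) = c)
    (hE : Represents a B Q (fun i => cutAt n (s.arr 4) (s.reg 8 + i * n)) m)
    (htop : s.reg 2 = s.reg 8 + m * n) :
    Does insertProg s (2000 * (S + 1) * (n + 1) ^ 2) fun s' => ∃ m',
      Represents a B (fun d => Q d ∨ d = c) (fun i => cutAt n (s'.arr 4) (s.reg 8 + i * n)) m' ∧
      s'.reg 2 = s.reg 8 + m' * n ∧ ∀ k < s.reg 8, s'.arr 4 k = s.arr 4 k := by
  have hsq : 1 ≤ (n + 1) ^ 2 := Nat.one_le_pow _ _ (by omega)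
  have hT : 300 * (n + 1) ^ 2 + (1000 * (S + 1) * (n + 1) ^ 2) + 20 ≤
      2000 * (S + 1) * (n + 1) ^ 2 := by nlinarith
  refine Does.seq (stableProg_spec hn) fun s₁ f₁ h₁ => ?_
  rw [ha, hB, hc] at h₁
  have e4 : s₁.arr 4 = s.arr 4 := f₁.arr 4 rfl
  refine Does.ite (fun hx => ?_) fun hx => Does.skip ?_
  · have hst := h₁.1 hx
    refine Does.seq (scanProg_spec (a := a) (B := B) (c := c) (S := S) (m := m)
      (E := fun i => cutAt n (s.arr 4) (s.reg 8 + i * n)) (by rw [f₁.reg 0 rfl, hn]) hn0 hmS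
      (by rw [f₁.arr 1 rfl, ha]) (by rw [f₁.arr 3 rfl, f₁.reg 3 rfl, hB])
      (by rw [e4, f₁.reg 2 rfl, hc]) (by rw [e4, f₁.reg 8 rfl]; simp)
      (by rw [f₁.reg 2 rfl, f₁.reg 8 rfl, htop])) fun s₂ f₂ ⟨h2, h3, h4⟩ => ?_
    rw [f₁.reg 8 rfl] at h2 h3
    rw [f₁.reg 2 rfl, e4] at h3
    have k2 : s₂.reg 2 = s.reg 2 := by rw [f₂.reg 2 rfl, f₁.reg 2 rfl]
    have k0 : s₂.reg 0 = n := by rw [f₂.reg 0 rfl, f₁.reg 0 rfl, hn]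
    refine Does.ite (fun hy => Does.skip ?_) fun hy => Does.set ?_
    · exact ⟨m, hE.insert_found hst (h4.1 hy) h2, by rw [k2, htop], fun k hk => h3 k (.inl hk)⟩
    · have hne : ∀ i < m, ¬ SameOn a B (cutAt n (s.arr 4) (s.reg 8 + i * n)) c :=
        fun i hi h => h4.2 ⟨i, hi, h⟩ hy
      refine ⟨m + 1, hE.insert_new hst hne (fun i hi => ?_) ?_, ?_, fun k hk => h3 k (.inl hk)⟩
      · have := h2 i hi
        rwa [if_neg (fun h => hne i hi h.1)] at this
      · rw [← hc, ← htop]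
        exact cutAt_congr fun v hv => h3 _ (by omega)
      · simp [k2, k0, htop]
        ring
  · exact ⟨m, hE.congr (fun _ => Iff.rfl) (fun i _ => by rw [e4]) |>.insert_unstable
      (fun h => h₁.2 h hx), by rw [f₁.reg 2 rfl, htop], fun k _ => by rw [e4]⟩

/-- Writes the maximum of the partial cuts whose addresses are in registers `27` and `28` to the
top of the heap. Register `29` becomes nonzero if and only if they are compatible. -/
def mergeProg : RamProgram :=
  .seq (.set 29 (.const 1)) <|
    forTo 40 0 <|
      .seq (.ite (sumThree (.get 4 (.add (.reg 27) (.reg 40))) (.get 4 (.add (.reg 28) (.reg 40))))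
        (.set 29 (.const 0)) .skip) <|
      .put 4 (.add (.reg 2) (.reg 40)) (.add (.get 4 (.add (.reg 27) (.reg 40)))
        (.sub (.get 4 (.add (.reg 28) (.reg 40))) (.get 4 (.add (.reg 27) (.reg 40)))))

theorem mergeProg_spec {n : ℕ} {s : RamState} (hn : s.reg 0 = n)
    {c d : Fin n → ℕ} (hc : cutAt n (s.arr 4) (s.reg 27) = c)
    (hd : cutAt n (s.arr 4) (s.reg 28) = d)
    (hle : s.reg 27 + n ≤ s.reg 2) (hle' : s.reg 28 + n ≤ s.reg 2) :
    Does mergeProg s (100 * (n + 1)) fun s' =>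
      cutAt n (s'.arr 4) (s.reg 2) = (fun v => max (c v) (d v)) ∧
      (∀ k < s.reg 2, s'.arr 4 k = s.arr 4 k) ∧ (s'.reg 29 ≠ 0 ↔ ∀ v, c v + d v ≠ 3) := by
  refine Does.set_seq (Does.forTo (m := n) (fun k s' =>
      (∀ v < k, s'.arr 4 (s.reg 2 + v) =
        max (s.arr 4 (s.reg 27 + v)) (s.arr 4 (s.reg 28 + v))) ∧
      (∀ k < s.reg 2, s'.arr 4 k = s.arr 4 k) ∧
      (s'.reg 29 ≠ 0 ↔ ∀ v < k, s.arr 4 (s.reg 27 + v) + s.arr 4 (s.reg 28 + v) ≠ 3))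
    70 (by simp [hn]) (by simp; omega) (by simp) ?_ ?_)
  · rintro k hk s' hs hi ⟨hI1, hI2, hI3⟩
    have e2 : s'.reg 2 = s.reg 2 := by rw [hs.reg 2 rfl]; simp
    have e27 : s'.reg 27 = s.reg 27 := by rw [hs.reg 27 rfl]; simp
    have e28 : s'.reg 28 = s.reg 28 := by rw [hs.reg 28 rfl]; simp
    have g27 := hI2 (s.reg 27 + k) (by omega)
    have g28 := hI2 (s.reg 28 + k) (by omega)
    refine Does.seq (T' := 30) (R := fun s₁ => (s₁.reg 29 ≠ 0 ↔
      ∀ v < k + 1, s.arr 4 (s.reg 27 + v) + s.arr 4 (s.reg 28 + v) ≠ 3)) ?_ ?_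
    · have split : (∀ v < k + 1, s.arr 4 (s.reg 27 + v) + s.arr 4 (s.reg 28 + v) ≠ 3) ↔
          (∀ v < k, s.arr 4 (s.reg 27 + v) + s.arr 4 (s.reg 28 + v) ≠ 3) ∧
            s.arr 4 (s.reg 27 + k) + s.arr 4 (s.reg 28 + k) ≠ 3 := by
        simp only [Nat.lt_succ_iff_lt_or_eq, or_imp, forall_and, forall_eq]
      rw [split]
      refine Does.ite (fun hx => Does.set ?_) fun hx => Does.skip ?_
      · rw [sumThree_eval] at hx
        simp only [RamExpr.eval, e27, e28, hi, g27, g28] at hx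
        simp [hx]
      · rw [sumThree_eval_eq_zero] at hx
        simp only [RamExpr.eval, e27, e28, hi, g27, g28] at hx
        simp only [hI3, hx, ne_eq, not_false_eq_true, and_true]
    · intro s₁ f₁ h₁
      have e4 : s₁.arr 4 = s'.arr 4 := f₁.arr 4 rfl
      refine Does.put ?_
      simp only [RamState.arr_setReg, RamState.arr_setArr, if_true, RamExpr.eval, e4,
        f₁.reg 2 rfl, f₁.reg 27 rfl, f₁.reg 28 rfl, f₁.reg 40 rfl, e2, e27, e28, hi, g27, g28,
        Function.update_apply]
      refine ⟨fun v hv => ?_, fun i hik => ?_, ?_⟩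
      · by_cases hvk : v = k
        · subst hvk
          rw [if_pos rfl]
          omega
        · rw [if_neg (by omega)]
          exact hI1 v (by omega)
      · rw [if_neg (by omega)]
        exact hI2 i hik
      · simpa using h₁
  · rintro s' - ⟨h1, h2, h3⟩
    refine ⟨?_, h2, h3.trans ?_⟩
    · rw [← hc, ← hd]
      exact funext fun v => h1 v v.2
    · rw [← hc, ← hd]
      exact ⟨fun h v => h v v.2, fun h v hv => h ⟨v, hv⟩⟩

/-- The heap `H` holds a table for the set `U` of assigned vertices between the addresses `b` and
`e`, with signatures on `B`. -/
def HoldsTable (n : ℕ) (a : Fin n → Fin n → ℕ) (B U : Finset (Fin n)) (H : ℕ → ℕ) (b e : ℕ) :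
    Prop :=
  ∃ m, e = b + m * n ∧ Represents a B (IsCutOf U) (fun i => cutAt n H (b + i * n)) m

theorem HoldsTable.congr {n : ℕ} {a : Fin n → Fin n → ℕ} {B U : Finset (Fin n)} {H H' : ℕ → ℕ}
    {b e : ℕ} (h : HoldsTable n a B U H b e) (hH : ∀ k < e, H' k = H k) :
    HoldsTable n a B U H' b e := by
  obtain ⟨m, rfl, h⟩ := h
  refine ⟨m, rfl, h.congr (fun _ => Iff.rfl) fun i hi => cutAt_congr fun v hv => hH _ ?_⟩
  have := block_le (n := n) hi
  omega

/-- Tables with signatures on `B` have length at most `S`. -/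
def TableBound {n : ℕ} (a : Fin n → Fin n → ℕ) (S : ℕ) (B : Finset (Fin n)) : Prop :=
  ∀ (Q : (Fin n → ℕ) → Prop) (E : ℕ → Fin n → ℕ) (m : ℕ), (∀ c, Q c → ∀ v, c v ≤ 2) →
    Represents a B Q E m → m ≤ S

/-- Joins the table from register `4` to register `5` with the table from register `6` to
register `7`. The resulting table goes from register `8` to the top of the heap. -/
def joinProg : RamProgram :=
  .seq (.set 8 (.reg 2)) <| forStep 27 (.reg 4) 5 (.reg 0) <| forStep 28 (.reg 6) 7 (.reg 0) <|
    .seq mergeProg <| .ite (.reg 29) insertProg .skip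

/-- Up to `S ^ 2` pairs are merged, and each result is searched for in a table of at most `S`
entries with quadratic work per entry. The new table grows from the old top of the heap, so both
operands stay intact. -/
theorem joinProg_spec {n S : ℕ} {s : RamState} (hn : s.reg 0 = n) (hn0 : 0 < n)
    {a : Fin n → Fin n → ℕ} (ha : matrixOf n (s.arr 1) = a)
    (hsymm : ∀ u v, a u v = a v u)
    {B B₁ B₂ U₁ U₂ : Finset (Fin n)} (hB : bagAt n (s.arr 3) (s.reg 3) = B)
    (h₁ : HoldsTable n a B₁ U₁ (s.arr 4) (s.reg 4) (s.reg 5))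
    (h₂ : HoldsTable n a B₂ U₂ (s.arr 4) (s.reg 6) (s.reg 7))
    (hle₁ : s.reg 5 ≤ s.reg 2) (hle₂ : s.reg 7 ≤ s.reg 2)
    (hS : TableBound a S B) (hS₁ : TableBound a S B₁) (hS₂ : TableBound a S B₂)
    (hU : ∀ v, v ∈ U₁ → v ∈ U₂ → v ∈ B₁ ∧ v ∈ B₂)
    (hB₁ : ∀ v ∈ B, v ∈ U₁ → v ∈ B₁) (hB₂ : ∀ v ∈ B, v ∈ U₂ → v ∈ B₂)
    (hE₁ : ∀ v ∈ U₁, v ∉ B₁ → ∀ u ∉ U₁, a v u = 0)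
    (hE₂ : ∀ v ∈ U₂, v ∉ B₂ → ∀ u ∉ U₂, a v u = 0) :
    Does joinProg s (10000 * (S + 1) ^ 3 * (n + 1) ^ 2) fun s' =>
      s'.reg 8 = s.reg 2 ∧ s.reg 2 ≤ s'.reg 2 ∧ (∀ k < s.reg 2, s'.arr 4 k = s.arr 4 k) ∧
      HoldsTable n a B (U₁ ∪ U₂) (s'.arr 4) (s.reg 2) (s'.reg 2) := by
  obtain ⟨m₁, he₁, r₁⟩ := h₁
  obtain ⟨m₂, he₂, r₂⟩ := h₂
  have hm₁ : m₁ ≤ S := hS₁ _ _ _ (fun c hc v => (hc v).1) r₁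
  have hm₂ : m₂ ≤ S := hS₂ _ _ _ (fun c hc v => (hc v).1) r₂
  let E₁ : ℕ → Fin n → ℕ := fun i => cutAt n (s.arr 4) (s.reg 4 + i * n)
  let E₂ : ℕ → Fin n → ℕ := fun i => cutAt n (s.arr 4) (s.reg 6 + i * n)
  let J : ℕ → ℕ → (Fin n → ℕ) → Prop := fun i j c =>
    (∀ v, E₁ i v + E₂ j v ≠ 3) ∧ c = fun v => max (E₁ i v) (E₂ j v)
  have hJ2 : ∀ i < m₁, ∀ j < m₂, ∀ c, J i j c → ∀ v, c v ≤ 2 := by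
    rintro i hi j hj c ⟨-, rfl⟩ v
    exact max_le ((r₁.sound i hi).1 v).1 ((r₂.sound j hj).1 v).1
  -- The joins of the pairs treated before the pair `(k, l)`: all full rows before `k` and the first
  -- `l` columns of row `k`.
  let K : ℕ → ℕ → (Fin n → ℕ) → Prop := fun k l c =>
    (∃ i < k, ∃ j < m₂, J i j c) ∨ ∃ j < l, J k j c
  let Inv : ℕ → ℕ → RamState → Prop := fun k l s' => ∃ m,
    Represents a B (K k l) (fun i => cutAt n (s'.arr 4) (s.reg 2 + i * n)) m ∧
      s'.reg 2 = s.reg 2 + m * n ∧ ∀ i < s.reg 2, s'.arr 4 i = s.arr 4 i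
  have hsq : n + 1 ≤ (n + 1) ^ 2 := by nlinarith
  have T1 : 100 * (n + 1) + 2000 * (S + 1) * (n + 1) ^ 2 + 8 ≤
      2200 * (S + 1) * (n + 1) ^ 2 := by nlinarith
  have T2 : 6 + m₂ * (2200 * (S + 1) * (n + 1) ^ 2 + 8) ≤ 2300 * (S + 1) ^ 2 * (n + 1) ^ 2 := by
    have h1 := Nat.mul_le_mul_right (2200 * (S + 1) * (n + 1) ^ 2 + 8) hm₂
    have h2 : S * (2200 * (S + 1) * (n + 1) ^ 2 + 8) + 2200 * (S + 1) * (n + 1) ^ 2 + 8 * 1 =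
      2200 * (S + 1) ^ 2 * (n + 1) ^ 2 + 8 * (S + 1) := by ring
    have h3 : (S + 1) * 1 ≤ (S + 1) ^ 2 * (n + 1) ^ 2 :=
      Nat.mul_le_mul (by nlinarith) (by omega)
    nlinarith
  have T3 : 6 + m₁ * (2300 * (S + 1) ^ 2 * (n + 1) ^ 2 + 8) + 2 ≤
      10000 * (S + 1) ^ 3 * (n + 1) ^ 2 := by
    have h1 := Nat.mul_le_mul_right (2300 * (S + 1) ^ 2 * (n + 1) ^ 2 + 8) hm₁
    have h2 : S * (2300 * (S + 1) ^ 2 * (n + 1) ^ 2 + 8) + 2300 * (S + 1) ^ 2 * (n + 1) ^ 2 +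
      8 * 1 = 2300 * (S + 1) ^ 3 * (n + 1) ^ 2 + 8 * (S + 1) := by ring
    have h3 : (S + 1) * 1 ≤ (S + 1) ^ 3 * (n + 1) ^ 2 :=
      Nat.mul_le_mul (Nat.le_self_pow (by simp) _) (by omega)
    nlinarith
  refine Does.set_seq (Does.forBlocks (m := m₁) (d := n) (fun k s' => Inv k 0 s')
    (2300 * (S + 1) ^ 2 * (n + 1) ^ 2) hn0 (by simp [hn]) (by simp [he₁])
    (Nat.le_sub_of_add_le T3) ?_ ?_ ?_)
  · refine ⟨0, (represents_empty a B fun _ _ => 0).congr (fun c => ?_)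
      (fun i hi => absurd hi (by simp)), by simp, by simp⟩
    simp [K]
  · intro k hk s₁ hs₁ hi₁ hI₁
    have d0 : s₁.reg 0 = n := by rw [hs₁.reg 0 rfl]; simp [hn]
    have d6 : s₁.reg 6 = s.reg 6 := by rw [hs₁.reg 6 rfl]; simp
    have d7 : s₁.reg 7 = s.reg 7 := by rw [hs₁.reg 7 rfl]; simp
    have d27 : s₁.reg 27 = s.reg 4 + k * n := by simpa using hi₁
    refine Does.forBlocks (m := m₂) (d := n) (fun l s' => Inv k l s')
      (2200 * (S + 1) * (n + 1) ^ 2) hn0 d0 (by rw [d6, d7, he₂]) T2 (by simpa [Inv] using hI₁) ?_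
      ?_
    · rintro l hl s₂ hs₂ hi₂ ⟨m, hm1, hm2, hm3⟩
      -- The length bound is needed for the unfinished table, which is why `TableBound` ranges over
      -- all `Q`.
      have hmS : m ≤ S := by
        refine hS _ _ _ ?_ hm1
        rintro c (⟨i, hi, j, hj, h⟩ | ⟨j, hj, h⟩)
        · exact hJ2 i (by omega) j hj c h
        · exact hJ2 k hk j (by omega) c h
      have e0 : s₂.reg 0 = n := by rw [hs₂.reg 0 rfl, d0]
      have e27 : s₂.reg 27 = s.reg 4 + k * n := by rw [hs₂.reg 27 rfl, d27]
      have e28 : s₂.reg 28 = s.reg 6 + l * n := by rw [hi₂, d6]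
      have e8 : s₂.reg 8 = s.reg 2 := by rw [hs₂.reg 8 rfl, hs₁.reg 8 rfl]; simp
      have e3 : s₂.reg 3 = s.reg 3 := by rw [hs₂.reg 3 rfl, hs₁.reg 3 rfl]; simp
      have a1 : s₂.arr 1 = s.arr 1 := by rw [hs₂.arr 1 rfl, hs₁.arr 1 rfl]; simp
      have a3 : s₂.arr 3 = s.arr 3 := by rw [hs₂.arr 3 rfl, hs₁.arr 3 rfl]; simp
      have hk' := block_le (n := n) hk
      have hl' := block_le (n := n) hl
      have c1 : cutAt n (s₂.arr 4) (s₂.reg 27) = E₁ k := by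
        rw [e27]
        exact cutAt_congr fun v hv => hm3 _ (by omega)
      have c2 : cutAt n (s₂.arr 4) (s₂.reg 28) = E₂ l := by
        rw [e28]
        exact cutAt_congr fun v hv => hm3 _ (by omega)
      refine Does.seq (mergeProg_spec e0 c1 c2 (by omega) (by omega)) fun s₃ f₃ ⟨g1, g2, g3⟩ => ?_
      have hrep : Represents a B (K k l) (fun i => cutAt n (s₃.arr 4) (s.reg 2 + i * n)) m := by
        refine hm1.congr (fun _ => Iff.rfl) fun i hi => cutAt_congr fun v hv => g2 _ ?_
        have := block_le (n := n) hi
        omega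
      have hbelow : ∀ i < s.reg 2, s₃.arr 4 i = s.arr 4 i := fun i hi => by
        rw [g2 i (by omega), hm3 i hi]
      have hKsucc : ∀ c, K k (l + 1) c ↔ K k l c ∨ J k l c := by
        intro c
        simp only [K, Nat.lt_succ_iff_lt_or_eq, or_and_right, exists_or, exists_eq_left, or_assoc]
      have k2 : s₃.reg 2 = s₂.reg 2 := f₃.reg 2 rfl
      have k8 : s₃.reg 8 = s.reg 2 := by rw [f₃.reg 8 rfl, e8]
      refine Does.ite (fun hx => ?_) fun hx => Does.skip ?_
      · have hcomp := g3.1 hx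
        refine ((insertProg_spec (s := s₃) (m := m) (S := S) (a := a) (B := B) (Q := K k l)
          (by rw [f₃.reg 0 rfl, e0]) hn0 hmS (by rw [f₃.arr 1 rfl, a1, ha])
          (by rw [f₃.arr 3 rfl, f₃.reg 3 rfl, a3, e3, hB]) (c := fun v => max (E₁ k v) (E₂ l v))
          (by rw [k2, g1]) (by rw [k8]; exact hrep) (by rw [k2, k8, hm2])).mono ?_).conseq
          fun s₄ f₄ ⟨m', q1, q2, q3⟩ => ?_
        · simp only [RamExpr.cost]
          omega
        rw [k8] at q1 q2 q3
        refine ⟨m', ?_, by simpa using q2, fun i hi => ?_⟩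
        · refine q1.congr (fun c => ?_) (fun _ _ => rfl)
          rw [hKsucc]
          exact or_congr_right ⟨fun h => ⟨hcomp, h⟩, fun h => h.2⟩
        · rw [RamState.arr_setReg, q3 i hi, hbelow i hi]
      · have hcomp : ¬ ∀ v, E₁ k v + E₂ l v ≠ 3 := fun h => g3.2 h hx
        refine ⟨m, hrep.congr (fun c => ?_) (fun _ _ => rfl), by simp [k2, hm2], hbelow⟩
        rw [hKsucc]
        exact ⟨Or.inl, fun h => h.elim id fun h => absurd h.1 hcomp⟩
    · rintro s₂ hs₂ ⟨m, hm1, hm2, hm3⟩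
      refine ⟨m, hm1.congr (fun c => ?_) (fun _ _ => rfl), by simpa using hm2, hm3⟩
      constructor
      · rintro (⟨i, hi, h⟩ | h)
        · exact .inl ⟨i, by omega, h⟩
        · exact .inl ⟨k, by omega, h⟩
      · rintro (⟨i, hi, h⟩ | ⟨j, hj, -⟩)
        · rcases Nat.lt_succ_iff_lt_or_eq.1 hi with hi | rfl
          · exact .inl ⟨i, hi, h⟩
          · exact .inr h
        · omega
  · rintro s' hs' ⟨m, hm1, hm2, hm3⟩
    refine ⟨by rw [hs'.reg 8 rfl]; simp, by omega, hm3, m, hm2, ?_⟩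
    -- So far the table represents only the joins that were tried; the exchange argument extends
    -- this to all cuts of the union.
    refine Represents.join hsymm hU hB₁ hB₂ hE₁ hE₂ r₁ r₂ (hm1.congr (fun c => ?_) fun _ _ => rfl)
    simp [K, J, E₁, E₂, IsJoin]

end TableProcedures

/-! ### Tables of single bags -/

section NodeTables

/-- Appends to the heap the partial cut that maps the vertex in register `41` to the value of
register `42` and every other vertex to `0`. -/
def allocProg : RamProgram :=
  .seq (forTo 43 0 (.put 4 (.add (.reg 2) (.reg 43)) (.const 0))) <|
    .seq (.put 4 (.add (.reg 2) (.reg 41)) (.reg 42)) <| .set 2 (.add (.reg 2) (.reg 0))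

theorem allocProg_spec {n : ℕ} {s : RamState} (hn : s.reg 0 = n) (w : Fin n)
    (hw : s.reg 41 = w) :
    Does allocProg s (30 * (n + 1)) fun s' =>
      cutAt n (s'.arr 4) (s.reg 2) = Pi.single w (s.reg 42) ∧
      (∀ k < s.reg 2, s'.arr 4 k = s.arr 4 k) ∧ s'.reg 2 = s.reg 2 + n := by
  refine Does.seq (T' := 6 + n * (8 + 8)) (Does.forTo (m := n) (fun k s' =>
      (∀ v < k, s'.arr 4 (s.reg 2 + v) = 0) ∧ ∀ k < s.reg 2, s'.arr 4 k = s.arr 4 k) 8 hn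
      le_rfl (by simp) ?_ fun s' _ h => h) ?_
  · rintro k hk s' hs hi ⟨hI1, hI2⟩
    have e2 : s'.reg 2 = s.reg 2 := hs.reg 2 rfl
    refine Does.put ?_
    simp only [RamState.arr_setReg, RamState.arr_setArr, if_true, RamExpr.eval, e2, hi,
      Function.update_apply]
    refine ⟨fun v hv => ?_, fun i hi => ?_⟩
    · by_cases hvk : v = k
      · rw [if_pos (by omega)]
      · rw [if_neg (by omega)]
        exact hI1 v (by omega)
    · rw [if_neg (by omega)]
      exact hI2 i hi
  · rintro s₁ f₁ ⟨h1, h2⟩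
    have e2 : s₁.reg 2 = s.reg 2 := f₁.reg 2 rfl
    have e0 : s₁.reg 0 = n := by rw [f₁.reg 0 rfl, hn]
    have e41 : s₁.reg 41 = w := by rw [f₁.reg 41 rfl, hw]
    have e42 : s₁.reg 42 = s.reg 42 := f₁.reg 42 rfl
    refine Does.put_seq (Does.set ?_)
    simp only [RamState.arr_setReg, RamState.arr_setArr, RamState.reg_setReg, RamState.reg_setArr,
      if_true, RamExpr.eval, e2, e0, e41, e42, and_true]
    refine ⟨funext fun v => ?_, fun k hk => ?_⟩
    · simp only [cutAt, Function.update_apply, Pi.single_apply, Fin.ext_iff]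
      by_cases hv : (v : ℕ) = w
      · rw [if_pos (by omega), if_pos hv]
      · rw [if_neg (by omega), if_neg hv, h1 v v.2]
    · rw [Function.update_apply, if_neg (by omega)]
      exact h2 k hk

/-- Appends the table of the empty set of vertices to the heap. -/
def emptyTableProg : RamProgram :=
  .seq (.set 41 (.const 0)) <| .seq (.set 42 (.const 0)) allocProg

/-- Writing the value `0` at vertex `0` makes the allocated block the zero cut, the only partial cut
with nothing assigned. -/
theorem emptyTableProg_spec {n : ℕ} {s : RamState} (hn : s.reg 0 = n) (hn0 : 0 < n)
    (a : Fin n → Fin n → ℕ) (B : Finset (Fin n)) :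
    Does emptyTableProg s (40 * (n + 1)) fun s' =>
      (∀ k < s.reg 2, s'.arr 4 k = s.arr 4 k) ∧ s.reg 2 ≤ s'.reg 2 ∧
      HoldsTable n a B ∅ (s'.arr 4) (s.reg 2) (s'.reg 2) := by
  refine Does.set_seq (Does.set_seq (((allocProg_spec (n := n) (by simpa using hn) ⟨0, hn0⟩
    (by simp)).mono (by simp; omega)).conseq fun s' _ ⟨h1, h2, h3⟩ => ?_))
  norm_num at h1 h2 h3
  refine ⟨h2, by omega, 1, by omega, represents_zero a B ?_⟩
  simpa using h1

/-- Appends the table of the vertex in register `32` to the heap, at the address that is stored in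
register `33`. -/
def singleTableProg : RamProgram :=
  .seq (.set 33 (.reg 2)) <| .seq (.set 41 (.reg 32)) <| .seq (.set 42 (.const 1)) <|
    .seq allocProg <| .seq (.set 42 (.const 2)) allocProg

theorem singleTableProg_spec {n : ℕ} {s : RamState} (hn : s.reg 0 = n) (w : Fin n)
    (hw : s.reg 32 = w) (a : Fin n → Fin n → ℕ) :
    Does singleTableProg s (100 * (n + 1)) fun s' =>
      (∀ k < s.reg 2, s'.arr 4 k = s.arr 4 k) ∧ s.reg 2 ≤ s'.reg 2 ∧ s'.reg 33 = s.reg 2 ∧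
      HoldsTable n a {w} {w} (s'.arr 4) (s.reg 2) (s'.reg 2) := by
  refine Does.set_seq (Does.set_seq (Does.set_seq (Does.seq (allocProg_spec (n := n)
    (by simpa using hn) w (by simpa using hw)) fun s₁ f₁ ⟨h1, h2, h3⟩ => ?_)))
  norm_num at h1 h2 h3
  refine Does.set_seq (((allocProg_spec (n := n) (by simp [f₁.reg 0 rfl, hn]) w
    (by simp [f₁.reg 41 rfl, hw])).mono (by simp; omega)).conseq fun s₂ f₂ ⟨k1, k2, k3⟩ => ?_)
  norm_num at k1 k2 k3
  rw [h3] at k1 k2 k3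
  refine ⟨fun k hk => ?_, by omega, ?_, 2, by omega, represents_single a w ?_ ?_⟩
  · rw [k2 k (by omega), h2 k hk]
  · rw [f₂.reg 33 rfl]
    simp [f₁.reg 33 rfl]
  · rw [← h1]
    simp only [zero_mul, add_zero]
    exact cutAt_congr fun v hv => k2 _ (by omega)
  · rw [← k1]
    simp

/-- The table of the node `t`, whose limits are in arrays `5` and `6`. -/
def NodeTable (n : ℕ) (a : Fin n → Fin n → ℕ) (s : RamState) (t : ℕ) (B U : Finset (Fin n)) :
    Prop :=
  HoldsTable n a B U (s.arr 4) (s.arr 5 t) (s.arr 6 t) ∧ s.arr 6 t ≤ s.reg 2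

/-- Completed tables lie below the top of the heap, and later programs write only above it. -/
theorem NodeTable.congr {n : ℕ} {a : Fin n → Fin n → ℕ} {s s' : RamState} {t : ℕ}
    {B U : Finset (Fin n)} (h : NodeTable n a s t B U) (h4 : ∀ k < s.reg 2, s'.arr 4 k = s.arr 4 k)
    (h2 : s.reg 2 ≤ s'.reg 2) (h5 : s'.arr 5 t = s.arr 5 t) (h6 : s'.arr 6 t = s.arr 6 t) :
    NodeTable n a s' t B U := by
  refine ⟨?_, by rw [h6]; exact h.2.trans h2⟩
  rw [h5, h6]
  exact h.1.congr fun k hk => h4 k (lt_of_lt_of_le hk h.2)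

/-- Adds the vertex in register `32` to the table of the node in register `30`. -/
def addVertexProg : RamProgram :=
  .seq singleTableProg <| .seq (.set 4 (.get 5 (.reg 30))) <| .seq (.set 5 (.get 6 (.reg 30))) <|
    .seq (.set 6 (.reg 33)) <| .seq (.set 7 (.reg 2)) <| .seq joinProg <|
    .seq (.put 5 (.reg 30) (.reg 8)) <| .put 6 (.reg 30) (.reg 2)

theorem succ_le_pow_mul (S n : ℕ) : n + 1 ≤ (S + 1) ^ 3 * (n + 1) ^ 2 := by
  calc n + 1 = 1 * (n + 1) ^ 1 := by ring
    _ ≤ (S + 1) ^ 3 * (n + 1) ^ 2 :=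
      Nat.mul_le_mul (Nat.one_le_pow _ _ (by omega)) (Nat.pow_le_pow_right (by omega) (by simp))

/-- A join in which nothing is forgotten: both parts lie inside their bags, so the separation
hypotheses are vacuous, and the edges from `w` to `W` enter when the crossing weights are
recomputed. -/
theorem addVertexProg_spec {n S : ℕ} {s : RamState} (hn : s.reg 0 = n) (hn0 : 0 < n)
    {a : Fin n → Fin n → ℕ} (ha : matrixOf n (s.arr 1) = a) (hsymm : ∀ u v, a u v = a v u)
    {t : ℕ} (ht : s.reg 30 = t) {w : Fin n} (hw : s.reg 32 = w) {B W : Finset (Fin n)}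
    (hB : bagAt n (s.arr 3) (s.reg 3) = B) (hS : TableBound a S B) (hS1 : TableBound a S {w})
    (hW : W ⊆ B) (hwW : w ∉ W) (h : NodeTable n a s t B W) :
    Does addVertexProg s (14000 * (S + 1) ^ 3 * (n + 1) ^ 2) fun s' =>
      (∀ k < s.reg 2, s'.arr 4 k = s.arr 4 k) ∧ s.reg 2 ≤ s'.reg 2 ∧
      (∀ i ≠ t, s'.arr 5 i = s.arr 5 i ∧ s'.arr 6 i = s.arr 6 i) ∧
      NodeTable n a s' t B (W ∪ {w}) := by
  refine Does.seq (singleTableProg_spec hn w hw a) fun s₃ f₃ ⟨g1, g2, g3, g4⟩ =>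
    Does.set_seq (Does.set_seq (Does.set_seq (Does.set_seq ?_)))
  have d30 : s₃.reg 30 = t := by rw [f₃.reg 30 rfl, ht]
  have d0 : s₃.reg 0 = n := by rw [f₃.reg 0 rfl, hn]
  have d3 : s₃.reg 3 = s.reg 3 := f₃.reg 3 rfl
  have b1 : s₃.arr 1 = s.arr 1 := f₃.arr 1 rfl
  have b3 : s₃.arr 3 = s.arr 3 := f₃.arr 3 rfl
  have b5 : s₃.arr 5 = s.arr 5 := f₃.arr 5 rfl
  have b6 : s₃.arr 6 = s.arr 6 := f₃.arr 6 rfl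
  have h' : NodeTable n a s₃ t B W := h.congr g1 g2 (by rw [b5]) (by rw [b6])
  refine Does.seq (joinProg_spec (n := n) (S := S) (a := a) (B := B) (B₁ := B)
    (B₂ := {w}) (U₁ := W) (U₂ := {w}) (by simpa using d0) hn0
    (by simp [b1, ha]) hsymm (by simp [b3, d3, hB]) ?_ ?_ ?_ ?_ hS hS hS1 ?_ ?_ ?_ ?_ ?_)
    fun s₄ f₄ ⟨k1, k2, k3, k4⟩ => Does.put_seq (Does.put ?_ ?_)
  · simpa [d30] using h'.1
  · simpa [g3] using g4
  · simpa [d30] using h'.2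
  · simp
  · intro v hv hv'
    rw [Finset.mem_singleton] at hv'
    exact absurd (hv' ▸ hv) hwW
  · exact fun v hv _ => hv
  · exact fun v _ hv => hv
  · exact fun v hv hv' => absurd (hW hv) hv'
  · exact fun v hv hv' => absurd hv hv'
  · simp only [RamState.arr_setReg, RamState.reg_setReg, RamExpr.eval, Nat.reduceEqDiff, if_false]
      at k1 k2 k3 k4
    have c30 : s₄.reg 30 = t := by rw [f₄.reg 30 rfl]; simp [d30]
    have c5 : s₄.arr 5 = s.arr 5 := by rw [f₄.arr 5 rfl]; simp [b5]
    have c6 : s₄.arr 6 = s.arr 6 := by rw [f₄.arr 6 rfl]; simp [b6]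
    simp only [RamState.arr_setArr, RamState.reg_setArr, RamExpr.eval, c30, NodeTable,
      Nat.reduceEqDiff, if_false, if_true, Function.update_self]
    refine ⟨fun i hi => ?_, by omega, fun i hi => ?_, by rwa [k1], le_rfl⟩
    · rw [k3 i (by omega), g1 i hi]
    · simp only [Function.update_of_ne hi, c5, c6, and_self]
  · have := succ_le_pow_mul S n
    simp only [mul_assoc, RamExpr.cost]
    omega

/-- Builds the table of the node in register `30` for its own bag. -/
def initNodeProg : RamProgram :=
  .seq (.set 11 (.reg 30)) <| .seq (mulProg 0) <| .seq (.set 3 (.reg 10)) <|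
  .seq (.put 5 (.reg 30) (.reg 2)) <| .seq emptyTableProg <| .seq (.put 6 (.reg 30) (.reg 2)) <|
  forTo 32 0 <| .ite (.get 3 (.add (.reg 3) (.reg 32))) addVertexProg .skip

theorem initNodeProg_spec {n N S : ℕ} {s : RamState} (hn : s.reg 0 = n) (hn0 : 0 < n)
    {a : Fin n → Fin n → ℕ} (ha : matrixOf n (s.arr 1) = a) (hsymm : ∀ u v, a u v = a v u)
    {t : ℕ} (ht : s.reg 30 = t) (htN : t < N) {B : Finset (Fin n)}
    (hB : bagAt n (s.arr 3) (t * n) = B) (hS : TableBound a S B)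
    (hS1 : ∀ v, TableBound a S {v}) :
    Does initNodeProg s (20000 * (S + 1) ^ 3 * (n + 1) ^ 3 + 12 * N) fun s' =>
      (∀ k < s.reg 2, s'.arr 4 k = s.arr 4 k) ∧ s.reg 2 ≤ s'.reg 2 ∧
      (∀ i ≠ t, s'.arr 5 i = s.arr 5 i ∧ s'.arr 6 i = s.arr 6 i) ∧
      NodeTable n a s' t B B := by
  refine Does.set_seq (Does.seq (mulProg_spec (b := N) (by simp [ht]; omega) (by simp) (by simp))
    fun s₁ f₁ h₁ => Does.set_seq (Does.put_seq ?_))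
  have q10 : s₁.reg 10 = t * n := by rw [h₁]; simp [ht, hn]
  have q30 : s₁.reg 30 = t := by rw [f₁.reg 30 rfl]; simp [ht]
  have q2 : s₁.reg 2 = s.reg 2 := by rw [f₁.reg 2 rfl]; simp
  have q0 : s₁.reg 0 = n := by rw [f₁.reg 0 rfl]; simp [hn]
  have qa : s₁.arr = s.arr := by
    funext i
    exact f₁.arr i rfl
  refine Does.seq (emptyTableProg_spec (n := n) (by simpa using q0) hn0 a B)
    fun s₂ f₂ ⟨h1, h2, h3⟩ => ?_
  simp only [RamState.reg_setArr, RamState.reg_setReg, RamExpr.eval, RamState.arr_setReg,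
    RamState.arr_setArr, qa] at h1 h2 h3
  norm_num at h1 h2 h3
  rw [q2] at h1 h2 h3
  have r₂ : ∀ r, emptyTableProg.modReg r = false → r ≠ 3 → s₂.reg r = s₁.reg r := by
    intro r hr hr'
    rw [f₂.reg r hr]
    simp [hr']
  have p3 : s₂.reg 3 = t * n := by rw [f₂.reg 3 rfl]; simp [q10]
  have p30 : s₂.reg 30 = t := by rw [r₂ 30 rfl (by simp), q30]
  have p0 : s₂.reg 0 = n := by rw [r₂ 0 rfl (by simp), q0]
  have pa : ∀ i, i ≠ 4 → i ≠ 5 → s₂.arr i = s.arr i := by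
    intro i hi hi'
    rw [f₂.arr i (by simp [emptyTableProg, allocProg, forTo, forStep, RamProgram.modArr, hi.symm])]
    simp [hi', qa]
  have p5 : s₂.arr 5 = Function.update (s.arr 5) t (s.reg 2) := by
    rw [f₂.arr 5 rfl]
    simp [qa, q30, q2]
  -- The signatures are on the whole bag from the start; a vertex not yet added just has side `0`
  -- and crossing weight `0`.
  refine Does.put_seq (Does.forTo (m := n) (fun k s' =>
      (∀ k < s.reg 2, s'.arr 4 k = s.arr 4 k) ∧ s.reg 2 ≤ s'.reg 2 ∧
      (∀ i ≠ t, s'.arr 5 i = s.arr 5 i ∧ s'.arr 6 i = s.arr 6 i) ∧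
      NodeTable n a s' t B {v ∈ B | v < k}) (15000 * (S + 1) ^ 3 * (n + 1) ^ 2)
      (by simpa using p0) ?_ ?_ ?_ ?_)
  · refine Nat.le_sub_of_add_le (Nat.le_sub_of_add_le (Nat.le_sub_of_add_le
      (Nat.le_sub_of_add_le (Nat.le_sub_of_add_le (Nat.le_sub_of_add_le ?_)))))
    have hsq := succ_le_pow_mul S n
    simp only [RamExpr.cost]
    have : (S + 1) ^ 3 * (n + 1) ^ 3 = (S + 1) ^ 3 * (n + 1) ^ 2 * (n + 1) := by ring
    set X := (S + 1) ^ 3 * (n + 1) ^ 2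
    calc _ ≤ 15000 * X * n + 200 * X + 12 * N := by nlinarith
      _ ≤ 20000 * (X * (n + 1)) + 12 * N := by nlinarith
      _ = _ := by rw [← this]; ring
  · simp only [RamState.arr_setReg, RamState.arr_setArr, RamState.reg_setReg, RamState.reg_setArr,
      RamExpr.eval, p30, NodeTable]
    norm_num
    refine ⟨h1, h2, fun i hi => ?_, ?_⟩
    · rw [p5, pa 6 (by simp) (by simp)]
      simp [hi]
    · rw [p5]
      simpa using h3
  · rintro k hk s' hs hi ⟨hI1, hI2, hI3, hI4⟩
    have e3 : s'.reg 3 = t * n := by rw [hs.reg 3 rfl]; simp [p3]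
    have e30 : s'.reg 30 = t := by rw [hs.reg 30 rfl]; simp [p30]
    have e0 : s'.reg 0 = n := by rw [hs.reg 0 rfl]; simp [p0]
    have a1 : s'.arr 1 = s.arr 1 := by rw [hs.arr 1 rfl]; simp [pa]
    have a3 : s'.arr 3 = s.arr 3 := by rw [hs.arr 3 rfl]; simp [pa]
    have hmem : (⟨k, hk⟩ : Fin n) ∈ B ↔ s.arr 3 (t * n + k) ≠ 0 := by simp [← hB, bagAt]
    have filter_succ : (⟨k, hk⟩ : Fin n) ∈ B →
        ({v ∈ B | v < k} : Finset (Fin n)) ∪ {⟨k, hk⟩} =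
          ({v ∈ B | v < k + 1} : Finset (Fin n)) := by
      intro hkB
      ext v
      simp only [Finset.mem_union, Finset.mem_filter, Finset.mem_singleton, Fin.ext_iff]
      constructor
      · rintro (⟨h, h'⟩ | h)
        · exact ⟨h, by omega⟩
        · obtain rfl : v = ⟨k, hk⟩ := Fin.ext h
          exact ⟨hkB, by simp⟩
      · rintro ⟨h, h'⟩
        rcases Nat.lt_succ_iff_lt_or_eq.1 h' with h' | h'
        · exact .inl ⟨h, h'⟩
        · exact .inr h'
    refine Does.ite (fun hx => ?_) fun hx => Does.skip ?_ ?_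
    · have hkB : (⟨k, hk⟩ : Fin n) ∈ B := hmem.2 (by simpa [a3, e3, hi] using hx)
      refine ((addVertexProg_spec (w := ⟨k, hk⟩) (S := S) e0 hn0 (by rw [a1, ha]) hsymm e30 hi
        (by rw [a3, e3, hB]) hS (hS1 _) (Finset.filter_subset _ _) (by simp) hI4).mono
        ?_).conseq fun s'' f'' ⟨g1, g2, g3, g4⟩ => ?_
      · have := succ_le_pow_mul S n
        simp only [mul_assoc, RamExpr.cost]
        omega
      · rw [filter_succ hkB] at g4
        refine ⟨fun i hi => ?_, ?_, fun i hi => ?_, ?_⟩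
        · rw [RamState.arr_setReg, g1 i (by omega), hI1 i hi]
        · simpa using hI2.trans g2
        · rw [RamState.arr_setReg, (g3 i hi).1, (g3 i hi).2]
          exact hI3 i hi
        · simpa [NodeTable] using g4
    · have hkB : (⟨k, hk⟩ : Fin n) ∉ B := fun h => hmem.1 h (by simpa [a3, e3, hi] using hx)
      have : ({v ∈ B | v < k + 1} : Finset (Fin n)) = ({v ∈ B | v < k} : Finset (Fin n)) := by
        refine Finset.filter_congr fun v hv => ?_
        have : (v : ℕ) ≠ k := by
          rintro rfl
          exact hkB hv
        omega
      rw [this]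
      exact ⟨hI1, by simpa using hI2, hI3, by simpa [NodeTable] using hI4⟩
    · have : 15000 * 1 * 1 ≤ 15000 * (S + 1) ^ 3 * (n + 1) ^ 2 :=
        Nat.mul_le_mul (Nat.mul_le_mul_left _ (Nat.one_le_pow _ _ (by omega)))
          (Nat.one_le_pow _ _ (by omega))
      simp only [RamExpr.cost]
      omega
  · rintro s' - ⟨g1, g2, g3, g4⟩
    have : ({v ∈ B | (v : ℕ) < n} : Finset (Fin n)) = B :=
      Finset.filter_true_of_mem fun v _ => v.2
    rw [this] at g4
    exact ⟨g1, g2, g3, g4⟩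

end NodeTables

/-! ### Finding leaves and contracting the tree -/

section Contract

/-- Register `44` becomes the number of remaining neighbours of the node in register `30`, register
`46` becomes one of them. The removed nodes have nonzero entries in array `7`. -/
def countProg : RamProgram :=
  .seq (.set 11 (.reg 30)) <| .seq (mulProg 1) <| .seq (.set 44 (.const 0)) <|
  forTo 45 1 <| .ite (.get 2 (.add (.reg 10) (.reg 45)))
    (.ite (.get 7 (.reg 45)) .skip <|
      .seq (.set 44 (.add (.reg 44) (.const 1))) (.set 46 (.reg 45)))
    .skip

theorem countProg_spec {N t : ℕ} {s : RamState} (hN : s.reg 1 = N) (ht : s.reg 30 = t)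
    (htN : t < N) :
    Does countProg s (100 * (N + 1)) fun s' =>
      let X := {p ∈ Finset.range N | s.arr 2 (t * N + p) ≠ 0 ∧ s.arr 7 p = 0}
      s'.reg 44 = X.card ∧ (X.Nonempty → s'.reg 46 ∈ X) := by
  refine Does.set_seq (Does.seq (mulProg_spec (b := N) (by simp [ht]; omega) (by simp) (by simp))
    fun s₁ f₁ h₁ => Does.set_seq ?_)
  have q10 : s₁.reg 10 = t * N := by rw [h₁]; simp [ht, hN]
  have q1 : s₁.reg 1 = N := by rw [f₁.reg 1 rfl]; simp [hN]
  have q2 : s₁.arr 2 = s.arr 2 := f₁.arr 2 rfl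
  have q7 : s₁.arr 7 = s.arr 7 := f₁.arr 7 rfl
  let X : ℕ → Finset ℕ := fun k =>
    {p ∈ Finset.range k | s.arr 2 (t * N + p) ≠ 0 ∧ s.arr 7 p = 0}
  refine Does.forTo (m := N) (fun k s' => s'.reg 44 = (X k).card ∧
      ((X k).Nonempty → s'.reg 46 ∈ X k)) 30 (by simp [q1]) (by simp; omega) (by simp [X]) ?_
    fun s' _ h => h
  rintro k hk s' hs hi ⟨hI1, hI2⟩
  have e10 : s'.reg 10 = t * N := by rw [hs.reg 10 rfl]; simp [q10]
  have e2 : s'.arr 2 = s.arr 2 := by rw [hs.arr 2 rfl]; simp [q2]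
  have e7 : s'.arr 7 = s.arr 7 := by rw [hs.arr 7 rfl]; simp [q7]
  have same : ¬ (s.arr 2 (t * N + k) ≠ 0 ∧ s.arr 7 k = 0) → X (k + 1) = X k := by
    intro h
    simp only [X, Finset.range_add_one, Finset.filter_insert, if_neg h]
  refine Does.ite (fun hx => Does.ite (fun hy => Does.skip ?_) fun hy =>
    Does.set_seq (Does.set ?_)) fun hx => Does.skip ?_
  · simp only [RamExpr.eval, e10, e2, e7, hi] at hx hy
    rw [same fun h => hy h.2]
    simpa using ⟨hI1, hI2⟩
  · simp only [RamExpr.eval, e10, e2, e7, hi] at hx hy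
    have : X (k + 1) = insert k (X k) := by
      simp only [X, Finset.range_add_one, Finset.filter_insert, if_pos (And.intro hx hy)]
    rw [this, Finset.card_insert_of_notMem (by simp [X])]
    simp [hI1, hi]
  · simp only [RamExpr.eval, e10, e2, hi] at hx
    rw [same fun h => h.1 hx]
    simpa using ⟨hI1, hI2⟩

/-- Finds a leaf of the remaining tree; registers `38` and `35` become the leaf and its
neighbour. -/
def leafProg : RamProgram :=
  forTo 30 1 <| .seq countProg <| .ite (.get 7 (.reg 30)) .skip <|
    .ite (.sub (.reg 44) (.const 1)) .skip <|
    .ite (.reg 44) (.seq (.set 38 (.reg 30)) (.set 35 (.reg 46))) .skip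

variable {n N : ℕ} {G : SimpleGraph (Fin n)} {D : TreeDecomposition G (Fin N)}

theorem leafProg_spec {s : RamState} (hN : s.reg 1 = N)
    (hT : ∀ t p : Fin N, s.arr 2 (t * N + p) ≠ 0 ↔ D.tree.Adj t p) {A : Finset (Fin N)}
    (hA : ∀ t : Fin N, s.arr 7 t = 0 ↔ t ∈ A) (hex : ∃ l p, IsLeafOf D A l p) :
    Does leafProg s (200 * (N + 1) ^ 2) fun s' =>
      ∃ l p, IsLeafOf D A l p ∧ s'.reg 38 = l ∧ s'.reg 35 = p := by
  obtain ⟨l₀, p₀, h₀⟩ := hex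
  -- The search may record several leaves, each replacing the previous one. Knowing one leaf `l₀`
  -- ensures that something valid is recorded once `l₀` has been passed.
  refine Does.forTo (m := N) (fun k s' => (l₀ : ℕ) < k →
      ∃ l p, IsLeafOf D A l p ∧ s'.reg 38 = l ∧ s'.reg 35 = p) (150 * (N + 1)) hN (by nlinarith)
    (by simp) ?_ fun s' _ h => h l₀.2
  intro k hk s' hs hi hI
  have e1 : s'.reg 1 = N := by rw [hs.reg 1 rfl, hN]
  have e2 : s'.arr 2 = s.arr 2 := hs.arr 2 rfl
  have e7 : s'.arr 7 = s.arr 7 := hs.arr 7 rfl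
  let t : Fin N := ⟨k, hk⟩
  refine Does.seq (countProg_spec e1 hi hk) fun s₁ f₁ ⟨h1, h2⟩ => ?_
  rw [e2, e7] at h1 h2
  set X := {p ∈ Finset.range N | s.arr 2 (k * N + p) ≠ 0 ∧ s.arr 7 p = 0} with hX
  have hXmem : ∀ p : Fin N, (p : ℕ) ∈ X ↔ D.tree.Adj t p ∧ p ∈ A := by
    intro p
    simp only [hX, Finset.mem_filter, Finset.mem_range, p.2, true_and]
    exact and_congr (hT t p) (hA p)
  have k30 : s₁.reg 30 = k := by rw [f₁.reg 30 rfl, hi]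
  have k7 : s₁.arr 7 = s.arr 7 := by rw [f₁.arr 7 rfl, e7]
  have keep : (∀ p, ¬ IsLeafOf D A t p) → s₁.reg 38 = s'.reg 38 → s₁.reg 35 = s'.reg 35 →
      ((l₀ : ℕ) < k + 1 →
        ∃ l p, IsLeafOf D A l p ∧ (s₁.setReg 30 (k + 1)).reg 38 = l ∧
          (s₁.setReg 30 (k + 1)).reg 35 = p) := by
    intro h h38 h35 hl
    have hne : (l₀ : ℕ) ≠ k := by
      intro e
      obtain rfl : l₀ = t := Fin.ext e
      exact h p₀ h₀
    obtain ⟨l, p, hlp, g1, g2⟩ := hI (by omega)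
    exact ⟨l, p, hlp, by simp [h38, g1], by simp [h35, g2]⟩
  have card_leaf : ∀ p, IsLeafOf D A t p → X.card = 1 := by
    intro p hp
    rw [Finset.card_eq_one]
    refine ⟨p, Finset.eq_singleton_iff_unique_mem.2
      ⟨(hXmem p).2 ⟨hp.adj, hp.mem_parent⟩, fun q hq => ?_⟩⟩
    have hqN : q < N := Finset.mem_range.1 (Finset.mem_filter.1 hq).1
    obtain ⟨h, h'⟩ := (hXmem ⟨q, hqN⟩).1 hq
    exact congrArg Fin.val (hp.unique _ h' h)
  refine Does.ite (fun hx => Does.skip ?_) fun hx => Does.ite (fun hy => Does.skip ?_) fun hy =>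
    Does.ite (fun hz => Does.set_seq (Does.set ?_)) fun hz => Does.skip ?_
  · simp only [RamExpr.eval, k30, k7] at hx
    exact keep (fun p hp => hx ((hA t).2 hp.mem_leaf)) (f₁.reg 38 rfl) (f₁.reg 35 rfl)
  · simp only [RamExpr.eval, h1] at hy
    exact keep (fun p hp => hy (by rw [card_leaf p hp])) (f₁.reg 38 rfl) (f₁.reg 35 rfl)
  · simp only [RamExpr.eval, h1, k30, k7] at hx hy hz
    have hcard : X.card = 1 := by omega
    have h46 := h2 (Finset.card_pos.1 (by omega))
    have h46N : s₁.reg 46 < N := Finset.mem_range.1 (Finset.mem_filter.1 h46).1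
    obtain ⟨hadj, hmem⟩ := (hXmem ⟨s₁.reg 46, h46N⟩).1 h46
    refine fun _ => ⟨t, ⟨s₁.reg 46, h46N⟩, ⟨(hA t).1 hx, hmem, hadj, fun q hq hq' => ?_⟩, ?_, ?_⟩
    · obtain ⟨x, hxX⟩ := Finset.card_eq_one.1 hcard
      have g1 : (q : ℕ) = x := by
        have := (hXmem q).2 ⟨hq', hq⟩
        rwa [hxX, Finset.mem_singleton] at this
      have g2 : s₁.reg 46 = x := by rwa [hxX, Finset.mem_singleton] at h46
      exact Fin.ext (g1.trans g2.symm)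
    · simp [k30, t]
    · simp
  · simp only [RamExpr.eval, h1] at hz
    exact keep (fun p hp => by simp [card_leaf p hp] at hz) (f₁.reg 38 rfl) (f₁.reg 35 rfl)

/-- Merges the node in register `38` into the node in register `35`. -/
def mergeNodesProg : RamProgram :=
  .seq (.set 11 (.reg 35)) <| .seq (mulProg 0) <| .seq (.set 3 (.reg 10)) <|
  .seq (.set 4 (.get 5 (.reg 35))) <| .seq (.set 5 (.get 6 (.reg 35))) <|
  .seq (.set 6 (.get 5 (.reg 38))) <| .seq (.set 7 (.get 6 (.reg 38))) <| .seq joinProg <|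
  .seq (.put 5 (.reg 35) (.reg 8)) <| .seq (.put 6 (.reg 35) (.reg 2)) <|
  .put 7 (.reg 38) (.const 1)

/-- The hypotheses of the join come from `IsContraction`: the two parts meet only in both bags, a
vertex of the bag of `p` lying in `U l` is in the bag of `l`, and `not_adj` excludes edges leaving a
part off its bag. -/
theorem mergeNodesProg_spec {S : ℕ} {s : RamState} (hn : s.reg 0 = n) (hn0 : 0 < n)
    {a : Fin n → Fin n → ℕ} (ha : matrixOf n (s.arr 1) = a) (hsymm : ∀ u v, a u v = a v u)
    (haG : ∀ u v, ¬ G.Adj u v → a u v = 0)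
    (hbag : ∀ t : Fin N, bagAt n (s.arr 3) (t * n) = D.bag t)
    (hS : ∀ t : Fin N, TableBound a S (D.bag t))
    {A : Finset (Fin N)} {U : Fin N → Finset (Fin n)} (h : IsContraction D A U)
    {l p : Fin N} (hlp : IsLeafOf D A l p) (hl : s.reg 38 = l) (hp : s.reg 35 = p)
    (htab : ∀ t ∈ A, NodeTable n a s t (D.bag t) (U t)) :
    Does mergeNodesProg s (11000 * (S + 1) ^ 3 * (n + 1) ^ 2 + 12 * N) fun s' =>
      s'.arr 7 = Function.update (s.arr 7) l 1 ∧
      ∀ t ∈ A.erase l, NodeTable n a s' t (D.bag t) (Function.update U p (U p ∪ U l) t) := by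
  have hpl : p ≠ l := hlp.adj.ne'
  have hpN := p.2
  refine Does.set_seq (Does.seq (mulProg_spec (b := N) (by simp [hp]) (by simp)
    (by simp)) fun s₁ f₁ h₁ => Does.set_seq (Does.set_seq (Does.set_seq (Does.set_seq
      (Does.set_seq ?_)))))
  have q10 : s₁.reg 10 = p * n := by rw [h₁]; simp [hp, hn]
  have q35 : s₁.reg 35 = p := by rw [f₁.reg 35 rfl]; simp [hp]
  have q38 : s₁.reg 38 = l := by rw [f₁.reg 38 rfl]; simp [hl]
  have q2 : s₁.reg 2 = s.reg 2 := by rw [f₁.reg 2 rfl]; simp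
  have q0 : s₁.reg 0 = n := by rw [f₁.reg 0 rfl]; simp [hn]
  have qa : s₁.arr = s.arr := by
    funext i
    exact f₁.arr i rfl
  have tp := htab p hlp.mem_parent
  have tl := htab l hlp.mem_leaf
  have out : ∀ t ∈ A, ∀ v ∈ U t, v ∉ D.bag t → ∀ u ∉ U t, a v u = 0 :=
    fun t ht v hv hvb u hu => haG _ _ (h.not_adj ht hv hvb hu)
  refine Does.seq (joinProg_spec (n := n) (S := S) (a := a) (B := D.bag p) (B₁ := D.bag p)
    (B₂ := D.bag l) (U₁ := U p) (U₂ := U l) (by simpa using q0) hn0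
    (by simp [qa, ha]) hsymm (by simp [qa, q10, hbag p]) ?_ ?_ ?_ ?_ (hS p) (hS p) (hS l)
    ?_ ?_ ?_ ?_ ?_) fun s₂ f₂ ⟨k1, k2, k3, k4⟩ => ?_
  · simpa [q35, qa] using tp.1
  · simpa [q38, qa] using tl.1
  · simpa [q35, qa, q2] using tp.2
  · simpa [q38, qa, q2] using tl.2
  · exact fun v hv hv' => h.separated p hlp.mem_parent l hlp.mem_leaf hpl v hv hv'
  · exact fun v hv _ => hv
  · exact fun v hv hv' => (h.separated p hlp.mem_parent l hlp.mem_leaf hpl v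
      (h.bag_subset p hlp.mem_parent hv) hv').2
  · exact out p hlp.mem_parent
  · exact out l hlp.mem_leaf
  · simp only [RamState.arr_setReg, RamState.reg_setReg, RamExpr.eval, Nat.reduceEqDiff, if_false,
      q2, qa] at k1 k2 k3 k4
    have c35 : s₂.reg 35 = p := by rw [f₂.reg 35 rfl]; simp [q35]
    have c38 : s₂.reg 38 = l := by rw [f₂.reg 38 rfl]; simp [q38]
    have c5 : s₂.arr 5 = s.arr 5 := by rw [f₂.arr 5 rfl]; simp [qa]
    have c6 : s₂.arr 6 = s.arr 6 := by rw [f₂.arr 6 rfl]; simp [qa]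
    have c7 : s₂.arr 7 = s.arr 7 := by rw [f₂.arr 7 rfl]; simp [qa]
    refine Does.put_seq (Does.put_seq (Does.put ?_ ?_))
    · simp only [RamState.arr_setArr, RamState.reg_setArr, RamExpr.eval, c35, c38, c7,
        Nat.reduceEqDiff, if_false, if_true, true_and]
      intro t ht
      have htA := Finset.mem_of_mem_erase ht
      by_cases htp : t = p
      · subst htp
        simp only [Function.update_self, NodeTable, RamState.arr_setArr, RamState.reg_setArr,
          Nat.reduceEqDiff, if_false, if_true]
        exact ⟨by rwa [k1], le_rfl⟩
      · have htp' : (t : ℕ) ≠ p := fun e => htp (Fin.ext e)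
        rw [Function.update_of_ne htp]
        refine (htab t htA).congr ?_ ?_ ?_ ?_
        · simpa using k3
        · simpa using k2
        · simp [htp', c5]
        · simp [htp', c6]
    · have := succ_le_pow_mul S n
      simp only [mul_assoc, RamExpr.cost]
      omega

/-- Merges all nodes into one, which is stored in register `35`. -/
def contractProg : RamProgram :=
  .seq (.set 35 (.const 0)) <| .seq (.set 37 (.sub (.reg 1) (.const 1))) <|
    forTo 36 37 (.seq leafProg mergeNodesProg)

theorem contractProg_spec {S : ℕ} {s : RamState} (hn : s.reg 0 = n) (hn0 : 0 < n)
    (hN : s.reg 1 = N)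
    {a : Fin n → Fin n → ℕ} (ha : matrixOf n (s.arr 1) = a) (hsymm : ∀ u v, a u v = a v u)
    (haG : ∀ u v, ¬ G.Adj u v → a u v = 0)
    (hT : ∀ t p : Fin N, s.arr 2 (t * N + p) ≠ 0 ↔ D.tree.Adj t p)
    (hbag : ∀ t : Fin N, bagAt n (s.arr 3) (t * n) = D.bag t)
    (hS : ∀ t : Fin N, TableBound a S (D.bag t)) (h7 : ∀ t : Fin N, s.arr 7 t = 0)
    (htab : ∀ t : Fin N, NodeTable n a s t (D.bag t) (D.bag t)) :
    Does contractProg s ((11000 * (S + 1) ^ 3 * (n + 1) ^ 2 + 300 * (N + 1) ^ 2) * (N + 1))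
      fun s' => ∃ r : Fin N, s'.reg 35 = r ∧ NodeTable n a s' r (D.bag r) Finset.univ := by
  have hNpos : 0 < N := by
    obtain ⟨t⟩ := D.isTree.connected.nonempty
    exact t.pos
  refine Does.set_seq (Does.set_seq (Does.forTo (m := N - 1) (fun k s' =>
    ∃ A U, IsContraction D A U ∧ A.card + k = N ∧ (∀ t : Fin N, s'.arr 7 t = 0 ↔ t ∈ A) ∧
      (∀ t ∈ A, NodeTable n a s' t (D.bag t) (U t)) ∧ ∃ r ∈ A, s'.reg 35 = r)
    (11000 * (S + 1) ^ 3 * (n + 1) ^ 2 + 250 * (N + 1) ^ 2) (by simp [hN]) ?_ ?_ ?_ ?_))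
  · refine Nat.le_sub_of_add_le (Nat.le_sub_of_add_le ?_)
    obtain ⟨M, rfl⟩ : ∃ M, N = M + 1 := ⟨N - 1, by omega⟩
    set X := 11000 * (S + 1) ^ 3 * (n + 1) ^ 2
    simp only [RamExpr.cost, Nat.add_sub_cancel]
    nlinarith
  -- Register `35` starts with node `0`, which is the survivor when `N = 1` and no merge takes
  -- place. Otherwise it holds the parent of the last merge, which is never the removed node.
  · refine ⟨Finset.univ, D.bag, isContraction_bag D, by simp, fun t => by simp [h7], fun t _ => ?_,
      ⟨0, hNpos⟩, by simp, by simp⟩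
    simpa [NodeTable] using htab t
  · rintro k hk s' hs hi ⟨A, U, hc, hcard, h7', htab', -⟩
    have e0 : s'.reg 0 = n := by rw [hs.reg 0 rfl]; simp [hn]
    have e1 : s'.reg 1 = N := by rw [hs.reg 1 rfl]; simp [hN]
    have a1 : s'.arr 1 = s.arr 1 := by rw [hs.arr 1 rfl]; simp
    have a2 : s'.arr 2 = s.arr 2 := by rw [hs.arr 2 rfl]; simp
    have a3 : s'.arr 3 = s.arr 3 := by rw [hs.arr 3 rfl]; simp
    refine Does.seq (leafProg_spec (D := D) (A := A) e1 (by rwa [a2]) h7'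
      (hc.exists_leaf (by omega))) fun s₁ f₁ ⟨l, p, hlp, h38, h35⟩ => ?_
    refine ((mergeNodesProg_spec (D := D) (S := S) (a := a) (A := A) (U := U)
      (by rw [f₁.reg 0 rfl, e0]) hn0 (by rw [f₁.arr 1 rfl, a1, ha]) hsymm haG
      (by rwa [f₁.arr 3 rfl, a3]) hS hc hlp h38 h35 fun t ht => ?_).mono ?_).conseq
      fun s₂ f₂ ⟨g1, g2⟩ => ?_
    · refine (htab' t ht).congr ?_ ?_ ?_ ?_
      · intro i _; rw [f₁.arr 4 rfl]
      · rw [f₁.reg 2 rfl]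
      · rw [f₁.arr 5 rfl]
      · rw [f₁.arr 6 rfl]
    · refine Nat.le_sub_of_add_le ?_
      nlinarith
    · refine ⟨A.erase l, _, hc.merge hlp, ?_, fun t => ?_, fun t ht => ?_, p,
        Finset.mem_erase.2 ⟨hlp.adj.ne', hlp.mem_parent⟩, ?_⟩
      · have := Finset.card_erase_add_one hlp.mem_leaf
        omega
      · rw [RamState.arr_setReg, g1, f₁.arr 7 rfl, Function.update_apply, Finset.mem_erase, ← h7' t]
        by_cases htl : t = l
        · simp [htl]
        · rw [if_neg fun e => htl (Fin.ext e)]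
          simp [htl]
      · simpa [NodeTable] using g2 t ht
      · simp [f₂.reg 35 rfl, h35]
  · rintro s' - ⟨A, U, hc, hcard, -, htab', r, hr, hr35⟩
    obtain ⟨x, hx⟩ := Finset.card_eq_one.1 (show A.card = 1 by omega)
    obtain rfl : r = x := by simpa [hx] using hr
    have := htab' r hr
    rw [hc.eq_univ hx] at this
    exact ⟨r, hr35, this⟩

end Contract

/-! ### The two branches, the main program and its time bound -/

section MainProgram

/-- Register `47` becomes nonzero if and only if some weighted degree is at least two. -/
def checkProg : RamProgram :=
  .seq (.set 47 (.const 0)) <| forTo 13 0 <| .seq degreeProg <|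
    .ite (.sub (.reg 14) (.const 1)) (.set 47 (.const 1)) .skip

theorem checkProg_spec {n : ℕ} {s : RamState} (hn : s.reg 0 = n) :
    Does checkProg s (100 * (n + 1) ^ 2) fun s' =>
      (s'.reg 47 ≠ 0 ↔ ∃ v, 1 < ∑ u, matrixOf n (s.arr 1) v u) := by
  refine Does.set_seq (Does.forTo (m := n) (fun k s' => s'.reg 47 ≠ 0 ↔
    ∃ v : Fin n, (v : ℕ) < k ∧ 1 < ∑ u, matrixOf n (s.arr 1) v u) (60 * (n + 1))
    (by simpa using hn) (Nat.le_sub_of_add_le (by simp; nlinarith)) (by simp) ?_ ?_)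
  · intro k hk s' hs hi hI
    have e0 : s'.reg 0 = n := by rw [hs.reg 0 rfl]; simp [hn]
    have a1 : s'.arr 1 = s.arr 1 := by rw [hs.arr 1 rfl]; simp
    have split : (∃ v : Fin n, (v : ℕ) < k + 1 ∧ 1 < ∑ u, matrixOf n (s.arr 1) v u) ↔
        (∃ v : Fin n, (v : ℕ) < k ∧ 1 < ∑ u, matrixOf n (s.arr 1) v u) ∨
          1 < ∑ u, matrixOf n (s.arr 1) ⟨k, hk⟩ u := by
      constructor
      · rintro ⟨v, hv, h⟩
        rcases Nat.lt_succ_iff_lt_or_eq.1 hv with hv | hv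
        · exact .inl ⟨v, hv, h⟩
        · obtain rfl : v = ⟨k, hk⟩ := Fin.ext hv
          exact .inr h
      · rintro (⟨v, hv, h⟩ | h)
        · exact ⟨v, by omega, h⟩
        · exact ⟨⟨k, hk⟩, by simp, h⟩
    refine Does.seq (degreeProg_spec e0 ⟨k, hk⟩ hi) fun s₁ f₁ h₁ => ?_
    rw [a1] at h₁
    refine Does.ite (fun hx => Does.set ?_) fun hx => Does.skip ?_
    · simp only [RamExpr.eval, h₁] at hx
      rw [split]
      simp only [RamState.reg_setReg, RamExpr.eval]
      norm_num
      right
      omega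
    · simp only [RamExpr.eval, h₁] at hx
      rw [split, ← hI]
      have : ¬ 1 < ∑ u, matrixOf n (s.arr 1) ⟨k, hk⟩ u := by omega
      simp [this, f₁.reg 47 rfl]
  · rintro s' - h
    rw [h]
    exact ⟨fun ⟨v, _, h⟩ => ⟨v, h⟩, fun ⟨v, h⟩ => ⟨v, v.2, h⟩⟩

/-- Puts a vertex on side `1` if and only if it has a smaller neighbour. -/
def matchingProg : RamProgram :=
  forTo 32 0 <| .seq (.set 11 (.reg 32)) <| .seq (mulProg 0) <|
    .seq (.put 0 (.reg 32) (.const 0)) <| forTo 15 32 <|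
      .ite (.get 1 (.add (.reg 10) (.reg 15))) (.put 0 (.reg 32) (.const 1)) .skip

theorem matchingProg_spec {n : ℕ} {s : RamState} (hn : s.reg 0 = n) :
    Does matchingProg s (100 * (n + 1) ^ 2) fun s' => ∃ c : Fin n → Bool, Outputs s' c ∧
      ∀ v, c v = true ↔ ∃ u < v, matrixOf n (s.arr 1) v u ≠ 0 := by
  let P : ℕ → ℕ → Prop := fun v k => ∃ u < k, s.arr 1 (v * n + u) ≠ 0
  refine Does.forTo (m := n) (fun k s' => ∀ v < k, s'.arr 0 v ≤ 1 ∧ (s'.arr 0 v = 1 ↔ P v v))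
    (70 * (n + 1)) hn (by nlinarith) (by simp) ?_ ?_
  · intro k hk s' hs hi hI
    have e0 : s'.reg 0 = n := by rw [hs.reg 0 rfl, hn]
    have a1 : s'.arr 1 = s.arr 1 := hs.arr 1 rfl
    refine Does.set_seq (Does.seq (mulProg_spec (b := n) (by simp [hi]; omega) (by simp)
      (by simp)) fun s₁ f₁ h₁ => ?_)
    have q10 : s₁.reg 10 = k * n := by rw [h₁]; simp [hi, e0]
    have q32 : s₁.reg 32 = k := by rw [f₁.reg 32 rfl]; simp [hi]
    have qa1 : s₁.arr 1 = s.arr 1 := by rw [f₁.arr 1 rfl]; simp [a1]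
    have qa0 : s₁.arr 0 = s'.arr 0 := by rw [f₁.arr 0 rfl]; simp
    refine Does.put_seq (Does.forTo (m := k) (fun l s' =>
      (∀ v < k, s'.arr 0 v ≤ 1 ∧ (s'.arr 0 v = 1 ↔ P v v)) ∧
        s'.arr 0 k ≤ 1 ∧ (s'.arr 0 k = 1 ↔ P k l)) 20 (by simp [q32]) (by simp; omega) ?_ ?_ ?_)
    · refine ⟨fun v hv => ?_, ?_⟩
      · simpa [q32, qa0, Function.update_apply, hv.ne] using hI v hv
      · simp [q32, P]
    · rintro l hl s₂ hs₂ hi₂ ⟨hJ1, hJ2, hJ3⟩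
      have d10 : s₂.reg 10 = k * n := by rw [hs₂.reg 10 rfl]; simp [q10]
      have d32 : s₂.reg 32 = k := by rw [hs₂.reg 32 rfl]; simp [q32]
      have da1 : s₂.arr 1 = s.arr 1 := by rw [hs₂.arr 1 rfl]; simp [qa1]
      have split : P k (l + 1) ↔ P k l ∨ s.arr 1 (k * n + l) ≠ 0 := by
        constructor
        · rintro ⟨u, hu, h⟩
          rcases Nat.lt_succ_iff_lt_or_eq.1 hu with hu | rfl
          · exact .inl ⟨u, hu, h⟩
          · exact .inr h
        · rintro (⟨u, hu, h⟩ | h)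
          · exact ⟨u, by omega, h⟩
          · exact ⟨l, by omega, h⟩
      refine Does.ite (fun hx => Does.put ?_) fun hx => Does.skip ?_
      · simp only [RamExpr.eval, d10, da1, hi₂] at hx
        refine ⟨fun v hv => ?_, ?_⟩
        · simpa [d32, Function.update_apply, hv.ne] using hJ1 v hv
        · rw [split]
          simp [d32, hx]
      · simp only [RamExpr.eval, d10, da1, hi₂] at hx
        rw [split]
        refine ⟨hJ1, hJ2, ?_⟩
        simpa [hx] using hJ3
    · rintro s₂ hs₂ ⟨hJ1, hJ2, hJ3⟩ v hv
      rcases Nat.lt_succ_iff_lt_or_eq.1 hv with hv | rfl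
      · exact hJ1 v hv
      · exact ⟨hJ2, hJ3⟩
  · intro s' hs h
    refine ⟨fun v => decide (s'.arr 0 v = 1), fun v => ?_, fun v => ?_⟩
    · have := (h v v.2).1
      rcases (by omega : s'.arr 0 v = 0 ∨ s'.arr 0 v = 1) with e | e <;> simp [e]
    · rw [decide_eq_true_iff, (h v v.2).2]
      exact ⟨fun ⟨u, hu, h⟩ => ⟨⟨u, by omega⟩, hu, h⟩, fun ⟨u, hu, h⟩ => ⟨u, hu, h⟩⟩

/-- Writes the first partial cut of the final table to array `0`. -/
def outputProg : RamProgram :=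
  forTo 13 0 <| .put 0 (.reg 13) (.sub (.get 4 (.add (.reg 8) (.reg 13))) (.const 1))

theorem outputProg_spec {n : ℕ} {s : RamState} (hn : s.reg 0 = n) :
    Does outputProg s (20 * (n + 1)) fun s' =>
      ∀ v < n, s'.arr 0 v = s.arr 4 (s.reg 8 + v) - 1 := by
  refine Does.forTo (m := n) (fun k s' => ∀ v < k, s'.arr 0 v = s.arr 4 (s.reg 8 + v) - 1) 10
    hn (by omega) (by simp) ?_ fun s' _ h => h
  intro k hk s' hs hi hI
  have e8 : s'.reg 8 = s.reg 8 := hs.reg 8 rfl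
  have a4 : s'.arr 4 = s.arr 4 := hs.arr 4 rfl
  refine Does.put ?_
  intro v hv
  rcases Nat.lt_succ_iff_lt_or_eq.1 hv with hv | rfl
  · simpa [hi, Function.update_apply, hv.ne] using hI v hv
  · simp [hi, e8, a4]

/-- Forgets the bag of the only remaining node, whose number is in register `35`. -/
def forgetProg : RamProgram :=
  .seq (.set 33 (.reg 2)) <| .seq emptyTableProg <| .seq (.set 4 (.get 5 (.reg 35))) <|
  .seq (.set 5 (.get 6 (.reg 35))) <| .seq (.set 6 (.reg 33)) <| .seq (.set 7 (.reg 2)) <|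
  .seq (.set 11 (.reg 1)) <| .seq (mulProg 0) <| .seq (.set 3 (.reg 10)) joinProg

/-- Joining with the table of the empty set changes no partial cut, but with signatures on `∅` only
cuts stable at every vertex are kept, and only a lightest one. -/
theorem forgetProg_spec {n N S : ℕ} {s : RamState} (hn : s.reg 0 = n) (hn0 : 0 < n)
    (hN : s.reg 1 = N) {a : Fin n → Fin n → ℕ} (ha : matrixOf n (s.arr 1) = a)
    (hsymm : ∀ u v, a u v = a v u) {B : Finset (Fin n)}
    (hbag : bagAt n (s.arr 3) (N * n) = ∅) (hS : TableBound a S B) (hS0 : TableBound a S ∅)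
    {r : ℕ} (hr : s.reg 35 = r) (htab : NodeTable n a s r B Finset.univ) :
    Does forgetProg s (11000 * (S + 1) ^ 3 * (n + 1) ^ 2 + 12 * N) fun s' => ∃ m,
      Represents a ∅ (IsCutOf Finset.univ) (fun i => cutAt n (s'.arr 4) (s'.reg 8 + i * n)) m := by
  refine Does.set_seq (Does.seq (emptyTableProg_spec (n := n) (by simpa using hn) hn0 a ∅)
    fun s₁ f₁ ⟨h1, h2, h3⟩ => Does.set_seq (Does.set_seq (Does.set_seq (Does.set_seq
      (Does.set_seq (Does.seq (mulProg_spec (b := N) ?_ (by simp) (by simp))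
        fun s₂ f₂ h₂ => Does.set_seq ?_))))))
  · simp [f₁.reg 1 rfl, hN]
  simp only [RamState.reg_setReg, RamState.arr_setReg, RamExpr.eval, Nat.reduceEqDiff, if_false]
    at h1 h2 h3
  have r35 : s₁.reg 35 = r := by rw [f₁.reg 35 rfl]; simp [hr]
  have r33 : s₁.reg 33 = s.reg 2 := by rw [f₁.reg 33 rfl]; simp
  have r0 : s₁.reg 0 = n := by rw [f₁.reg 0 rfl]; simp [hn]
  have r1 : s₁.reg 1 = N := by rw [f₁.reg 1 rfl]; simp [hN]
  have b1 : s₁.arr 1 = s.arr 1 := by rw [f₁.arr 1 rfl]; simp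
  have b3 : s₁.arr 3 = s.arr 3 := by rw [f₁.arr 3 rfl]; simp
  have b5 : s₁.arr 5 = s.arr 5 := by rw [f₁.arr 5 rfl]; simp
  have b6 : s₁.arr 6 = s.arr 6 := by rw [f₁.arr 6 rfl]; simp
  have q0 : s₂.reg 0 = n := by rw [f₂.reg 0 rfl]; simp [r0]
  have q2 : s₂.reg 2 = s₁.reg 2 := by rw [f₂.reg 2 rfl]; simp
  have q4 : s₂.reg 4 = s.arr 5 r := by rw [f₂.reg 4 rfl]; simp [r35, b5]
  have q5 : s₂.reg 5 = s.arr 6 r := by rw [f₂.reg 5 rfl]; simp [r35, b6]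
  have q6 : s₂.reg 6 = s.reg 2 := by rw [f₂.reg 6 rfl]; simp [r33]
  have q7 : s₂.reg 7 = s₁.reg 2 := by rw [f₂.reg 7 rfl]; simp
  have q10 : s₂.reg 10 = N * n := by rw [h₂]; simp [r1, r0]
  have qa : ∀ i, s₂.arr i = s₁.arr i := fun i => f₂.arr i rfl
  refine ((joinProg_spec (n := n) (S := S) (a := a) (B := ∅) (B₁ := B) (B₂ := ∅)
    (U₁ := Finset.univ) (U₂ := ∅) (by simpa using q0) hn0 (by simp [qa, b1, ha]) hsymm
    (by simp [qa, b3, q10, hbag]) ?_ ?_ ?_ ?_ hS0 hS hS0 (by simp) (by simp) (by simp) (by simp)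
    (by simp)).mono ?_).conseq fun s₃ f₃ ⟨k1, k2, k3, m, k4, k5⟩ => ⟨m, ?_⟩
  · simpa [q4, q5, qa] using htab.1.congr fun k hk => h1 k (lt_of_lt_of_le hk htab.2)
  · simpa [q6, q7, qa] using h3
  · simpa [q5, q2] using htab.2.trans h2
  · simp [q7, q2]
  · have := succ_le_pow_mul S n
    simp only [mul_assoc, RamExpr.cost]
    omega
  · rw [k1]
    simpa using k5

/-- The program for graphs with a weighted degree of at least two. -/
def treeProg : RamProgram :=
  .seq (forTo 30 1 initNodeProg) <| .seq contractProg <| .seq forgetProg outputProg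

variable {n N : ℕ} {G : SimpleGraph (Fin n)} {w : Sym2 (Fin n) → ℕ}
  {D : TreeDecomposition G (Fin N)}

theorem matrixOf_inputState : matrixOf n ((inputState G w D).arr 1) = weightMatrix G w := by
  classical
  funext v u
  simp only [matrixOf, inputState]
  rw [rowMajor_apply]
  rfl

theorem tree_inputState (t p : Fin N) :
    (inputState G w D).arr 2 (t * N + p) ≠ 0 ↔ D.tree.Adj t p := by
  simp only [inputState]
  rw [rowMajor_apply]
  simp

theorem bagAt_inputState (t : Fin N) :
    bagAt n ((inputState G w D).arr 3) (t * n) = D.bag t := by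
  ext v
  simp only [bagAt, Finset.mem_filter, Finset.mem_univ, true_and, inputState]
  rw [rowMajor_apply]
  simp

/-- The incidence array is zero behind the matrix, so the row after the last one serves as an empty
bag. -/
theorem bagAt_inputState_end : bagAt n ((inputState G w D).arr 3) (N * n) = ∅ := by
  ext v
  have : (inputState G w D).arr 3 (N * n + v) = 0 := by
    simp only [inputState, rowMajor]
    rw [dif_neg (by omega)]
  simp [bagAt, this]

theorem treeProg_spec {S : ℕ} {s : RamState} (hn0 : 0 < n)
    (hreg : s.reg 0 = n ∧ s.reg 1 = N ∧ s.reg 2 = 0) (harr : s.arr = (inputState G w D).arr)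
    (hS : ∀ t : Fin N, TableBound (weightMatrix G w) S (D.bag t))
    (hS0 : TableBound (weightMatrix G w) S ∅)
    (hS1 : ∀ v, TableBound (weightMatrix G w) S {v}) :
    Does treeProg s (70000 * (S + 1) ^ 3 * (n + N) ^ 4) fun s' =>
      ∃ c : Fin n → Bool, Outputs s' c ∧ IsMinStableCut G w c := by
  obtain ⟨h0, h1, h2⟩ := hreg
  have hNpos : 0 < N := by
    obtain ⟨t⟩ := D.isTree.connected.nonempty
    exact t.pos
  have hsymm := weightMatrix_comm G w
  have hT : 6 + N * (20000 * (S + 1) ^ 3 * (n + 1) ^ 3 + 12 * N + 8) +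
      (11000 * (S + 1) ^ 3 * (n + 1) ^ 2 + 300 * (N + 1) ^ 2) * (N + 1) +
      (11000 * (S + 1) ^ 3 * (n + 1) ^ 2 + 12 * N) + 20 * (n + 1) ≤
      70000 * (S + 1) ^ 3 * (n + N) ^ 4 := by
    -- Both `n` and `N` are positive, so `n + 1` and `N + 1` are at most `M`, and every term is
    -- bounded by a multiple of `X * M ^ 4`.
    set M := n + N with hM
    have hX : 1 ≤ (S + 1) ^ 3 := Nat.one_le_pow _ _ (by omega)
    set X := (S + 1) ^ 3
    have hn' : n + 1 ≤ M := by omega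
    have hN' : N + 1 ≤ M := by omega
    have hNM : N ≤ M := by omega
    have hM2 : 1 ≤ M := by omega
    have p2 : (n + 1) ^ 2 ≤ M ^ 2 := Nat.pow_le_pow_left hn' 2
    have p3 : (n + 1) ^ 3 ≤ M ^ 3 := Nat.pow_le_pow_left hn' 3
    have p2' : (N + 1) ^ 2 ≤ M ^ 2 := Nat.pow_le_pow_left hN' 2
    have m4 : ∀ k ≤ 4, M ^ k ≤ X * M ^ 4 := fun k hk => by
      calc M ^ k = 1 * M ^ k := by ring
        _ ≤ X * M ^ 4 := Nat.mul_le_mul hX (Nat.pow_le_pow_right hM2 hk)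
    have x4 : ∀ k ≤ 4, X * M ^ k ≤ X * M ^ 4 := fun k hk =>
      Nat.mul_le_mul_left _ (Nat.pow_le_pow_right hM2 hk)
    calc _ ≤ 6 + M * (20000 * X * M ^ 3 + 12 * M + 8) + (11000 * X * M ^ 2 + 300 * M ^ 2) * M +
          (11000 * X * M ^ 2 + 12 * M) + 20 * M := by gcongr
      _ = 20000 * (X * M ^ 4) + 11000 * (X * M ^ 3) + 11000 * (X * M ^ 2) + 300 * M ^ 3 +
          12 * M ^ 2 + 40 * M ^ 1 + 6 * M ^ 0 := by ring
      _ ≤ 20000 * (X * M ^ 4) + 11000 * (X * M ^ 4) + 11000 * (X * M ^ 4) + 300 * (X * M ^ 4) +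
          12 * (X * M ^ 4) + 40 * (X * M ^ 4) + 6 * (X * M ^ 4) := by
        gcongr ?_ + 11000 * ?_ + 11000 * ?_ + 300 * ?_ + 12 * ?_ + 40 * ?_ + 6 * ?_
        · exact le_rfl
        · exact x4 3 (by omega)
        · exact x4 2 (by omega)
        · exact m4 3 (by omega)
        · exact m4 2 (by omega)
        · exact m4 1 (by omega)
        · exact m4 0 (by omega)
      _ ≤ 70000 * X * M ^ 4 := by
        have := Nat.zero_le (X * M ^ 4)
        rw [mul_assoc]
        omega
  refine Does.seq (T' := 6 + N * (20000 * (S + 1) ^ 3 * (n + 1) ^ 3 + 12 * N + 8))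
    (Does.forTo (m := N) (fun k s' => ∀ t : Fin N, (t : ℕ) < k →
      NodeTable n (weightMatrix G w) s' t (D.bag t) (D.bag t))
    (20000 * (S + 1) ^ 3 * (n + 1) ^ 3 + 12 * N) h1 le_rfl (by simp) ?_ fun s' _ h => h)
    fun s₁ f₁ g₁ => ?_
  · intro k hk s' hs hi hI
    have a1 : matrixOf n (s'.arr 1) = weightMatrix G w := by
      rw [hs.arr 1 rfl, harr, matrixOf_inputState]
    refine (initNodeProg_spec (S := S) (t := k) (B := D.bag ⟨k, hk⟩) (by rw [hs.reg 0 rfl, h0]) hn0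
      a1 hsymm hi hk (by rw [hs.arr 3 rfl, harr]; exact bagAt_inputState ⟨k, hk⟩) (hS _)
      hS1).conseq fun s'' f'' ⟨q1, q2, q3, q4⟩ t ht => ?_
    rcases Nat.lt_succ_iff_lt_or_eq.1 ht with ht | ht
    · have := (hI t ht).congr q1 q2 (q3 t ht.ne).1 (q3 t ht.ne).2
      simpa [NodeTable] using this
    · obtain rfl : t = ⟨k, hk⟩ := Fin.ext ht
      simpa [NodeTable] using q4
  · have b1 : matrixOf n (s₁.arr 1) = weightMatrix G w := by
      rw [f₁.arr 1 rfl, harr, matrixOf_inputState]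
    have b3 : s₁.arr 3 = (inputState G w D).arr 3 := by rw [f₁.arr 3 rfl, harr]
    refine Does.seq (contractProg_spec (D := D) (S := S) (by rw [f₁.reg 0 rfl, h0]) hn0
      (by rw [f₁.reg 1 rfl, h1]) b1 hsymm (fun u v h => if_neg h)
      (fun t p => by rw [f₁.arr 2 rfl, harr]; exact tree_inputState t p)
      (fun t => by rw [b3]; exact bagAt_inputState t) hS
      (fun t => by rw [f₁.arr 7 rfl, harr]; rfl) fun t => g₁ t t.2) fun s₂ f₂ ⟨r, hr, htab⟩ => ?_
    refine Does.seq (forgetProg_spec (S := S) (N := N) (B := D.bag r)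
      (by rw [f₂.reg 0 rfl, f₁.reg 0 rfl, h0]) hn0
      (by rw [f₂.reg 1 rfl, f₁.reg 1 rfl, h1]) (by rw [f₂.arr 1 rfl, b1]) hsymm
      (by rw [f₂.arr 3 rfl, b3]; exact bagAt_inputState_end) (hS r) hS0 hr htab)
      fun s₃ f₃ ⟨m, hm⟩ => ?_
    refine ((outputProg_spec (n := n) (by rw [f₃.reg 0 rfl, f₂.reg 0 rfl, f₁.reg 0 rfl, h0])).mono
      (by omega)).conseq fun s₄ f₄ h₄ => ?_
    obtain ⟨hc, hst, hmin⟩ := hm.final hsymm (weightMatrix_self G w)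
    simp only [zero_mul, add_zero] at hc hst hmin
    set c₀ := cutAt n (s₃.arr 4) (s₃.reg 8) with hc₀
    have hc₀' := eq_one_add_toNat hc
    refine ⟨fun v => decide (c₀ v = 2), fun v => ?_, ?_⟩
    · have e : c₀ v = s₃.arr 4 (s₃.reg 8 + v) := rfl
      rw [h₄ v v.2, ← e]
      have := congrFun hc₀' v
      change 1 + (decide (c₀ v = 2)).toNat = c₀ v at this
      change _ = (decide (c₀ v = 2)).toNat
      omega
    · refine isMinStableCut_of_totalCrossing G w _ (by rwa [hc₀']) fun c' hc' => ?_
      rw [hc₀']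
      exact hmin _ (isCutOf_univ c') hc'

/-- The program of the theorem. -/
def mainProg : RamProgram :=
  .seq checkProg <| .ite (.reg 47) treeProg matchingProg

/-- The table bound is required only in the branch that builds tables. The graph without vertices
takes the other branch, as the loops over blocks of length `n` need `n` positive. -/
theorem mainProg_spec {S : ℕ}
    (hS : (∃ v, 1 < ∑ u, weightMatrix G w v u) →
      (∀ t : Fin N, TableBound (weightMatrix G w) S (D.bag t)) ∧
      TableBound (weightMatrix G w) S ∅ ∧ ∀ v, TableBound (weightMatrix G w) S {v}) :
    Does mainProg (inputState G w D) (80000 * (S + 1) ^ 3 * (n + N) ^ 4) fun s' =>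
      ∃ c : Fin n → Bool, Outputs s' c ∧ IsMinStableCut G w c := by
  have hNpos : 0 < N := by
    obtain ⟨t⟩ := D.isTree.connected.nonempty
    exact t.pos
  have hT : 100 * (n + 1) ^ 2 + 70000 * (S + 1) ^ 3 * (n + N) ^ 4 + 2 ≤
      80000 * (S + 1) ^ 3 * (n + N) ^ 4 := by
    have h1 : (n + 1) ^ 2 ≤ (n + N) ^ 4 :=
      (Nat.pow_le_pow_left (by omega) 2).trans (Nat.pow_le_pow_right (by omega) (by omega))
    have h2 : 1 * (n + N) ^ 4 ≤ (S + 1) ^ 3 * (n + N) ^ 4 :=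
      Nat.mul_le_mul_right _ (Nat.one_le_pow _ _ (by omega))
    have h3 : 1 ≤ (n + 1) ^ 2 := Nat.one_le_pow _ _ (by omega)
    simp only [mul_assoc]
    omega
  have hT' : 100 * (n + 1) ^ 2 ≤ 70000 * (S + 1) ^ 3 * (n + N) ^ 4 := by
    have h1 : (n + 1) ^ 2 ≤ (n + N) ^ 4 :=
      (Nat.pow_le_pow_left (by omega) 2).trans (Nat.pow_le_pow_right (by omega) (by omega))
    have h2 : 1 * (n + N) ^ 4 ≤ (S + 1) ^ 3 * (n + N) ^ 4 :=
      Nat.mul_le_mul_right _ (Nat.one_le_pow _ _ (by omega))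
    simp only [mul_assoc]
    omega
  refine Does.seq (checkProg_spec (n := n) rfl) fun s₁ f₁ h₁ => ?_
  rw [matrixOf_inputState] at h₁
  have e : s₁.arr = (inputState G w D).arr := by
    funext i
    exact f₁.arr i rfl
  refine Does.ite (fun hx => ?_) fun hx => ?_
  · have hex := h₁.1 hx
    obtain ⟨hS, hS0, hS1⟩ := hS hex
    refine (treeProg_spec (D := D) (S := S) ?_ ⟨?_, ?_, ?_⟩ e hS hS0 hS1).mono ?_
    · obtain ⟨v, -⟩ := hex
      exact v.pos
    · rw [f₁.reg 0 rfl]; rfl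
    · rw [f₁.reg 1 rfl]; rfl
    · rw [f₁.reg 2 rfl]; rfl
    · simp only [RamExpr.cost]
      omega
  · have hle : ∀ v, ∑ u, weightMatrix G w v u ≤ 1 := fun v => by
      by_contra h
      exact h₁.2 ⟨v, by omega⟩ hx
    refine ((matchingProg_spec (n := n) (by rw [f₁.reg 0 rfl]; rfl)).mono ?_).conseq
      fun s₂ f₂ ⟨c, h1, h2⟩ => ⟨c, h1, ?_⟩
    · simp only [RamExpr.cost]
      omega
    · rw [e, matrixOf_inputState] at h2
      exact isMinStableCut_of_weightedDegree_le_one G w hle c h2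

theorem tableBound_pow (B : Finset (Fin n)) {k : ℕ} (hB : B.card ≤ k) :
    TableBound (weightMatrix G w) ((3 * (maxDeg G * maxWeight G w + 1)) ^ k) B := by
  intro Q E m hQ h
  exact (h.length_le hQ (sum_weightMatrix_le G w)).trans (Nat.pow_le_pow_right (by omega) hB)

theorem card_bag_le (t : Fin N) : (D.bag t).card ≤ D.width + 1 := by
  have : (D.bag t).card ≤ Finset.univ.sup fun t => (D.bag t).card :=
    Finset.le_sup (f := fun t => (D.bag t).card) (Finset.mem_univ t)
  unfold TreeDecomposition.width
  omega

theorem one_le_width (h : ∃ u v, G.Adj u v) : 1 ≤ D.width := by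
  obtain ⟨u, v, h⟩ := h
  obtain ⟨t, hu, hv⟩ := D.edge_mem_bag u v h
  have h2 : 1 < (D.bag t).card := Finset.one_lt_card.2 ⟨u, hu, v, hv, h.ne⟩
  have := card_bag_le (D := D) t
  omega

/-- A weighted degree of at least two gives `2 ≤ X`, whence `3 * (X + 1) ≤ X ^ 4`, and an edge,
whence `1 ≤ D.width` and `D.width + 1 ≤ 2 * D.width`. This is how the factor `3` and the extra `1`
in the exponent are absorbed. -/
theorem exists_tableBound : ∃ S, S + 1 ≤ 2 * max 1 (maxDeg G * maxWeight G w) ^ (8 * D.width) ∧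
    ((∃ v, 1 < ∑ u, weightMatrix G w v u) →
      (∀ t : Fin N, TableBound (weightMatrix G w) S (D.bag t)) ∧
      TableBound (weightMatrix G w) S ∅ ∧ ∀ v, TableBound (weightMatrix G w) S {v}) := by
  set X := maxDeg G * maxWeight G w with hX
  by_cases hex : ∃ v, 1 < ∑ u, weightMatrix G w v u
  · have hX2 : 2 ≤ X := by
      obtain ⟨v, hv⟩ := hex
      have := sum_weightMatrix_le G w v
      omega
    have hw : 1 ≤ D.width := by
      obtain ⟨v, hv⟩ := hex
      obtain ⟨u, -, hu⟩ := Finset.exists_ne_zero_of_sum_ne_zero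
        (by omega : ∑ u, weightMatrix G w v u ≠ 0)
      refine one_le_width ⟨v, u, ?_⟩
      by_contra h
      exact hu (if_neg h)
    refine ⟨(3 * (X + 1)) ^ (D.width + 1), ?_, fun _ => ⟨fun t => tableBound_pow _ (card_bag_le t),
      tableBound_pow _ (by simp), fun v => tableBound_pow _ (by simp)⟩⟩
    have h4 : 3 * (X + 1) ≤ X ^ 4 := by
      have h1 : 2 ^ 3 ≤ X ^ 3 := Nat.pow_le_pow_left hX2 3
      have h2 : X ^ 4 = X ^ 3 * X := by ring
      rw [h2]
      nlinarith
    have h8 : (3 * (X + 1)) ^ (D.width + 1) ≤ X ^ (8 * D.width) := by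
      calc (3 * (X + 1)) ^ (D.width + 1) ≤ (X ^ 4) ^ (D.width + 1) := Nat.pow_le_pow_left h4 _
        _ = X ^ (4 * (D.width + 1)) := by rw [← pow_mul]
        _ ≤ X ^ (8 * D.width) := Nat.pow_le_pow_right (by omega) (by omega)
    have h1 : 1 ≤ X ^ (8 * D.width) := Nat.one_le_pow _ _ (by omega)
    rw [max_eq_right (by omega : 1 ≤ X)]
    omega
  -- No tables are built in this case, so there is nothing to bound.
  · refine ⟨0, ?_, fun h => absurd h hex⟩
    have : 1 ≤ max 1 X ^ (8 * D.width) := Nat.one_le_pow _ _ (by omega)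
    omega

end MainProgram

end MinStableCut

theorem theorem3p5 :
    ∃ (p : MinStableCut.RamProgram) (C : ℕ),
      ∀ (n N : ℕ) (G : SimpleGraph (Fin n)) (w : Sym2 (Fin n) → ℕ)
        (D : MinStableCut.TreeDecomposition G (Fin N)),
        ∃ (s : MinStableCut.RamState) (t : ℕ) (c : Fin n → Bool),
          MinStableCut.Runs p (MinStableCut.inputState G w D) s t ∧
          MinStableCut.Outputs s c ∧
          MinStableCut.IsMinStableCut G w c ∧
          t ≤ C * (max 1 (MinStableCut.maxDeg G * MinStableCut.maxWeight G w)) ^ (C * D.width) *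
            (n + N) ^ C := by
  -- The constant is `8 * 80000`, where `8` comes from cubing the factor `2` in the bound on `S +
  -- 1`. As an exponent it is far larger than the `24` and `4` that are needed.
  refine ⟨MinStableCut.mainProg, 640000, fun n N G w D => ?_⟩
  obtain ⟨S, hS, hbound⟩ := MinStableCut.exists_tableBound (G := G) (w := w) (D := D)
  obtain ⟨s, t, hr, ht, c, hc, hmin⟩ := MinStableCut.mainProg_spec (D := D) hbound
  refine ⟨s, t, c, hr, hc, hmin, ht.trans ?_⟩
  have hNpos : 0 < N := by
    obtain ⟨t⟩ := D.isTree.connected.nonempty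
    exact t.pos
  set X := max 1 (MinStableCut.maxDeg G * MinStableCut.maxWeight G w) with hX
  have h1 : (S + 1) ^ 3 ≤ 8 * X ^ (24 * D.width) := by
    calc (S + 1) ^ 3 ≤ (2 * X ^ (8 * D.width)) ^ 3 := Nat.pow_le_pow_left hS 3
      _ = 8 * X ^ (24 * D.width) := by
        rw [mul_pow, ← pow_mul]
        ring_nf
  have h2 : X ^ (24 * D.width) ≤ X ^ (640000 * D.width) :=
    Nat.pow_le_pow_right (by omega) (by omega)
  have h3 : (n + N) ^ 4 ≤ (n + N) ^ 640000 :=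
    Nat.pow_le_pow_right (Nat.add_pos_right n hNpos) (by norm_num)
  refine Nat.mul_le_mul ?_ h3
  omega
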